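/- **Setting.** A loopless multigraph $G$ on the vertex set $\{0,\dots,n-1\}$, of maximum degree at most $\Delta$, arrives as a stream $E$ of its edges in arbitrary (adversarial) order; $\Delta$ is known. Let $D=4^a$ be the least power of $4$ with $D\ge\Delta$, so that $\sqrt D=2^a$, and let $\kappa\ge 32$ be a constant integer. Memory is counted in words. **One recursion level**, with input stream $S$. If $|S|\le n$, then $S$ is stored and colored by first-fit with fresh colors, and there are no leftover edges. Otherwise $S$ is cut into consecutive intervals of $n$ edges (the last one may be shorter), and $\sqrt D$ consecutive intervals form a phase. At the beginning of a phase all data are reset and every vertex $v$ draws a uniform offset $r_v\in[0,2\kappa D)$; in every interval a uniform $\sigma\in[0,\kappa\sqrt D)$ is drawn; all draws are independent. For each threshold $d=2^k\ge\sqrt D$, each phase has its own disjoint palettes $A^d_i,B^d_i,C^d_i$, $0\le i<N_d=\kappa D/d$, each with $K_d=2\kappa d$ colors indexed by $0,\dots,K_d-1$. At threshold $d$ one uses the index $i=\sigma \bmod N_d$ and the offsets $r_v\bmod K_d$. Let $\deg$ be the degree in the graph of the current interval. For a threshold $d$, a vertex is high if $\deg\in[d,2d)$ and low if $\deg<d$;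 the threshold $d$ takes care of the edges whose larger end point degree lies in $[d,2d)$. The interval is processed as follows. * Edges with both end point degrees below $\sqrt D$ are colored by first-fit from a fresh palette of the interval. * (1) A high vertex $v$ is blocked if the index $i$ was already used at threshold $d$ in an earlier interval of the phase in which $v$ was high for $d$. Edges of threshold $d$ with a blocked end point that is high for $d$ are left over. The other edges between two high vertices are colored by first-fit with colors of $A^d_i$. * (2) Counters $c_u[j]\in\{\bot\}\cup\mathbb N$, $0\le j<\kappa\sqrt D$, are kept in one array common to all thresholds, with value $\bot$ at the beginning of a phase; $c_u[\sigma]=\bot$ is set to $0$ if $\deg u>\sqrt D$. The mixed edges (one low end point $u$, one high end point $v$) are enumerated in the order of $u$, then of $v$. Consider the $b$-th mixed edge at $u$ ($b\ge 0$), with threshold $d$; if it was left over in (1) it is skipped. If $\delta=(r_v-r_u)\bmod K_d$ satisfies $\delta<2d$ or $\delta>K_d-2d$, the edge is left over. Otherwise, if $c_u[\sigma]\ne\bot$, let $c=b+\sum_{j\equiv\sigma\ (N_d)}c_u[j]$, where $\bot$ counts as $0$ and the values are those at the start of the enumeration; the edge is left over if $c\ge 2d$, and else tries the color $(r_u+c)\bmod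 K_d$ of $C^d_i$. If $c_u[\sigma]=\bot$, let $p$ be the number of earlier intervals of the phase with the same index $i$ at threshold $d$; the edge is left over if $p\ge 2d/\sqrt D$, and else tries the color $(r_u+b+\sqrt D\,p)\bmod K_d$ of $B^d_i$. If the color it tries was already given in this interval to a mixed edge incident to $v$, the edge is left over; otherwise it gets this color. Afterwards each $c_u[\sigma]\neq\bot$ grows by the number of mixed edges with low end point $u$. The leftover edges form, in the order in which they are produced, the virtual stream that is the input of the next level, which uses fresh colors and independent randomness; the given stream $E$ is the input of level $0$. The memory of a level is the maximum, over its intervals, of the number of words for: the edges of the interval and one color for each, a degree table of size $n$, the $n$ offsets, the number of the current interval, the number of occurrences of each $\sigma$ drawn in the phase (not recorded if $n<\sqrt D$, where it is never needed), the recorded triples (threshold, high vertex, index) of the phase, and the counters different from $\bot$. A level that stores its whole input $S$ uses $2|S|$ words. The total memory is the sum over all levels. The depth is the number of levels with nonempty input. **Theorem.** For every integer $\kappa\ge 32$ there are constants $C,q$ depending only on $\kappa$ such that for all $n$, $\Delta$ and every such stream $E$: 1. For every outcome of the random choices, only edges of $E$ are colored, no edge gets two colors, and no two adjacent edges get the same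 color; if the depth is finite, then every edge of $E$ is colored, so that the output is a proper edge coloring of $G$. The depth is finite with probability $1$. 2. For every recursion level and every fixed stream $S$: conditional on $S$ being the input of this level, the expected number of edges that the level leaves over is at most $7|S|/\kappa$. 3. The expected depth is at most $C\log(\Delta+1)$, that is, $O(\log\Delta)$. 4. The expected number of colors is at most $C\,\Delta^{1.5}\log^q(\Delta+1)$, that is, $\tilde O(\Delta^{1.5})$. 5. The expected total memory is at most $C\,n\log(\Delta+1)$ words, that is, $O(n\log\Delta)$. -/

import Mathlib

open MeasureTheory
open scoped ENNReal

namespace StreamColoring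

/-! ### Multigraphs presented as edge streams -/

/-- An edge of a multigraph on the vertex set `Fin n`. The pair of end points is to be read as
unordered; the label `copy` tells parallel edges apart. -/
structure Edge (n : ℕ) where
  src : Fin n
  tgt : Fin n
  copy : ℕ

/-- `v` is an end point of `e`. -/
def Edge.Inc {n : ℕ} (e : Edge n) (v : Fin n) : Prop := e.src = v ∨ e.tgt = v

/-- The two edges share an end point. -/
def Edge.Adj {n : ℕ} (e f : Edge n) : Prop := ∃ v, e.Inc v ∧ f.Inc v

open scoped Classical in
/-- Degree of `v` in the multigraph formed by the edges of the list `L`. -/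
noncomputable def deg {n : ℕ} (L : List (Edge n)) (v : Fin n) : ℕ :=
  L.countP (fun e => e.Inc v)

/-- `E` lists, in an arbitrary order, the edges of a loopless multigraph on `n` vertices of
maximum degree at most `Δ`. -/
structure IsStream {n : ℕ} (E : List (Edge n)) (Δ : ℕ) : Prop where
  nodup : E.Nodup
  loopless : ∀ e ∈ E, e.src ≠ e.tgt
  deg_le : ∀ v, deg E v ≤ Δ

/-- Colors are labelled by where their palette was created, so that palettes created at different
places are disjoint. -/
inductive Color where
  /-- palette of a recursion level whose whole input fits in memory -/
  | base (level idx : ℕ)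
  /-- palette created for one interval, for the edges between vertices of small degree -/
  | small (level interval idx : ℕ)
  /-- the palettes `A_i`, `B_i`, `C_i` of a phase at the degree threshold `2 ^ k` -/
  | A (level phase k i idx : ℕ)
  | B (level phase k i idx : ℕ)
  | C (level phase k i idx : ℕ)

/-- First-fit: the smallest number not given to an adjacent edge that is already colored. -/
noncomputable def firstFit {n : ℕ} (acc : List (Edge n × ℕ)) (e : Edge n) : ℕ :=
  sInf {c : ℕ | ∀ p ∈ acc, p.1.Adj e → p.2 ≠ c}

/-- First-fit coloring of an edge list that is held in memory. -/
noncomputable def greedy {n : ℕ} (L : List (Edge n)) : List (Edge n × ℕ) :=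
  L.foldl (fun acc e => acc ++ [(e, firstFit acc e)]) []

/-! ### One interval

Below, `2 ^ a` and `4 ^ a` play the roles of `√Δ` and `Δ`, and `I` is the list of edges of the
current interval. The degree thresholds are `d = 2 ^ k`. A vertex is high-degree for the threshold
`2 ^ k` when its degree lies in `[2 ^ k, 2 ^ (k+1))`, that is, when `scale I v = k`. -/

/-- The exponent `k` for which the degree of `v` in `I` lies in `[2 ^ k, 2 ^ (k+1))`. -/
noncomputable def scale {n : ℕ} (I : List (Edge n)) (v : Fin n) : ℕ := Nat.log 2 (deg I v)

/-- The exponent of the threshold that is responsible for the edge `e`. -/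
noncomputable def edgeScale {n : ℕ} (I : List (Edge n)) (e : Edge n) : ℕ :=
  max (scale I e.src) (scale I e.tgt)

/-- Both end points have degree below `√Δ` in the interval. -/
def IsSmall {n : ℕ} (a : ℕ) (I : List (Edge n)) (e : Edge n) : Prop :=
  deg I e.src < 2 ^ a ∧ deg I e.tgt < 2 ^ a

/-- `e` joins two high-degree vertices, for one and the same threshold that is at least `√Δ`. -/
def IsHigh {n : ℕ} (a : ℕ) (I : List (Edge n)) (e : Edge n) : Prop :=
  ¬ IsSmall a I e ∧ scale I e.src = scale I e.tgt

/-- `e` joins the low-degree vertex `u` to the high-degree vertex `v`, for the threshold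
`2 ^ scale I v ≥ √Δ`. -/
def IsMixed {n : ℕ} (a : ℕ) (I : List (Edge n)) (u v : Fin n) (e : Edge n) : Prop :=
  ((e.src = u ∧ e.tgt = v) ∨ (e.src = v ∧ e.tgt = u)) ∧
    2 ^ a ≤ deg I v ∧ scale I u < scale I v

/-- Number `κ Δ / d` of palettes of each kind at the threshold `d = 2 ^ k`. -/
def numPal (κ a k : ℕ) : ℕ := κ * 4 ^ a / 2 ^ k

/-- Size `K = 2 κ d` of each palette at the threshold `d = 2 ^ k`. -/
def palSize (κ k : ℕ) : ℕ := 2 * κ * 2 ^ k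

/-- The fresh randomness available in one interval: the index `σ`, and one offset per vertex (the
offsets are used only in the first interval of a phase). Reduced modulo `numPal κ a k` and
`palSize κ k`, which are divisors of the two ranges if `a ≤ k ≤ 2 * a`, they are uniform indices
and offsets for the threshold `2 ^ k`. -/
abbrev Seed (n κ a : ℕ) : Type := Fin (κ * 2 ^ a) × (Fin n → Fin (2 * κ * 4 ^ a))

/-- Everything that a recursion level remembers from one interval to the next. -/
structure State (n κ a : ℕ) where
  /-- number of intervals processed so far -/
  interval : ℕ
  /-- the random offsets `r_v` of the current phase -/
  offset : Fin n → ℕ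
  /-- how often each index `σ` was drawn in the current phase -/
  hits : Fin (κ * 2 ^ a) → ℕ
  /-- the sets `I_v`: `(k, v, i)` is present if `v` was high-degree for the threshold `2 ^ k` in an
  earlier interval of the phase, with palette index `i` -/
  used : Finset (ℕ × Fin n × ℕ)
  /-- the counters `c_u`; `none` stands for `⊥` -/
  ctr : Fin n → Fin (κ * 2 ^ a) → Option ℕ

open scoped Classical in
/-- Number of memory words taken by a state. Counters that are zero in `hits` or `⊥` in `ctr` are
not stored. -/
noncomputable def State.words {n κ a : ℕ} (st : State n κ a) : ℕ :=
  1 + n + (Finset.univ.filter (fun j => st.hits j ≠ 0)).card + st.used.card +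
    (Finset.univ.filter (fun x : Fin n × Fin (κ * 2 ^ a) => st.ctr x.1 x.2 ≠ none)).card

/-- The state before the first interval. -/
def State.init (n κ a : ℕ) : State n κ a where
  interval := 0
  offset := fun _ => 0
  hits := fun _ => 0
  used := ∅
  ctr := fun _ _ => none

/-- A phase consists of `√Δ` intervals; at its beginning everything is reset, and the offsets are
drawn. -/
def State.openPhase {n κ a : ℕ} (st : State n κ a) (seed : Seed n κ a) : State n κ a :=
  if st.interval % 2 ^ a = 0 then
    { State.init n κ a with
      interval := st.interval
      offset := fun v => (seed.2 v : ℕ) }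
  else st

open scoped Classical in
/-- The counters `c_u[σ]` of all vertices `u` of degree more than `√Δ` in the interval are
initialized to `0`, unless they have been before. -/
noncomputable def State.openCounters {n κ a : ℕ} (st : State n κ a) (I : List (Edge n))
    (σ : Fin (κ * 2 ^ a)) : State n κ a :=
  { st with
    ctr := fun u j =>
      if j = σ ∧ 2 ^ a < deg I u ∧ st.ctr u j = none then some 0 else st.ctr u j }

/-- The palette index `σ_l` at the threshold `2 ^ k`. -/
def palIdx {κ a : ℕ} (σ : Fin (κ * 2 ^ a)) (k : ℕ) : ℕ := σ % numPal κ a k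

/-- The offset `r_v ∈ [0, K)` at the threshold `2 ^ k`. -/
def State.off {n κ a : ℕ} (st : State n κ a) (k : ℕ) (v : Fin n) : ℕ :=
  st.offset v % palSize κ k

open scoped Classical in
/-- `p_l[σ_l]` at the threshold `2 ^ k`: the number of earlier intervals of the phase with the same
palette index. -/
noncomputable def State.repeats {n κ a : ℕ} (st : State n κ a) (σ : Fin (κ * 2 ^ a)) (k : ℕ) : ℕ :=
  ∑ j with palIdx j k = palIdx σ k, st.hits j

open scoped Classical in
/-- The value of the counter of `u` for the palette with index `σ_l` at the threshold `2 ^ k`. -/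
noncomputable def State.count {n κ a : ℕ} (st : State n κ a) (σ : Fin (κ * 2 ^ a)) (k : ℕ)
    (u : Fin n) : ℕ :=
  ∑ j with palIdx j k = palIdx σ k, (st.ctr u j).getD 0

/-- `e` is incident to a vertex `v` which is high-degree for the threshold responsible for `e`, and
for which `σ_l ∈ I_v`. -/
def State.Blocked {n κ a : ℕ} (st : State n κ a) (I : List (Edge n)) (σ : Fin (κ * 2 ^ a))
    (e : Edge n) : Prop :=
  ∃ v, e.Inc v ∧ 2 ^ a ≤ deg I v ∧ scale I v = edgeScale I e ∧
    (scale I v, v, palIdx σ (scale I v)) ∈ st.used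

/-- An edge from a low-degree vertex `low` to a high-degree vertex `high`; it is the `rank`-th such
edge at `low`, counted from `0`. -/
structure MixedItem (n : ℕ) where
  low : Fin n
  high : Fin n
  edge : Edge n
  rank : ℕ

open scoped Classical in
/-- The mixed edges at the low-degree vertex `u`, ordered by their high-degree end point. -/
noncomputable def mixedAt {n : ℕ} (a : ℕ) (I : List (Edge n)) (u : Fin n) :
    List (Edge n × Fin n) :=
  (List.finRange n).flatMap fun v => (I.filter (fun e => IsMixed a I u v e)).map fun e => (e, v)

/-- All mixed edges, ordered by their low-degree end point, then by their high-degree end point. -/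
noncomputable def mixedItems {n : ℕ} (a : ℕ) (I : List (Edge n)) : List (MixedItem n) :=
  (List.finRange n).flatMap fun u =>
    (mixedAt a I u).zipIdx.map fun x => ⟨u, x.1.2, x.1.1, x.2⟩

/-- The color that the low-degree vertex proposes for a mixed edge, or `none` if the edge has to be
left over at once: because the offsets are too close, because the counter is full, or because the
palette index was drawn too often in this phase. The counter goes up by one with each mixed edge at
the low-degree vertex, hence the summand `x.rank`. -/
noncomputable def State.propose {n κ a : ℕ} (st : State n κ a) (level : ℕ) (I : List (Edge n))
    (σ : Fin (κ * 2 ^ a)) (x : MixedItem n) : Option Color :=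
  let k := scale I x.high
  let d := 2 ^ k
  let K := palSize κ k
  let phase := st.interval / 2 ^ a
  let δ := (st.off k x.high + K - st.off k x.low) % K
  if δ < 2 * d ∨ K - 2 * d < δ then none
  else
    match st.ctr x.low σ with
    | some _ =>
      let c := st.count σ k x.low + x.rank
      if 2 * d ≤ c then none
      else some (Color.C level phase k (palIdx σ k) ((st.off k x.low + c) % K))
    | none =>
      let p := st.repeats σ k
      if 2 * d ≤ p * 2 ^ a then none
      else some (Color.B level phase k (palIdx σ k) ((st.off k x.low + x.rank + 2 ^ a * p) % K))

open scoped Classical in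
/-- Treat one mixed edge; `acc` holds the mixed edges of this interval that are already colored, and
those that were left over. A blocked edge has been left over before. -/
noncomputable def State.mixedStep {n κ a : ℕ} (st : State n κ a) (level : ℕ) (I : List (Edge n))
    (σ : Fin (κ * 2 ^ a)) (acc : List (Edge n × Color) × List (Edge n)) (x : MixedItem n) :
    List (Edge n × Color) × List (Edge n) :=
  if st.Blocked I σ x.edge then acc
  else
    match st.propose level I σ x with
    | none => (acc.1, acc.2 ++ [x.edge])
    | some c =>
      if ∃ q ∈ acc.1, q.1.Inc x.high ∧ q.2 = c then (acc.1, acc.2 ++ [x.edge])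
      else (acc.1 ++ [(x.edge, c)], acc.2)

/-- What the processing of an interval produces: edges with their final color, edges for the virtual
stream, and the new state. -/
structure IntervalResult (n κ a : ℕ) where
  colored : List (Edge n × Color)
  leftover : List (Edge n)
  next : State n κ a

open scoped Classical in
/-- Process one interval: this uses only the remembered state, the edges of the interval, and fresh
randomness. If `n < √Δ` then no vertex has degree `√Δ` in an interval of `n` edges, and the drawn
indices are not recorded. -/
noncomputable def processInterval {n κ a : ℕ} (level : ℕ) (st₀ : State n κ a) (I : List (Edge n))
    (seed : Seed n κ a) : IntervalResult n κ a :=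
  let σ := seed.1
  let st := (st₀.openPhase seed).openCounters I σ
  let small := (greedy (I.filter fun e => IsSmall a I e)).map fun p =>
    (p.1, Color.small level st.interval p.2)
  let high := (greedy (I.filter fun e => IsHigh a I e ∧ ¬ st.Blocked I σ e)).map fun p =>
    (p.1, Color.A level (st.interval / 2 ^ a) (edgeScale I p.1) (palIdx σ (edgeScale I p.1)) p.2)
  let mixed := (mixedItems a I).foldl (st.mixedStep level I σ) ([], [])
  { colored := small ++ high ++ mixed.1
    leftover := (I.filter fun e => st.Blocked I σ e) ++ mixed.2
    next :=
      { interval := st.interval + 1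
        offset := st.offset
        hits := fun j => if j = σ ∧ 2 ^ a ≤ n then st.hits j + 1 else st.hits j
        used := st.used ∪ (Finset.univ.filter fun v => 2 ^ a ≤ deg I v).image
          fun v => (scale I v, v, palIdx σ (scale I v))
        ctr := fun u j =>
          if j = σ then (st.ctr u j).map (· + (mixedAt a I u).length) else st.ctr u j } }

/-! ### One recursion level -/

/-- The `l`-th interval of a stream: `n` consecutive edges (fewer in the last one). -/
def interval {n : ℕ} (S : List (Edge n)) (l : ℕ) : List (Edge n) := (S.drop (l * n)).take n

/-- Number of intervals: the length of the stream divided by `n`, rounded up. -/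
def numIntervals {n : ℕ} (S : List (Edge n)) : ℕ := (S.length + n - 1) / n

/-- State of the level with number `level` on the input stream `S` before the `l`-th interval. -/
noncomputable def stateAt {n κ a : ℕ} (level : ℕ) (S : List (Edge n)) (seeds : ℕ → Seed n κ a) :
    ℕ → State n κ a
  | 0 => State.init n κ a
  | l + 1 => (processInterval level (stateAt level S seeds l) (interval S l) (seeds l)).next

/-- Result of the `l`-th interval. -/
noncomputable def resultAt {n κ a : ℕ} (level : ℕ) (S : List (Edge n)) (seeds : ℕ → Seed n κ a)
    (l : ℕ) : IntervalResult n κ a :=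
  processInterval level (stateAt level S seeds l) (interval S l) (seeds l)

/-- The edges colored by a level. A stream of at most `n` edges is kept in memory and colored
directly. -/
noncomputable def levelColored {n κ a : ℕ} (level : ℕ) (S : List (Edge n))
    (seeds : ℕ → Seed n κ a) : List (Edge n × Color) :=
  if S.length ≤ n then (greedy S).map fun p => (p.1, Color.base level p.2)
  else (List.range (numIntervals S)).flatMap fun l => (resultAt level S seeds l).colored

/-- The virtual stream of leftover edges that a level hands to the next level. -/
noncomputable def levelLeftover {n κ a : ℕ} (level : ℕ) (S : List (Edge n))
    (seeds : ℕ → Seed n κ a) : List (Edge n) :=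
  if S.length ≤ n then []
  else (List.range (numIntervals S)).flatMap fun l => (resultAt level S seeds l).leftover

/-- Peak number of memory words of a level. While an interval is processed, the level holds the
edges of the interval with one color slot for each of them, a table of the vertex degrees, and its
state. (Within a phase the state only grows, so its size is read off after the interval.) -/
noncomputable def levelMemory {n κ a : ℕ} (level : ℕ) (S : List (Edge n))
    (seeds : ℕ → Seed n κ a) : ℕ :=
  if S.length ≤ n then 2 * S.length
  else (Finset.range (numIntervals S)).sup fun l =>
    2 * (interval S l).length + n + (resultAt level S seeds l).next.words

/-! ### The recursive algorithm -/

/-- The outcomes of all random choices: one seed for each recursion level and each interval. -/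
abbrev Outcome (n κ a : ℕ) : Type := ℕ × ℕ → Seed n κ a

/-- All seeds are independent and uniformly distributed. -/
noncomputable def law (n κ a : ℕ) [NeZero κ] : Measure (Outcome n κ a) :=
  Measure.infinitePi fun _ : ℕ × ℕ => (PMF.uniformOfFintype (Seed n κ a)).toMeasure

/-- The input stream of each recursion level: the given stream at the top, then the leftover edges
of the level above. -/
noncomputable def virtualStream {n κ a : ℕ} (E : List (Edge n)) (ω : Outcome n κ a) :
    ℕ → List (Edge n)
  | 0 => E
  | j + 1 => levelLeftover j (virtualStream E ω j) fun l => ω (j, l)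

/-- The pairs of an edge and a color that the algorithm writes to its output stream. -/
def output {n κ a : ℕ} (E : List (Edge n)) (ω : Outcome n κ a) : Set (Edge n × Color) :=
  {p | ∃ j, p ∈ levelColored j (virtualStream E ω j) fun l => ω (j, l)}

/-- Number of colors that occur in the output. -/
noncomputable def numColors {n κ a : ℕ} (E : List (Edge n)) (ω : Outcome n κ a) : ℕ∞ :=
  (Prod.snd '' output E ω).encard

/-- Recursion depth: the number of levels with a nonempty input stream. -/
noncomputable def depth {n κ a : ℕ} (E : List (Edge n)) (ω : Outcome n κ a) : ℕ∞ :=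
  {j | virtualStream E ω j ≠ []}.encard

/-- Total memory: the levels run at the same time, so their peak memories are added. -/
noncomputable def totalMemory {n κ a : ℕ} (E : List (Edge n)) (ω : Outcome n κ a) : ℝ≥0∞ :=
  ∑' j, (levelMemory j (virtualStream E ω j) (fun l => ω (j, l)) : ℝ≥0∞)

/-- No edge gets two colors, no edge outside `E` gets a color, and adjacent edges never get the same
color. -/
def IsPartialColoring {n : ℕ} (E : List (Edge n)) (out : Set (Edge n × Color)) : Prop :=
  (∀ e c, (e, c) ∈ out → e ∈ E) ∧
  (∀ e c c', (e, c) ∈ out → (e, c') ∈ out → c = c') ∧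
  ∀ e f c c', (e, c) ∈ out → (f, c') ∈ out → e ≠ f → e.Adj f → c ≠ c'

/-- A valid edge coloring of `E`: moreover, all edges get a color. -/
def IsColoring {n : ℕ} (E : List (Edge n)) (out : Set (Edge n × Color)) : Prop :=
  IsPartialColoring E out ∧ ∀ e ∈ E, ∃ c, (e, c) ∈ out

end StreamColoring

namespace StreamColoring

/-! ### First-fit coloring of a stored list of edges. -/

section Greedy

variable {n : ℕ}

/-! Write D = 4^a, d = 2^k for a threshold, N = κD/d for the number of its palettes and K = 2κd for
their size.

Properness. Every color records its level, its phase (or interval) and its kind, so a conflict can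
only arise inside one phase and between edges of one kind. First-fit settles conflicts within an
interval among small edges and among the edges colored from A. Across intervals, blocking ensures
that a vertex that is high twice for the same threshold and index has no unblocked edge of that
threshold the second time. A mixed edge from u takes its color in the cyclic window of length 2d
starting at the offset of u, and the gap test keeps the windows of the two ends of an edge disjoint
(`add_mod_ne_of_gap`); hence a vertex that is low for one edge and high for another sees no
conflict. If the vertex is low for both, the counter (C) or the number of repetitions times √D (B)
has moved past the earlier colors. If it is high for both, the explicit test or blocking applies.
This is `mixed_proper`.

Leftover edges. A union bound charges each edge with seven shares of 1/κ: one for each end point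
that may block it, and for a mixed edge two for the gap test and one each for a full counter, too
many repetitions, and a collision at the high end. Two mechanisms prove them all. For blocking,
counters and repetitions, an earlier interval has the current palette index with probability 1/N;
the weights of the earlier intervals of the phase sum to at most D, and Markov's inequality with
threshold d gives D/(Nd) = 1/κ (`mul_total_le_of_weight`). For gaps and collisions, one offset is
rotated through all K residues while the indices, and hence all counters, stay fixed
(`gap_total_le`, `color_total_le`). These are counting statements over finite seed vectors;
independence of the levels turns them into conditional expectations (`lintegral_leftover_le`).

Depth, colors, memory. The mean input length starts at no more than nD and shrinks by 7/κ ≤ 1/4 per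
level. Since a nonempty input at level j + 1 requires at least n edges at level j, Markov's
inequality bounds its probability by D/4^j, and summation bounds the expected depth by a + 3. A
level with nonempty input uses O(a · 8^a) colors and at most 10n words for every outcome, so the
remaining expectations are these bounds times the expected depth, with D ≤ 4Δ at the end. -/

theorem Edge.Adj.symm {e f : Edge n} (h : e.Adj f) : f.Adj e := by
  obtain ⟨v, h1, h2⟩ := h
  exact ⟨v, h2, h1⟩

theorem Edge.adj_iff {e f : Edge n} : f.Adj e ↔ f.Inc e.src ∨ f.Inc e.tgt := by
  constructor
  · rintro ⟨v, hf, h | h⟩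
    · exact Or.inl (h ▸ hf)
    · exact Or.inr (h ▸ hf)
  · rintro (h | h)
    · exact ⟨_, h, Or.inl rfl⟩
    · exact ⟨_, h, Or.inr rfl⟩

theorem deg_append (L M : List (Edge n)) (v : Fin n) : deg (L ++ M) v = deg L v + deg M v := by
  simp [deg]

theorem deg_le_length (L : List (Edge n)) (v : Fin n) : deg L v ≤ L.length :=
  List.countP_le_length

theorem deg_le_of_subperm {L M : List (Edge n)} (h : L.Subperm M) (v : Fin n) :
    deg L v ≤ deg M v := h.countP_le _

theorem deg_pos {L : List (Edge n)} {e : Edge n} (he : e ∈ L) {v : Fin n} (hv : e.Inc v) :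
    0 < deg L v := by
  simp only [deg, List.countP_pos_iff]
  exact ⟨e, he, by simpa using hv⟩

theorem firstFit_spec (acc : List (Edge n × ℕ)) (e : Edge n) :
    ∀ p ∈ acc, p.1.Adj e → p.2 ≠ firstFit acc e := by
  have hne : {c : ℕ | ∀ p ∈ acc, p.1.Adj e → p.2 ≠ c}.Nonempty := by
    -- A number larger than the sum of all used numbers is larger than each of them.
    refine ⟨(acc.map Prod.snd).sum + 1, fun p hp _ h => ?_⟩
    have := List.single_le_sum (l := acc.map Prod.snd) (by simp) p.2 (List.mem_map_of_mem hp)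
    omega
  exact Nat.sInf_mem hne

/-- Pigeonhole: the forbidden numbers come from edges that meet one of the two end points, so one of
the first (their count + 1) numbers is free. -/
theorem firstFit_le (acc : List (Edge n × ℕ)) (e : Edge n) :
    firstFit acc e ≤ deg (acc.map Prod.fst) e.src + deg (acc.map Prod.fst) e.tgt := by
  classical
  set F := (acc.filter fun p => p.1.Adj e).map Prod.snd with hF
  have hlen : F.length ≤ deg (acc.map Prod.fst) e.src + deg (acc.map Prod.fst) e.tgt := by
    rw [hF, List.length_map]
    simp only [deg, List.countP_map, ← List.countP_eq_length_filter]
    clear hF F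
    induction acc with
    | nil => simp
    | cons p acc ih =>
      simp only [List.countP_cons, Function.comp, Edge.adj_iff] at ih ⊢
      by_cases h1 : p.1.Inc e.src <;> by_cases h2 : p.1.Inc e.tgt <;>
        simp only [h1, h2, or_true, or_false, decide_true, decide_false, if_true] <;>
        simp <;> simp only [Function.comp_def, ← Bool.decide_or] at ih ⊢ <;> omega
  have : ∃ c ∈ Finset.range (F.length + 1), c ∉ F.toFinset := by
    apply Finset.exists_mem_notMem_of_card_lt_card
    have := F.toFinset_card_le
    simp only [Finset.card_range]; omega
  obtain ⟨c, hc, hcF⟩ := this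
  refine le_trans (Nat.sInf_le (m := c) ?_) (by simp at hc; omega)
  intro p hp hadj h
  apply hcF
  simp only [hF, List.mem_toFinset, List.mem_map, List.mem_filter]
  exact ⟨p, ⟨hp, by simpa using hadj⟩, h⟩

/-- Step of the first-fit coloring. -/
noncomputable def greedyFrom (acc : List (Edge n × ℕ)) (L : List (Edge n)) : List (Edge n × ℕ) :=
  L.foldl (fun acc e => acc ++ [(e, firstFit acc e)]) acc

theorem greedyFrom_map_fst (L : List (Edge n)) (acc : List (Edge n × ℕ)) :
    (greedyFrom acc L).map Prod.fst = acc.map Prod.fst ++ L := by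
  induction L generalizing acc with
  | nil => simp [greedyFrom]
  | cons e L ih =>
    have := ih (acc ++ [(e, firstFit acc e)])
    simpa [greedyFrom] using this

theorem greedy_map_fst (L : List (Edge n)) : (greedy L).map Prod.fst = L := by
  simpa [greedyFrom, greedy] using greedyFrom_map_fst L []

theorem greedyFrom_pairwise (L : List (Edge n)) (acc : List (Edge n × ℕ))
    (h : acc.Pairwise fun p q => p.1.Adj q.1 → p.2 ≠ q.2) :
    (greedyFrom acc L).Pairwise fun p q => p.1.Adj q.1 → p.2 ≠ q.2 := by
  induction L generalizing acc with
  | nil => simpa [greedyFrom] using h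
  | cons e L ih =>
    refine ih (acc ++ [(e, firstFit acc e)]) ?_
    rw [List.pairwise_append]
    refine ⟨h, List.pairwise_singleton _ _, ?_⟩
    intro p hp q hq
    rw [List.mem_singleton] at hq
    subst hq
    exact firstFit_spec acc e p hp

theorem greedy_proper {L : List (Edge n)} {p q : Edge n × ℕ}
    (hp : p ∈ greedy L) (hq : q ∈ greedy L) (hne : p.1 ≠ q.1) (hadj : p.1.Adj q.1) :
    p.2 ≠ q.2 := by
  have h := greedyFrom_pairwise L [] List.Pairwise.nil
  -- Pairwise validity compares an entry only with later ones. The guard p.1 ≠ q.1 makes the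
  -- relation vacuous on the diagonal, and symmetry then extends it to all pairs.
  have : Std.Symm fun p q : Edge n × ℕ => p.1 ≠ q.1 → p.1.Adj q.1 → p.2 ≠ q.2 :=
    ⟨fun x y hxy h1 h2 => (hxy h1.symm h2.symm).symm⟩
  have hpw : (greedy L).Pairwise fun p q : Edge n × ℕ => p.1 ≠ q.1 → p.1.Adj q.1 → p.2 ≠ q.2 := by
    refine List.Pairwise.imp ?_ h
    intro p q h _
    exact h
  exact List.Pairwise.forall_of_forall (l := greedy L)
    (R := fun p q => p.1 ≠ q.1 → p.1.Adj q.1 → p.2 ≠ q.2)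
    (fun x _ h => absurd rfl h) hpw hp hq hne hadj

/-- Degrees are measured in the colored part followed by the remaining list. This concatenation does
not change when an edge is processed, so the bound is an invariant. -/
theorem greedyFrom_le (L : List (Edge n)) (acc : List (Edge n × ℕ))
    (hacc : ∀ p ∈ acc, p.2 ≤ deg (acc.map Prod.fst ++ L) p.1.src +
      deg (acc.map Prod.fst ++ L) p.1.tgt) :
    ∀ p ∈ greedyFrom acc L, p.2 ≤ deg (acc.map Prod.fst ++ L) p.1.src +
      deg (acc.map Prod.fst ++ L) p.1.tgt := by
  induction L generalizing acc with
  | nil => simpa [greedyFrom] using hacc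
  | cons e L ih =>
    have h := ih (acc ++ [(e, firstFit acc e)])
    have happ : (acc ++ [(e, firstFit acc e)]).map Prod.fst ++ L = acc.map Prod.fst ++ e :: L := by
      simp
    rw [happ] at h
    refine h ?_
    intro p hp
    rw [List.mem_append, List.mem_singleton] at hp
    obtain hp | rfl := hp
    · exact hacc p hp
    · have h1 := firstFit_le acc e
      simp only [deg_append]
      omega

theorem greedy_le {L : List (Edge n)} {p : Edge n × ℕ} (hp : p ∈ greedy L) :
    p.2 ≤ deg L p.1.src + deg L p.1.tgt := by
  simpa using greedyFrom_le L [] (by simp) p hp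

theorem greedy_fst_mem {L : List (Edge n)} {p : Edge n × ℕ} (hp : p ∈ greedy L) : p.1 ∈ L := by
  have := List.mem_map_of_mem (f := Prod.fst) hp
  rwa [greedy_map_fst] at this

end Greedy

/-! ### One interval: types of edges and the pass through the mixed edges. -/

section Interval

variable {n κ a : ℕ} {I : List (Edge n)}

theorem deg_lt_of_scale_lt {u v : Fin n} (h : scale I u < scale I v) : deg I u < deg I v := by
  by_contra hc
  exact absurd (Nat.log_mono_right (b := 2) (not_lt.mp hc)) (not_le.mpr h)

theorem deg_lt_two_pow_scale (v : Fin n) : deg I v < 2 ^ (scale I v + 1) :=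
  Nat.lt_pow_succ_log_self (by norm_num) _

theorem two_pow_scale_le {v : Fin n} (h : 2 ^ a ≤ deg I v) : 2 ^ scale I v ≤ deg I v :=
  Nat.pow_log_le_self 2 (by have := Nat.one_le_two_pow (n := a); omega)

theorem le_scale {v : Fin n} (h : 2 ^ a ≤ deg I v) : a ≤ scale I v :=
  Nat.le_log_of_pow_le (by norm_num) h

theorem deg_lt_of_scale_lt_exp {u : Fin n} {k : ℕ} (h : scale I u < k) : deg I u < 2 ^ k :=
  lt_of_lt_of_le (deg_lt_two_pow_scale u) (Nat.pow_le_pow_right (by norm_num) h)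

/-- Positivity of the degree matters: `Nat.log` sends 0 to 0, so for a = 0 the scale cannot tell
degree 0 from degree 1. -/
theorem two_pow_le_deg {v : Fin n} (h : a ≤ scale I v) (hpos : 0 < deg I v) : 2 ^ a ≤ deg I v :=
  le_trans (Nat.pow_le_pow_right (by norm_num) h) (Nat.pow_log_le_self 2 hpos.ne')

namespace IsMixed

variable {u v : Fin n} {e : Edge n}

theorem ne (h : IsMixed a I u v e) : u ≠ v := by
  rintro rfl
  exact lt_irrefl _ h.2.2

theorem inc_low (h : IsMixed a I u v e) : e.Inc u := by
  obtain ⟨⟨h, -⟩ | ⟨-, h⟩, -⟩ := h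
  exacts [Or.inl h, Or.inr h]

theorem inc_high (h : IsMixed a I u v e) : e.Inc v := by
  obtain ⟨⟨-, h⟩ | ⟨h, -⟩, -⟩ := h
  exacts [Or.inr h, Or.inl h]

theorem eq_or_eq (h : IsMixed a I u v e) {w : Fin n} (hw : e.Inc w) : w = u ∨ w = v := by
  obtain ⟨⟨h1, h2⟩ | ⟨h1, h2⟩, -⟩ := h <;> obtain rfl | rfl := hw <;> simp_all

/-- The high end point is the one of larger scale, so the roles of the two ends cannot be exchanged.
-/
theorem unique (h : IsMixed a I u v e) {u' v' : Fin n} (h' : IsMixed a I u' v' e) :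
    u = u' ∧ v = v' := by
  have hv : v = v' := by
    obtain hv | hv := h'.eq_or_eq h.inc_high
    · obtain hw | hw := h.eq_or_eq h'.inc_high
      · have h1 := h.2.2
        have h2 := h'.2.2
        subst hv hw
        omega
      · exact hw.symm
    · exact hv
  refine ⟨?_, hv⟩
  obtain hu | hu := h'.eq_or_eq h.inc_low
  · exact hu
  · exact absurd (hu.trans hv.symm) h.ne

theorem edgeScale_eq (h : IsMixed a I u v e) : edgeScale I e = scale I v := by
  obtain ⟨⟨rfl, rfl⟩ | ⟨rfl, rfl⟩, -, h⟩ := h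
  · exact max_eq_right h.le
  · exact max_eq_left h.le

theorem not_isSmall (h : IsMixed a I u v e) : ¬ IsSmall a I e := by
  rintro ⟨h1, h2⟩
  have := h.2.1
  obtain rfl | rfl := h.inc_high <;> omega

theorem not_isHigh (h : IsMixed a I u v e) : ¬ IsHigh a I e := by
  rintro ⟨-, h'⟩
  obtain ⟨⟨rfl, rfl⟩ | ⟨rfl, rfl⟩, -, h⟩ := h <;> omega

theorem adj_low_lt (h : IsMixed a I u v e) : deg I u < 2 ^ scale I v :=
  deg_lt_of_scale_lt_exp h.2.2

end IsMixed

/-- Once the scales differ, the end of larger scale also has the larger degree, which is at least √D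
because one of the two degrees is. -/
theorem exists_isMixed {e : Edge n} (h1 : ¬ IsSmall a I e) (h2 : ¬ IsHigh a I e) :
    ∃ u v, IsMixed a I u v e := by
  have hs : scale I e.src ≠ scale I e.tgt := fun h => h2 ⟨h1, h⟩
  have h3 : 2 ^ a ≤ deg I e.src ∨ 2 ^ a ≤ deg I e.tgt := by
    by_contra hc
    push Not at hc
    exact h1 hc
  obtain hlt | hlt := lt_or_gt_of_ne hs
  · refine ⟨e.src, e.tgt, Or.inl ⟨rfl, rfl⟩, ?_, hlt⟩
    have := deg_lt_of_scale_lt hlt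
    omega
  · refine ⟨e.tgt, e.src, Or.inr ⟨rfl, rfl⟩, ?_, hlt⟩
    have := deg_lt_of_scale_lt hlt
    omega

theorem IsHigh.two_pow_le_deg {e : Edge n} (he : e ∈ I) (h : IsHigh a I e) {v : Fin n}
    (hv : e.Inc v) : 2 ^ a ≤ deg I v ∧ scale I v = edgeScale I e := by
  obtain ⟨h1, h2⟩ := h
  have h3 : 2 ^ a ≤ deg I e.src ∨ 2 ^ a ≤ deg I e.tgt := by
    by_contra hc
    push Not at hc
    exact h1 hc
  have h4 : a ≤ scale I e.src := by
    obtain h | h := h3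
    · exact le_scale h
    · exact h2 ▸ le_scale h
  have hsv : scale I v = scale I e.src := by
    obtain rfl | rfl := hv
    exacts [rfl, h2.symm]
  refine ⟨StreamColoring.two_pow_le_deg (hsv ▸ h4) (deg_pos he hv), ?_⟩
  rw [hsv, edgeScale, ← h2, max_self]

/-! ### The enumeration of the mixed edges -/

theorem mem_mixedAt {u : Fin n} {p : Edge n × Fin n} :
    p ∈ mixedAt a I u ↔ p.1 ∈ I ∧ IsMixed a I u p.2 p.1 := by
  classical
  obtain ⟨e, v⟩ := p
  simp only [mixedAt, List.mem_flatMap, List.mem_finRange, true_and, List.mem_map,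
    List.mem_filter, decide_eq_true_eq, Prod.mk.injEq]
  constructor
  · rintro ⟨w, f, ⟨hf, hm⟩, rfl, rfl⟩
    exact ⟨hf, hm⟩
  · rintro ⟨hf, hm⟩
    exact ⟨v, e, ⟨hf, hm⟩, rfl, rfl⟩

theorem mixedAt_nodup (hI : I.Nodup) (u : Fin n) : ((mixedAt a I u).map Prod.fst).Nodup := by
  classical
  simp only [mixedAt, List.map_flatMap, List.map_map, Function.comp_def, List.map_id']
  rw [List.nodup_flatMap]
  refine ⟨fun v _ => hI.filter _, (List.nodup_finRange n).imp ?_⟩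
  intro v w hvw e he he'
  simp only [List.mem_filter, decide_eq_true_eq] at he he'
  exact hvw (he.2.unique he'.2).2

theorem mixedAt_length_le (hI : I.Nodup) (u : Fin n) : (mixedAt a I u).length ≤ deg I u := by
  classical
  rw [deg, List.countP_eq_length_filter, ← List.length_map (f := Prod.fst)]
  refine (List.subperm_of_subset (mixedAt_nodup hI u) ?_).length_le
  intro e he
  obtain ⟨p, hp, rfl⟩ := List.mem_map.mp he
  rw [mem_mixedAt] at hp
  simpa using ⟨hp.1, hp.2.inc_low⟩

theorem mem_mixedItems {x : MixedItem n} :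
    x ∈ mixedItems a I ↔ (mixedAt a I x.low)[x.rank]? = some (x.edge, x.high) := by
  obtain ⟨u, v, e, b⟩ := x
  simp only [mixedItems, List.mem_flatMap, List.mem_finRange, true_and, List.mem_map,
    List.mem_zipIdx_iff_getElem?, MixedItem.mk.injEq]
  constructor
  · rintro ⟨w, ⟨⟨f, v'⟩, b'⟩, h, rfl, rfl, rfl, rfl⟩
    exact h
  · intro h
    exact ⟨u, ((e, v), b), h, rfl, rfl, rfl, rfl⟩

section Item

variable {x y : MixedItem n}

theorem MixedItem.isMixed (hx : x ∈ mixedItems a I) : IsMixed a I x.low x.high x.edge :=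
  (mem_mixedAt.mp (List.mem_of_getElem? (mem_mixedItems.mp hx))).2

theorem MixedItem.edge_mem (hx : x ∈ mixedItems a I) : x.edge ∈ I :=
  (mem_mixedAt.mp (List.mem_of_getElem? (mem_mixedItems.mp hx))).1

theorem MixedItem.rank_lt (hx : x ∈ mixedItems a I) : x.rank < (mixedAt a I x.low).length :=
  (List.getElem?_eq_some_iff.mp (mem_mixedItems.mp hx)).1

/-- The rank is a position in the list `mixedAt` of the low end point, so low end point and rank
together determine the item. -/
theorem MixedItem.eq_of_rank (hx : x ∈ mixedItems a I) (hy : y ∈ mixedItems a I)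
    (hl : x.low = y.low) (hr : x.rank = y.rank) : x = y := by
  rw [mem_mixedItems] at hx hy
  rw [hl, hr, hy, Option.some.injEq, Prod.mk.injEq] at hx
  obtain ⟨u, v, e, b⟩ := x
  obtain ⟨u', v', e', b'⟩ := y
  simp_all

end Item

theorem mixedItems_nodup (hI : I.Nodup) : ((mixedItems a I).map MixedItem.edge).Nodup := by
  have : (mixedItems a I).map MixedItem.edge =
      (List.finRange n).flatMap fun u => (mixedAt a I u).map Prod.fst := by
    simp only [mixedItems, List.map_flatMap, List.map_map]
    congr 1
    funext u
    conv_rhs => rw [← List.zipIdx_map_fst 0 (mixedAt a I u), List.map_map]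
    rfl
  rw [this, List.nodup_flatMap]
  refine ⟨fun u _ => mixedAt_nodup hI u, (List.nodup_finRange n).imp ?_⟩
  intro u w huw e he he'
  obtain ⟨p, hp, rfl⟩ := List.mem_map.mp he
  obtain ⟨p', hp', hpp⟩ := List.mem_map.mp he'
  rw [mem_mixedAt] at hp hp'
  rw [hpp] at hp'
  exact huw (hp.2.unique hp'.2).1

theorem exists_mixedItem {e : Edge n} (he : e ∈ I) {u v : Fin n} (h : IsMixed a I u v e) :
    ∃ x ∈ mixedItems a I, x.edge = e := by
  have hmem : (e, v) ∈ mixedAt a I u := mem_mixedAt.mpr ⟨he, h⟩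
  obtain ⟨b, hb⟩ := List.mem_iff_getElem?.mp hmem
  exact ⟨⟨u, v, e, b⟩, mem_mixedItems.mpr hb, rfl⟩

theorem countP_high_le (hI : I.Nodup) (v : Fin n) :
    (mixedItems a I).countP (fun x => x.high = v) ≤ deg I v := by
  classical
  rw [deg, List.countP_eq_length_filter, List.countP_eq_length_filter,
    ← List.length_map (f := MixedItem.edge)]
  refine (List.subperm_of_subset (((mixedItems_nodup hI)).sublist
    (List.filter_sublist.map _)) ?_).length_le
  intro e he
  simp only [List.mem_map, List.mem_filter, decide_eq_true_eq] at he ⊢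
  obtain ⟨x, ⟨hx, rfl⟩, rfl⟩ := he
  exact ⟨MixedItem.edge_mem hx, (MixedItem.isMixed hx).inc_high⟩

/-! ### The pass through the mixed edges -/

/-- Result of the pass through a list of mixed edges. -/
noncomputable def State.mixedPass (st : State n κ a) (level : ℕ) (I : List (Edge n))
    (σ : Fin (κ * 2 ^ a)) (L : List (MixedItem n)) : List (Edge n × Color) × List (Edge n) :=
  L.foldl (st.mixedStep level I σ) ([], [])

variable (st : State n κ a) (level : ℕ) (σ : Fin (κ * 2 ^ a)) (L : List (MixedItem n))

theorem State.mixedPass_concat (x : MixedItem n) :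
    st.mixedPass level I σ (L ++ [x]) =
      st.mixedStep level I σ (st.mixedPass level I σ L) x := by
  simp [State.mixedPass]

open scoped Classical in
-- Each step puts an unblocked item into exactly one of the two outputs.
theorem State.mixedPass_perm :
    ((st.mixedPass level I σ L).1.map Prod.fst ++ (st.mixedPass level I σ L).2).Perm
      ((L.map MixedItem.edge).filter fun e => ¬ st.Blocked I σ e) := by
  induction L using List.reverseRecOn with
  | nil => simp [State.mixedPass]
  | append_singleton L x ih =>
    rw [State.mixedPass_concat, State.mixedStep]
    by_cases hb : st.Blocked I σ x.edge
    · simpa [hb] using ih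
    · have hl : ((st.mixedPass level I σ L).1.map Prod.fst ++
          ((st.mixedPass level I σ L).2 ++ [x.edge])).Perm
          (((L ++ [x]).map MixedItem.edge).filter fun e => ¬ st.Blocked I σ e) := by
        rw [← List.append_assoc]
        simpa [hb] using ih.append_right [x.edge]
      have hc : ∀ c : Color, (((st.mixedPass level I σ L).1 ++ [(x.edge, c)]).map Prod.fst ++
          (st.mixedPass level I σ L).2).Perm
          (((L ++ [x]).map MixedItem.edge).filter fun e => ¬ st.Blocked I σ e) := by
        intro c
        refine List.Perm.trans ?_ hl
        rw [List.map_append, List.append_assoc]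
        exact List.perm_append_comm.append_left _
      simp only [hb, if_false]
      cases st.propose level I σ x with
      | none => exact hl
      | some c =>
        simp only
        split_ifs
        exacts [hl, hc c]

theorem State.mixedPass_colored {q : Edge n × Color} (hq : q ∈ (st.mixedPass level I σ L).1) :
    ∃ x ∈ L, q.1 = x.edge ∧ st.propose level I σ x = some q.2 ∧ ¬ st.Blocked I σ x.edge := by
  induction L using List.reverseRecOn with
  | nil => simp [State.mixedPass] at hq
  | append_singleton L x ih =>
    have key : q ∈ (st.mixedPass level I σ L).1 → ∃ x' ∈ L ++ [x], q.1 = x'.edge ∧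
        st.propose level I σ x' = some q.2 ∧ ¬ st.Blocked I σ x'.edge := by
      intro h
      obtain ⟨y, hy, h⟩ := ih h
      exact ⟨y, List.mem_append_left _ hy, h⟩
    rw [State.mixedPass_concat, State.mixedStep] at hq
    split_ifs at hq with hb
    · exact key hq
    · cases hp : st.propose level I σ x with
      | none => rw [hp] at hq; exact key hq
      | some c =>
        rw [hp] at hq
        simp only at hq
        split_ifs at hq with hx
        · exact key hq
        · rw [List.mem_append, List.mem_singleton] at hq
          obtain hq | rfl := hq
          · exact key hq
          · exact ⟨x, by simp, rfl, hp, hb⟩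

/-- The later of the two items was tested against the earlier one at its own high end point. Since
either may be the later one, incidence is required at both high end points. -/
theorem State.mixedPass_proper (hL : (L.map MixedItem.edge).Nodup) {x y : MixedItem n}
    (hx : x ∈ L) (hy : y ∈ L) {c : Color}
    (hcx : (x.edge, c) ∈ (st.mixedPass level I σ L).1)
    (hcy : (y.edge, c) ∈ (st.mixedPass level I σ L).1)
    (hxy : y.edge.Inc x.high) (hyx : x.edge.Inc y.high) : x.edge = y.edge := by
  induction L using List.reverseRecOn with
  | nil => simp at hx
  | append_singleton L z ih =>
    rw [List.map_append, List.nodup_append] at hL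
    obtain ⟨hL, -, hz⟩ := hL
    have hz : ∀ w ∈ L, w.edge ≠ z.edge := fun w hw =>
      hz _ (List.mem_map_of_mem hw) _ (by simp)
    have hcol : ∀ w, (w, c) ∈ (st.mixedPass level I σ L).1 → w ≠ z.edge := by
      intro w hw
      obtain ⟨w', hw', h, -⟩ := st.mixedPass_colored level σ L hw
      simp only at h
      exact h ▸ hz w' hw'
    have key : (x.edge, c) ∈ (st.mixedPass level I σ L).1 →
        (y.edge, c) ∈ (st.mixedPass level I σ L).1 → x.edge = y.edge := by
      intro h1 h2
      refine ih hL ?_ ?_ h1 h2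
      · obtain h | h := List.mem_append.mp hx
        · exact h
        · exact absurd (congrArg _ (List.mem_singleton.mp h)) (hcol _ h1)
      · obtain h | h := List.mem_append.mp hy
        · exact h
        · exact absurd (congrArg _ (List.mem_singleton.mp h)) (hcol _ h2)
    rw [State.mixedPass_concat, State.mixedStep] at hcx hcy
    split_ifs at hcx hcy with hb
    · exact key hcx hcy
    · cases hp : st.propose level I σ z with
      | none => rw [hp] at hcx hcy; exact key hcx hcy
      | some c' =>
        rw [hp] at hcx hcy
        simp only at hcx hcy
        split_ifs at hcx hcy with hc
        · exact key hcx hcy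
        · simp only [List.mem_append, List.mem_singleton, Prod.mk.injEq] at hcx hcy
          have hmem : ∀ w ∈ L ++ [z], w.edge = z.edge → w = z := by
            intro w hw he
            obtain h | h := List.mem_append.mp hw
            · exact absurd he (hz w h)
            · exact List.mem_singleton.mp h
          obtain h1 | ⟨h1, rfl⟩ := hcx <;> obtain h2 | ⟨h2, h3⟩ := hcy
          · exact key h1 h2
          · obtain rfl := hmem y hy h2
            exact absurd ⟨_, h1, hyx, h3⟩ hc
          · obtain rfl := hmem x hx h1
            exact absurd ⟨_, h2, hxy, rfl⟩ hc
          · exact h1.trans h2.symm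

/-- The mixed edge `x` collides with another mixed edge `y` at its high-degree end point. -/
def State.Collide (st : State n κ a) (level : ℕ) (I : List (Edge n)) (σ : Fin (κ * 2 ^ a))
    (x y : MixedItem n) : Prop :=
  y.edge ≠ x.edge ∧ y.edge.Inc x.high ∧
    ∃ c, st.propose level I σ x = some c ∧ st.propose level I σ y = some c

open scoped Classical in
-- An item that is left over in the pass either proposes nothing or proposes the color of an earlier
-- colored item. Replacing "colored earlier" by "proposes" gives an event that no longer depends on
-- the history of the pass, so that its probability can be bounded pair by pair.
theorem State.mixedPass_leftover_le (hL : (L.map MixedItem.edge).Nodup) :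
    (st.mixedPass level I σ L).2.length ≤
      L.countP (fun x => st.propose level I σ x = none ∨ ∃ y ∈ L, st.Collide level I σ x y) := by
  induction L using List.reverseRecOn with
  | nil => simp [State.mixedPass]
  | append_singleton L z ih =>
    rw [List.map_append, List.nodup_append] at hL
    obtain ⟨hL, -, hz⟩ := hL
    have hz : ∀ w ∈ L, w.edge ≠ z.edge := fun w hw =>
      hz _ (List.mem_map_of_mem hw) _ (by simp)
    have hmono : L.countP (fun x => st.propose level I σ x = none ∨
          ∃ y ∈ L, st.Collide level I σ x y) ≤
        L.countP (fun x => st.propose level I σ x = none ∨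
          ∃ y ∈ L ++ [z], st.Collide level I σ x y) := by
      refine List.countP_mono_left fun x _ hx => ?_
      simp only [decide_eq_true_eq] at hx ⊢
      exact hx.imp_right fun ⟨y, hy, h⟩ => ⟨y, List.mem_append_left _ hy, h⟩
    have ih' := (ih hL).trans hmono
    rw [List.countP_append, State.mixedPass_concat, State.mixedStep]
    split_ifs with hb
    · omega
    · cases hp : st.propose level I σ z with
      | none => simpa [hp] using ih'
      | some c =>
        simp only
        split_ifs with hc
        · obtain ⟨q, hq, hinc, rfl⟩ := hc
          obtain ⟨y, hy, h1, h2, -⟩ := st.mixedPass_colored level σ L hq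
          have hcol : ∃ y ∈ L ++ [z], st.Collide level I σ z y :=
            ⟨y, List.mem_append_left _ hy, hz y hy, h1 ▸ hinc, _, hp, h2⟩
          rw [List.countP_singleton, if_pos (by simpa using Or.inr hcol)]
          simpa using ih'
        · simp only
          omega

/-! ### Partition of the edges of an interval -/

open scoped Classical in
-- Small, blocked, unblocked high and unblocked mixed edges partition the interval. Blocked edges
-- are never small, because blocking is witnessed by an end point of degree at least √D.
theorem processInterval_perm (level : ℕ) (st₀ : State n κ a) (seed : Seed n κ a)
    (hI : I.Nodup) :
    I.Perm ((processInterval level st₀ I seed).colored.map Prod.fst ++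
      (processInterval level st₀ I seed).leftover) := by
  set st := (st₀.openPhase seed).openCounters I seed.1 with hst
  have hmix := st.mixedPass_perm (I := I) level seed.1 (mixedItems a I)
  have hmem : ∀ e, e ∈ (mixedItems a I).map MixedItem.edge ↔ e ∈ I ∧ ∃ u v, IsMixed a I u v e := by
    intro e
    constructor
    · intro he
      obtain ⟨x, hx, rfl⟩ := List.mem_map.mp he
      exact ⟨MixedItem.edge_mem hx, _, _, MixedItem.isMixed hx⟩
    · rintro ⟨he, u, v, h⟩
      obtain ⟨x, hx, rfl⟩ := exists_mixedItem he h
      exact List.mem_map_of_mem hx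
  have hbs : ∀ e, st.Blocked I seed.1 e → ¬ IsSmall a I e := by
    rintro e ⟨v, hv, h, -⟩ ⟨h1, h2⟩
    obtain rfl | rfl := hv <;> omega
  have h1 : (processInterval level st₀ I seed).colored.map Prod.fst =
      I.filter (fun e => IsSmall a I e) ++ I.filter (fun e => IsHigh a I e ∧ ¬ st.Blocked I seed.1 e)
        ++ (st.mixedPass level I seed.1 (mixedItems a I)).1.map Prod.fst := by
    simp only [processInterval, List.map_append, List.map_map, Function.comp_def]
    rw [show (fun x : Edge n × ℕ => x.1) = Prod.fst from rfl, greedy_map_fst, greedy_map_fst]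
    rfl
  have h2 : (processInterval level st₀ I seed).leftover =
      I.filter (fun e => st.Blocked I seed.1 e) ++
        (st.mixedPass level I seed.1 (mixedItems a I)).2 := rfl
  rw [h1, h2]
  have hperm : (I.filter (fun e => IsSmall a I e) ++
      I.filter (fun e => IsHigh a I e ∧ ¬ st.Blocked I seed.1 e) ++
      I.filter (fun e => st.Blocked I seed.1 e) ++
      ((mixedItems a I).map MixedItem.edge).filter (fun e => ¬ st.Blocked I seed.1 e)).Perm I := by
    rw [List.perm_ext_iff_of_nodup _ hI]
    · intro e
      simp only [List.mem_append, List.mem_filter, decide_eq_true_eq, hmem]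
      constructor
      · tauto
      · intro he
        by_cases hs : IsSmall a I e
        · tauto
        · by_cases hb : st.Blocked I seed.1 e
          · tauto
          · by_cases hh : IsHigh a I e
            · tauto
            · have := exists_isMixed hs hh
              tauto
    · refine List.Nodup.append (List.Nodup.append (List.Nodup.append (hI.filter _) (hI.filter _) ?_)
        (hI.filter _) ?_) ((mixedItems_nodup hI).filter _) ?_
      · intro e h1 h2
        simp only [List.mem_filter, decide_eq_true_eq] at h1 h2
        exact h2.2.1.1 h1.2
      · intro e h1 h2
        simp only [List.mem_append, List.mem_filter, decide_eq_true_eq] at h1 h2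
        have := hbs e h2.2
        tauto
      · intro e h1 h2
        simp only [List.mem_append, List.mem_filter, decide_eq_true_eq, hmem] at h1 h2
        obtain ⟨⟨-, u, v, hm⟩, hb⟩ := h2
        have := hm.not_isSmall
        have := hm.not_isHigh
        tauto
  refine hperm.symm.trans ?_
  generalize I.filter (fun e => IsSmall a I e) = A
  generalize I.filter (fun e => IsHigh a I e ∧ ¬ st.Blocked I seed.1 e) = B
  generalize I.filter (fun e => st.Blocked I seed.1 e) = B'
  refine (hmix.symm.append_left _).trans ?_
  simp only [List.append_assoc]
  refine List.Perm.append_left _ (List.Perm.append_left _ ?_)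
  rw [← List.append_assoc, ← List.append_assoc]
  exact List.perm_append_comm.append_right _

end Interval

/-! ### Evolution of the state within one phase. -/

section Phase

variable {n κ a : ℕ} (level : ℕ) (S : List (Edge n)) (seeds : ℕ → Seed n κ a)

/-- State in the `l`-th interval, after the start of a new phase if there is one. -/
noncomputable def phaseState (l : ℕ) : State n κ a :=
  (stateAt level S seeds l).openPhase (seeds l)

/-- State that is used to treat the edges of the `l`-th interval. -/
noncomputable def workState (l : ℕ) : State n κ a :=
  (phaseState level S seeds l).openCounters (interval S l) (seeds l).1

theorem openPhase_interval (st : State n κ a) (seed : Seed n κ a) :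
    (st.openPhase seed).interval = st.interval := by
  unfold State.openPhase
  split_ifs <;> rfl

theorem stateAt_interval (l : ℕ) : (stateAt level S seeds l).interval = l := by
  induction l with
  | zero => rfl
  | succ l ih =>
    change ((stateAt level S seeds l).openPhase (seeds l)).interval + 1 = l + 1
    rw [openPhase_interval, ih]

theorem phaseState_interval (l : ℕ) : (phaseState level S seeds l).interval = l := by
  rw [phaseState, openPhase_interval, stateAt_interval]

theorem workState_interval (l : ℕ) : (workState level S seeds l).interval = l :=
  phaseState_interval level S seeds l

theorem phaseState_zero (q : ℕ) : phaseState level S seeds (q * 2 ^ a) =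
    { State.init n κ a with
      interval := q * 2 ^ a
      offset := fun v => ((seeds (q * 2 ^ a)).2 v : ℕ) } := by
  rw [phaseState, State.openPhase, stateAt_interval, if_pos (Nat.mul_mod_left _ _)]

theorem phaseState_succ {q r : ℕ} (hr : r + 1 < 2 ^ a) :
    phaseState level S seeds (q * 2 ^ a + (r + 1)) =
      (resultAt level S seeds (q * 2 ^ a + r)).next := by
  rw [phaseState, State.openPhase, stateAt_interval, if_neg]
  · rfl
  · rw [Nat.mul_add_mod', Nat.mod_eq_of_lt hr]
    omega

/-- Edges of the `r`-th interval of the `q`-th phase. -/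
def phaseInterval (a : ℕ) (q r : ℕ) : List (Edge n) := interval S (q * 2 ^ a + r)

/-- Index drawn in the `r`-th interval of the `q`-th phase. -/
def phaseIdx (q r : ℕ) : Fin (κ * 2 ^ a) := (seeds (q * 2 ^ a + r)).1

theorem phaseState_offset {q r : ℕ} (hr : r < 2 ^ a) (v : Fin n) :
    (phaseState level S seeds (q * 2 ^ a + r)).offset v = (seeds (q * 2 ^ a)).2 v := by
  induction r with
  | zero => rw [add_zero, phaseState_zero]
  | succ r ih =>
    rw [phaseState_succ _ _ _ hr]
    exact ih (by omega)

theorem workState_offset {q r : ℕ} (hr : r < 2 ^ a) (v : Fin n) :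
    (workState level S seeds (q * 2 ^ a + r)).offset v = (seeds (q * 2 ^ a)).2 v :=
  phaseState_offset level S seeds hr v

theorem mem_phaseState_used {q r : ℕ} (hr : r < 2 ^ a) (x : ℕ × Fin n × ℕ) :
    x ∈ (phaseState level S seeds (q * 2 ^ a + r)).used ↔
      ∃ s < r, ∃ v, 2 ^ a ≤ deg (phaseInterval S a q s) v ∧
        (scale (phaseInterval S a q s) v, v,
          palIdx (phaseIdx seeds q s) (scale (phaseInterval S a q s) v)) = x := by
  classical
  induction r with
  | zero => simp [phaseState_zero, State.init]
  | succ r ih =>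
    rw [phaseState_succ _ _ _ hr]
    have : x ∈ (resultAt level S seeds (q * 2 ^ a + r)).next.used ↔
      x ∈ (phaseState level S seeds (q * 2 ^ a + r)).used ∨
        ∃ v, 2 ^ a ≤ deg (phaseInterval S a q r) v ∧
          (scale (phaseInterval S a q r) v, v,
            palIdx (phaseIdx seeds q r) (scale (phaseInterval S a q r) v)) = x := by
      simp only [resultAt, processInterval, Finset.mem_union, Finset.mem_image, Finset.mem_filter,
        Finset.mem_univ, true_and]
      rfl
    rw [this, ih (by omega)]
    simp only [Nat.lt_succ_iff_lt_or_eq]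
    constructor
    · rintro (⟨s, hs, h⟩ | h)
      · exact ⟨s, Or.inl hs, h⟩
      · exact ⟨r, Or.inr rfl, h⟩
    · rintro ⟨s, hs | rfl, h⟩
      · exact Or.inl ⟨s, hs, h⟩
      · exact Or.inr h

theorem mem_workState_used {q r : ℕ} (hr : r < 2 ^ a) (k : ℕ) (v : Fin n) (i : ℕ) :
    (k, v, i) ∈ (workState level S seeds (q * 2 ^ a + r)).used ↔
      ∃ s < r, 2 ^ a ≤ deg (phaseInterval S a q s) v ∧ scale (phaseInterval S a q s) v = k ∧
        palIdx (phaseIdx seeds q s) k = i := by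
  refine (mem_phaseState_used level S seeds hr _).trans ?_
  constructor
  · rintro ⟨s, hs, w, h1, h2⟩
    simp only [Prod.mk.injEq] at h2
    obtain ⟨rfl, rfl, rfl⟩ := h2
    exact ⟨s, hs, h1, rfl, rfl⟩
  · rintro ⟨s, hs, h1, rfl, rfl⟩
    exact ⟨s, hs, v, h1, rfl⟩

theorem phaseState_hits {q r : ℕ} (hr : r < 2 ^ a) (j : Fin (κ * 2 ^ a)) :
    (phaseState level S seeds (q * 2 ^ a + r)).hits j =
      if 2 ^ a ≤ n then ∑ s ∈ Finset.range r, if phaseIdx seeds q s = j then 1 else 0 else 0 := by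
  induction r with
  | zero => simp [phaseState_zero, State.init]
  | succ r ih =>
    rw [phaseState_succ _ _ _ hr, Finset.sum_range_succ]
    have : (resultAt level S seeds (q * 2 ^ a + r)).next.hits j =
        if j = phaseIdx seeds q r ∧ 2 ^ a ≤ n then
          (phaseState level S seeds (q * 2 ^ a + r)).hits j + 1
        else (phaseState level S seeds (q * 2 ^ a + r)).hits j := rfl
    rw [this, ih (by omega)]
    by_cases hn : 2 ^ a ≤ n <;> by_cases hj : j = phaseIdx seeds q r <;> simp [hn, hj, eq_comm]

theorem workState_repeats {q r : ℕ} (hr : r < 2 ^ a) (σ : Fin (κ * 2 ^ a)) (k : ℕ) :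
    (workState level S seeds (q * 2 ^ a + r)).repeats σ k =
      if 2 ^ a ≤ n then
        ∑ s ∈ Finset.range r, if palIdx (phaseIdx seeds q s) k = palIdx σ k then 1 else 0
      else 0 := by
  classical
  have h : ∀ j, (workState level S seeds (q * 2 ^ a + r)).hits j = _ :=
    phaseState_hits level S seeds hr
  simp only [State.repeats, h]
  split_ifs with hn
  · rw [Finset.sum_comm]
    refine Finset.sum_congr rfl fun s _ => ?_
    rw [Finset.sum_ite_eq]
    simp
  · simp

theorem resultAt_next_ctr (l : ℕ) (u : Fin n) (j : Fin (κ * 2 ^ a)) :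
    (resultAt level S seeds l).next.ctr u j =
      if j = (seeds l).1 then
        ((workState level S seeds l).ctr u j).map (· + (mixedAt a (interval S l) u).length)
      else (workState level S seeds l).ctr u j := rfl

theorem workState_ctr (l : ℕ) (u : Fin n) (j : Fin (κ * 2 ^ a)) :
    (workState level S seeds l).ctr u j =
      if j = (seeds l).1 ∧ 2 ^ a < deg (interval S l) u ∧
        (phaseState level S seeds l).ctr u j = none then some 0
      else (phaseState level S seeds l).ctr u j := rfl

/-- Opening a counter replaces ⊥ by 0, and ⊥ already counts as 0. -/
theorem workState_ctr_getD (l : ℕ) (u : Fin n) (j : Fin (κ * 2 ^ a)) :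
    ((workState level S seeds l).ctr u j).getD 0 =
      ((phaseState level S seeds l).ctr u j).getD 0 := by
  rw [workState_ctr]
  split_ifs with h
  · simp [h.2.2]
  · rfl

/-- A larger degree would have opened the counter. This makes a block of √D consecutive colors of B
wide enough for all mixed edges at a vertex whose counter is ⊥. -/
theorem deg_le_of_ctr_eq_none {l : ℕ} {u : Fin n}
    (h : (workState level S seeds l).ctr u (seeds l).1 = none) :
    deg (interval S l) u ≤ 2 ^ a := by
  rw [workState_ctr] at h
  split_ifs at h with hc
  by_contra hd
  exact hc ⟨rfl, by omega, h⟩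

/-- Only an inequality: mixed edges met while the counter was still ⊥ are never added to it. -/
theorem phaseState_ctr_le {q r : ℕ} (hr : r < 2 ^ a) (u : Fin n) (j : Fin (κ * 2 ^ a)) :
    ((phaseState level S seeds (q * 2 ^ a + r)).ctr u j).getD 0 ≤
      ∑ s ∈ Finset.range r,
        if phaseIdx seeds q s = j then (mixedAt a (phaseInterval S a q s) u).length else 0 := by
  induction r with
  | zero => simp [phaseState_zero, State.init]
  | succ r ih =>
    rw [phaseState_succ _ _ _ hr, Finset.sum_range_succ, resultAt_next_ctr]
    have := ih (by omega)
    rw [← workState_ctr_getD] at this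
    have hI : interval S (q * 2 ^ a + r) = phaseInterval S a q r := rfl
    have hσ : (seeds (q * 2 ^ a + r)).1 = phaseIdx seeds q r := rfl
    rw [hI, hσ]
    by_cases hj : j = phaseIdx seeds q r
    · rw [if_pos hj, if_pos hj.symm]
      cases hc : (workState level S seeds (q * 2 ^ a + r)).ctr u j with
      | none => simp
      | some c => rw [hc] at this; simpa using this
    · rw [if_neg hj]
      omega

theorem workState_count_le {q r : ℕ} (hr : r < 2 ^ a) (σ : Fin (κ * 2 ^ a)) (k : ℕ) (u : Fin n) :
    (workState level S seeds (q * 2 ^ a + r)).count σ k u ≤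
      ∑ s ∈ Finset.range r, if palIdx (phaseIdx seeds q s) k = palIdx σ k then
        (mixedAt a (phaseInterval S a q s) u).length else 0 := by
  classical
  simp only [State.count, workState_ctr_getD]
  refine (Finset.sum_le_sum fun j _ => phaseState_ctr_le level S seeds hr u j).trans ?_
  rw [Finset.sum_comm]
  refine Finset.sum_le_sum fun s _ => ?_
  rw [Finset.sum_ite_eq]
  simp

/-- Within a phase an open counter stays open and never decreases. The extra summand appears because
the working state of an interval precedes the update made by that interval. -/
theorem phaseState_ctr_mono {q r s : ℕ} (hsr : s < r) (hr : r < 2 ^ a) {u : Fin n}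
    {j : Fin (κ * 2 ^ a)} {c : ℕ}
    (hc : (workState level S seeds (q * 2 ^ a + s)).ctr u j = some c) :
    ∃ c', (phaseState level S seeds (q * 2 ^ a + r)).ctr u j = some c' ∧
      c + (if j = phaseIdx seeds q s then (mixedAt a (phaseInterval S a q s) u).length else 0)
        ≤ c' := by
  induction r with
  | zero => omega
  | succ r ih =>
    rw [phaseState_succ _ _ _ hr, resultAt_next_ctr]
    obtain hlt | rfl := Nat.lt_succ_iff_lt_or_eq.mp hsr
    · obtain ⟨c', h1, h2⟩ := ih hlt (by omega)
      rw [workState_ctr, h1]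
      simp only [reduceCtorEq, and_false, if_false]
      by_cases hj : j = (seeds (q * 2 ^ a + r)).1
      · rw [if_pos hj]
        exact ⟨_, rfl, h2.trans (Nat.le_add_right _ _)⟩
      · rw [if_neg hj]
        exact ⟨c', rfl, h2⟩
    · rw [hc]
      change ∃ c', (if j = phaseIdx seeds q s then
        (some c).map (· + (mixedAt a (phaseInterval S a q s) u).length) else some c) = some c' ∧ _
      split_ifs
      · exact ⟨_, rfl, le_rfl⟩
      · exact ⟨c, rfl, le_rfl⟩

/-- A later interval starts past all positions that the earlier one could use; this separates the
C-colors at a common low end point. -/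
theorem workState_count_mono {q r s : ℕ} (hsr : s < r) (hr : r < 2 ^ a) {u : Fin n} {k : ℕ}
    (hc : (workState level S seeds (q * 2 ^ a + s)).ctr u (phaseIdx seeds q s) ≠ none) :
    (workState level S seeds (q * 2 ^ a + s)).count (phaseIdx seeds q s) k u +
        (mixedAt a (phaseInterval S a q s) u).length ≤
      (workState level S seeds (q * 2 ^ a + r)).count (phaseIdx seeds q s) k u := by
  classical
  have h : ∀ j, ((workState level S seeds (q * 2 ^ a + s)).ctr u j).getD 0 +
      (if j = phaseIdx seeds q s then (mixedAt a (phaseInterval S a q s) u).length else 0) ≤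
      ((workState level S seeds (q * 2 ^ a + r)).ctr u j).getD 0 := by
    intro j
    cases hj : (workState level S seeds (q * 2 ^ a + s)).ctr u j with
    | none =>
      rw [if_neg]
      · simp
      · rintro rfl
        exact hc hj
    | some c =>
      obtain ⟨c', h1, h2⟩ := phaseState_ctr_mono level S seeds hsr hr hj
      rw [workState_ctr_getD level S seeds (q * 2 ^ a + r), h1]
      exact h2
  simp only [State.count]
  refine le_trans ?_ (Finset.sum_le_sum fun j _ => h j)
  rw [Finset.sum_add_distrib, Finset.sum_ite_eq']
  simp

end Phase

/-! ### Cutting a stream into intervals. -/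

section Streams

variable {n κ a : ℕ} (level : ℕ) (S : List (Edge n)) (seeds : ℕ → Seed n κ a)

theorem interval_sublist (l : ℕ) : (interval S l).Sublist S :=
  (List.take_sublist _ _).trans (List.drop_sublist _ _)

theorem interval_length_le (l : ℕ) : (interval S l).length ≤ n := List.length_take_le _ _

/-- Settles n = 0, where `numIntervals` divides by zero. -/
theorem eq_nil_of_vertices (S : List (Edge 0)) : S = [] := by
  cases S with
  | nil => rfl
  | cons e => exact e.src.elim0

theorem flatMap_interval (N : ℕ) :
    (List.range N).flatMap (interval S) = S.take (N * n) := by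
  induction N with
  | zero => simp
  | succ N ih =>
    rw [List.range_succ, List.flatMap_append, ih, Nat.succ_mul, List.take_add]
    simp [interval]

theorem length_le_numIntervals_mul : S.length ≤ numIntervals S * n := by
  rcases Nat.eq_zero_or_pos n with rfl | hn
  · simp [eq_nil_of_vertices S]
  · have h := Nat.div_add_mod (S.length + n - 1) n
    have h2 := Nat.mod_lt (S.length + n - 1) hn
    rw [numIntervals, mul_comm]
    omega

theorem flatMap_interval_eq : (List.range (numIntervals S)).flatMap (interval S) = S := by
  rw [flatMap_interval, List.take_of_length_le (length_le_numIntervals_mul S)]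

variable {α β : Type*}

theorem flatMap_append_perm (l : List α) (f g : α → List β) :
    (l.flatMap fun x => f x ++ g x).Perm (l.flatMap f ++ l.flatMap g) := by
  induction l with
  | nil => simp
  | cons x l ih =>
    simp only [List.flatMap_cons, List.append_assoc]
    refine List.Perm.append_left _ ?_
    refine (ih.append_left _).trans ?_
    rw [← List.append_assoc, ← List.append_assoc]
    exact List.perm_append_comm.append_right _

variable {S} in
theorem level_perm (hS : S.Nodup) :
    S.Perm ((levelColored level S seeds).map Prod.fst ++ levelLeftover level S seeds) := by
  unfold levelColored levelLeftover
  split_ifs with h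
  · simp [Function.comp_def, show (fun x : Edge n × ℕ => x.1) = Prod.fst from rfl, greedy_map_fst]
  · rw [List.map_flatMap]
    refine List.Perm.trans ?_ (flatMap_append_perm _ _ _)
    conv_lhs => rw [← flatMap_interval_eq S]
    exact List.Perm.flatMap_left _ fun l _ =>
      processInterval_perm level _ _ (hS.sublist (interval_sublist S l))

end Streams

/-! ### Disjoint color windows and properness within a level. -/

section Proper

variable {n κ a : ℕ}

/-- The amount by which the color index of a mixed edge exceeds the offset of its low-degree end
point. -/
noncomputable def State.advance (st : State n κ a) (σ : Fin (κ * 2 ^ a)) (k : ℕ)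
    (x : MixedItem n) : ℕ :=
  match st.ctr x.low σ with
  | some _ => st.count σ k x.low + x.rank
  | none => x.rank + 2 ^ a * st.repeats σ k

/-- The difference of the offsets of the end points of a mixed edge. -/
noncomputable def State.gap (st : State n κ a) (k : ℕ) (x : MixedItem n) : ℕ :=
  (st.off k x.high + palSize κ k - st.off k x.low) % palSize κ k

/-- The conditions under which a mixed edge proposes the color `c`. -/
theorem State.propose_eq_some {st : State n κ a} {level : ℕ} {I : List (Edge n)}
    {σ : Fin (κ * 2 ^ a)} {x : MixedItem n} {c : Color}
    (h : st.propose level I σ x = some c) :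
    2 * 2 ^ scale I x.high ≤ st.gap (scale I x.high) x ∧
    st.gap (scale I x.high) x ≤ palSize κ (scale I x.high) - 2 * 2 ^ scale I x.high ∧
    ((st.ctr x.low σ ≠ none ∧ st.advance σ (scale I x.high) x < 2 * 2 ^ scale I x.high ∧
        st.advance σ (scale I x.high) x = st.count σ (scale I x.high) x.low + x.rank ∧
        c = Color.C level (st.interval / 2 ^ a) (scale I x.high) (palIdx σ (scale I x.high))
          ((st.off (scale I x.high) x.low + st.advance σ (scale I x.high) x) %
            palSize κ (scale I x.high))) ∨
      (st.ctr x.low σ = none ∧ st.repeats σ (scale I x.high) * 2 ^ a < 2 * 2 ^ scale I x.high ∧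
        st.advance σ (scale I x.high) x = x.rank + 2 ^ a * st.repeats σ (scale I x.high) ∧
        c = Color.B level (st.interval / 2 ^ a) (scale I x.high) (palIdx σ (scale I x.high))
          ((st.off (scale I x.high) x.low + st.advance σ (scale I x.high) x) %
            palSize κ (scale I x.high)))) := by
  unfold State.propose at h
  simp only at h
  by_cases h1 : st.gap (scale I x.high) x < 2 * 2 ^ scale I x.high ∨
    palSize κ (scale I x.high) - 2 * 2 ^ scale I x.high < st.gap (scale I x.high) x
  · unfold State.gap at h1
    rw [if_pos h1] at h
    exact absurd h (by simp)
  have h2 := h1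
  unfold State.gap at h2
  rw [if_neg h2] at h
  push Not at h1
  refine ⟨h1.1, h1.2, ?_⟩
  unfold State.advance
  cases hc : st.ctr x.low σ with
  | some m =>
    rw [hc] at h
    simp only [Option.ite_none_left_eq_some, not_le, Option.some.injEq] at h
    exact Or.inl ⟨by simp, h.1, rfl, h.2.symm⟩
  | none =>
    rw [hc] at h
    simp only [Option.ite_none_left_eq_some, not_le, Option.some.injEq] at h
    refine Or.inr ⟨rfl, h.1, rfl, ?_⟩
    rw [← h.2]
    simp only [add_assoc]

/-- On the cycle of length K, two windows of length 2d are disjoint if their starting points are at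
least 2d apart in both directions. -/
theorem add_mod_ne_of_gap {A B K d t t' : ℕ} (hB : B ≤ K)
    (h1 : 2 * d ≤ (A + K - B) % K) (h2 : (A + K - B) % K ≤ K - 2 * d)
    (ht : t < 2 * d) (ht' : t' < 2 * d) : (A + t) % K ≠ (B + t') % K := by
  intro h
  have hKd : 0 < K := by
    by_contra hK
    have : K = 0 := by omega
    subst this
    simp only [add_zero, Nat.mod_zero] at *
    omega
  have hlt := Nat.mod_lt (A + K - B) hKd
  set δ := (A + K - B) % K with hδ
  have e1 : (δ : ℤ) ≡ A - B [ZMOD K] := by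
    have : ((A + K - B : ℕ) : ℤ) = A + K - B := by omega
    rw [hδ, Int.natCast_mod, this]
    refine (Int.mod_modEq _ _).trans ?_
    rw [show (A : ℤ) + K - B = (A - B) + K by ring]
    exact Int.add_modEq_right
  have e2 : (A + t : ℤ) ≡ B + t' [ZMOD K] := by
    have := congrArg (Nat.cast (R := ℤ)) h
    push_cast at this
    exact this
  have e3 : (K : ℤ) ∣ δ + t - t' := by
    have := (dvd_add e1.dvd e2.dvd).neg_right
    rwa [show -((A : ℤ) - B - δ + (B + t' - (A + t))) = δ + t - t' by ring] at this
  -- The multiple δ + t - t' of K is positive since t' < 2d ≤ δ, and less than K since δ ≤ K - 2d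
  -- and t < 2d.
  have := Int.le_of_dvd (by omega) e3
  omega

theorem add_mod_inj {A K s t : ℕ} (hs : s < K) (ht : t < K) (h : (A + s) % K = (A + t) % K) :
    s = t := by
  have h' : A + s ≡ A + t [MOD K] := h
  exact Nat.ModEq.eq_of_lt_of_lt (Nat.ModEq.add_left_cancel' A h') hs ht


/-- The level in which a color is created. -/
def Color.level : Color → ℕ
  | base l _ => l
  | small l _ _ => l
  | A l _ _ _ _ => l
  | B l _ _ _ _ => l
  | C l _ _ _ _ => l

/-- The interval, or the phase, in which a color is created. -/
def Color.place (a : ℕ) : Color → ℕ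
  | base _ _ => 0
  | small _ l _ => l / 2 ^ a
  | A _ q _ _ _ => q
  | B _ q _ _ _ => q
  | C _ q _ _ _ => q

section Level

variable (level : ℕ) (S : List (Edge n)) (seeds : ℕ → Seed n κ a)

/-- How an edge obtains its color in the `r`-th interval of the `q`-th phase. -/
theorem colored_cases {q r : ℕ} {e : Edge n} {c : Color}
    (h : (e, c) ∈ (resultAt level S seeds (q * 2 ^ a + r)).colored) (hr : r < 2 ^ a) :
    (∃ p ∈ greedy ((phaseInterval S a q r).filter fun e =>
        by classical exact decide (IsSmall a (phaseInterval S a q r) e)),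
      e = p.1 ∧ c = Color.small level (q * 2 ^ a + r) p.2) ∨
    (∃ p ∈ greedy ((phaseInterval S a q r).filter fun e =>
        by classical exact decide (IsHigh a (phaseInterval S a q r) e ∧
          ¬ (workState level S seeds (q * 2 ^ a + r)).Blocked (phaseInterval S a q r)
            (phaseIdx seeds q r) e)),
      e = p.1 ∧ c = Color.A level q (edgeScale (phaseInterval S a q r) e)
        (palIdx (phaseIdx seeds q r) (edgeScale (phaseInterval S a q r) e)) p.2) ∨
    (∃ x ∈ mixedItems a (phaseInterval S a q r), e = x.edge ∧
      (workState level S seeds (q * 2 ^ a + r)).propose level (phaseInterval S a q r)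
        (phaseIdx seeds q r) x = some c ∧
      ¬ (workState level S seeds (q * 2 ^ a + r)).Blocked (phaseInterval S a q r)
        (phaseIdx seeds q r) e ∧
      (e, c) ∈ ((workState level S seeds (q * 2 ^ a + r)).mixedPass level
        (phaseInterval S a q r) (phaseIdx seeds q r) (mixedItems a (phaseInterval S a q r))).1) := by
  have hq : (q * 2 ^ a + r) / 2 ^ a = q := by
    rw [Nat.mul_comm, Nat.mul_add_div (by positivity), Nat.div_eq_of_lt hr, add_zero]
  have hint := workState_interval level S seeds (q * 2 ^ a + r)
  have h' : (e, c) ∈ (((greedy ((phaseInterval S a q r).filter fun e =>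
        by classical exact decide (IsSmall a (phaseInterval S a q r) e))).map fun p =>
        (p.1, Color.small level (workState level S seeds (q * 2 ^ a + r)).interval p.2)) ++
      ((greedy ((phaseInterval S a q r).filter fun e =>
        by classical exact decide (IsHigh a (phaseInterval S a q r) e ∧
          ¬ (workState level S seeds (q * 2 ^ a + r)).Blocked (phaseInterval S a q r)
            (phaseIdx seeds q r) e))).map fun p =>
        (p.1, Color.A level ((workState level S seeds (q * 2 ^ a + r)).interval / 2 ^ a)
          (edgeScale (phaseInterval S a q r) p.1)
          (palIdx (phaseIdx seeds q r) (edgeScale (phaseInterval S a q r) p.1)) p.2))) ++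
      ((workState level S seeds (q * 2 ^ a + r)).mixedPass level
        (phaseInterval S a q r) (phaseIdx seeds q r)
        (mixedItems a (phaseInterval S a q r))).1 := h
  rw [hint, hq] at h'
  simp only [List.mem_append, List.mem_map, Prod.mk.injEq] at h'
  obtain (⟨p, hp, rfl, rfl⟩ | ⟨p, hp, rfl, rfl⟩) | h' := h'
  · exact Or.inl ⟨p, hp, rfl, rfl⟩
  · exact Or.inr (Or.inl ⟨p, hp, rfl, rfl⟩)
  · obtain ⟨x, hx, h1, h2, h3⟩ := State.mixedPass_colored _ _ _ _ h'
    simp only at h1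
    subst h1
    exact Or.inr (Or.inr ⟨x, hx, rfl, h2, h3, h'⟩)

theorem workState_off {q r : ℕ} (hr : r < 2 ^ a) (k : ℕ) (v : Fin n) :
    (workState level S seeds (q * 2 ^ a + r)).off k v = (seeds (q * 2 ^ a)).2 v % palSize κ k := by
  rw [State.off, workState_offset _ _ _ hr]

/-- A vertex cannot be high twice for the same threshold and the same index on unblocked edges. -/
theorem blocked_of_high {q r s : ℕ} (hsr : s < r) (hr : r < 2 ^ a) {v : Fin n} {e : Edge n}
    (hv : e.Inc v) (h1 : 2 ^ a ≤ deg (phaseInterval S a q r) v)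
    (h2 : scale (phaseInterval S a q r) v = edgeScale (phaseInterval S a q r) e)
    (h3 : 2 ^ a ≤ deg (phaseInterval S a q s) v)
    (h4 : scale (phaseInterval S a q s) v = scale (phaseInterval S a q r) v)
    (h5 : palIdx (phaseIdx seeds q s) (scale (phaseInterval S a q r) v) =
      palIdx (phaseIdx seeds q r) (scale (phaseInterval S a q r) v)) :
    (workState level S seeds (q * 2 ^ a + r)).Blocked (phaseInterval S a q r)
      (phaseIdx seeds q r) e :=
  ⟨v, hv, h1, h2, (mem_workState_used level S seeds hr _ _ _).mpr ⟨s, hsr, h3, h4, h5⟩⟩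

section Mixed

variable {q r : ℕ} {x : MixedItem n} {c : Color}

theorem pow_le_vertices {I : List (Edge n)} (hlen : I.length ≤ n)
    (hx : x ∈ mixedItems a I) : 2 ^ a ≤ n :=
  (MixedItem.isMixed hx).2.1.trans ((deg_le_length I _).trans hlen)

/-- The colors proposed for the mixed edges lie close to the offset of the low-degree end point. -/
theorem advance_lt (hS : S.Nodup) (hx : x ∈ mixedItems a (phaseInterval S a q r))
    (h : (workState level S seeds (q * 2 ^ a + r)).propose level (phaseInterval S a q r)
        (phaseIdx seeds q r) x = some c) :
    (workState level S seeds (q * 2 ^ a + r)).advance (phaseIdx seeds q r)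
      (scale (phaseInterval S a q r) x.high) x < 2 * 2 ^ scale (phaseInterval S a q r) x.high := by
  obtain ⟨-, -, ⟨-, h, -⟩ | ⟨hc, h, h', -⟩⟩ := State.propose_eq_some h
  · exact h
  · rw [h']
    have hb : x.rank < 2 ^ a := (MixedItem.rank_lt hx).trans_le
      ((mixedAt_length_le (hS.sublist (interval_sublist S _)) _).trans
        (deg_le_of_ctr_eq_none level S seeds hc))
    obtain ⟨m, hm⟩ : ∃ m, scale (phaseInterval S a q r) x.high = a + m :=
      Nat.exists_eq_add_of_le (le_scale (MixedItem.isMixed hx).2.1)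
    rw [hm, pow_add] at h ⊢
    -- For B-colors: √D · p and 2d = √D · 2 · 2^m are multiples of √D, so p · √D < 2d leaves room
    -- for a whole block of length √D, and the rank is below √D.
    have h2 : (workState level S seeds (q * 2 ^ a + r)).repeats (phaseIdx seeds q r) (a + m) + 1 ≤
        2 * 2 ^ m := by
      by_contra hcon
      have : 2 ^ a * (2 * 2 ^ m) ≤ 2 ^ a *
        (workState level S seeds (q * 2 ^ a + r)).repeats (phaseIdx seeds q r) (a + m) :=
          Nat.mul_le_mul_left _ (by omega)
      nlinarith
    have := Nat.mul_le_mul_left (2 ^ a) h2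
    nlinarith

end Mixed

theorem two_mul_pow_le_palSize (hκ : 0 < κ) (k : ℕ) : 2 * 2 ^ k ≤ palSize κ k := by
  rw [palSize]
  exact Nat.mul_le_mul_right _ (by omega)

/-- Two adjacent mixed edges of one phase never get the same color. -/
theorem mixed_proper (hκ : 0 < κ) (hS : S.Nodup) {q r s : ℕ} (hsr : s ≤ r) (hr : r < 2 ^ a)
    {x y : MixedItem n} {c : Color}
    (hx : x ∈ mixedItems a (phaseInterval S a q r)) (hy : y ∈ mixedItems a (phaseInterval S a q s))
    (hpx : (workState level S seeds (q * 2 ^ a + r)).propose level (phaseInterval S a q r)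
        (phaseIdx seeds q r) x = some c)
    (hpy : (workState level S seeds (q * 2 ^ a + s)).propose level (phaseInterval S a q s)
        (phaseIdx seeds q s) y = some c)
    (hbx : ¬ (workState level S seeds (q * 2 ^ a + r)).Blocked (phaseInterval S a q r)
        (phaseIdx seeds q r) x.edge)
    (hcx : (x.edge, c) ∈ ((workState level S seeds (q * 2 ^ a + r)).mixedPass level
        (phaseInterval S a q r) (phaseIdx seeds q r) (mixedItems a (phaseInterval S a q r))).1)
    (hcy : (y.edge, c) ∈ ((workState level S seeds (q * 2 ^ a + s)).mixedPass level
        (phaseInterval S a q s) (phaseIdx seeds q s) (mixedItems a (phaseInterval S a q s))).1)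
    (hadj : x.edge.Adj y.edge) : x.edge = y.edge := by
  by_contra hne
  have hs : s < 2 ^ a := by omega
  have hmx := MixedItem.isMixed hx
  have hmy := MixedItem.isMixed hy
  have hax := advance_lt level S seeds hS hx hpx
  have hay := advance_lt level S seeds hS hy hpy
  obtain ⟨g1, g2, hX⟩ := State.propose_eq_some hpx
  obtain ⟨g3, g4, hY⟩ := State.propose_eq_some hpy
  -- the two edges have the same threshold, index and color
  have hk : scale (phaseInterval S a q s) y.high = scale (phaseInterval S a q r) x.high := by
    obtain ⟨-, -, -, h⟩ | ⟨-, -, -, h⟩ := hX <;> obtain ⟨-, -, -, h'⟩ | ⟨-, -, -, h'⟩ := hY <;>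
      simp_all
  rw [hk] at hay g3 g4 hY
  set k := scale (phaseInterval S a q r) x.high with hkdef
  have hmem : palIdx (phaseIdx seeds q s) k = palIdx (phaseIdx seeds q r) k ∧
      ((workState level S seeds (q * 2 ^ a + r)).off k x.low +
          (workState level S seeds (q * 2 ^ a + r)).advance (phaseIdx seeds q r) k x) %
            palSize κ k =
      ((workState level S seeds (q * 2 ^ a + s)).off k y.low +
          (workState level S seeds (q * 2 ^ a + s)).advance (phaseIdx seeds q s) k y) %
            palSize κ k := by
    obtain ⟨-, -, -, h⟩ | ⟨-, -, -, h⟩ := hX <;> obtain ⟨-, -, -, h'⟩ | ⟨-, -, -, h'⟩ := hY <;>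
      rw [h] at h' <;> simp only [Color.C.injEq, Color.B.injEq, reduceCtorEq] at h' <;>
      exact ⟨h'.2.2.2.1.symm, h'.2.2.2.2⟩
  obtain ⟨hi, hcol⟩ := hmem
  unfold State.gap at g1 g2 g3 g4
  rw [workState_off _ _ _ hr, workState_off _ _ _ hs] at hcol
  rw [workState_off _ _ _ hr, workState_off _ _ _ hr] at g1 g2
  rw [workState_off _ _ _ hs, workState_off _ _ _ hs] at g3 g4
  have hK0 : 0 < palSize κ k := by rw [palSize]; positivity
  have hoff : ∀ v : Fin n, ((seeds (q * 2 ^ a)).2 v : ℕ) % palSize κ k ≤ palSize κ k :=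
    fun v => (Nat.mod_lt _ hK0).le
  have hKle := two_mul_pow_le_palSize hκ k
  obtain ⟨v, hvx, hvy⟩ := hadj
  obtain rfl | rfl := hmx.eq_or_eq hvx
  · obtain hv | hv := hmy.eq_or_eq hvy
    · -- the common vertex is low-degree on both sides
      rw [hv] at hcol
      have hadv := add_mod_inj (hax.trans_le hKle) (hay.trans_le hKle) hcol
      obtain rfl | hlt := hsr.eq_or_lt
      · refine hne (congrArg _ (MixedItem.eq_of_rank hx hy hv ?_))
        obtain ⟨-, -, h, hc⟩ | ⟨-, -, h, hc⟩ := hX <;>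
          obtain ⟨-, -, h', hc'⟩ | ⟨-, -, h', hc'⟩ := hY
        · rw [h, h', hv] at hadv
          omega
        · exact absurd (hc.symm.trans hc') (by simp)
        · exact absurd (hc.symm.trans hc') (by simp)
        · rw [h, h'] at hadv
          omega
      · have hn : 2 ^ a ≤ n := pow_le_vertices (interval_length_le S _) hx
        obtain ⟨-, -, h, hc⟩ | ⟨-, -, h, hc⟩ := hX <;>
          obtain ⟨hcs, -, h', hc'⟩ | ⟨hcs, -, h', hc'⟩ := hY
        -- Both colors come from C: the later count exceeds the earlier count plus the earlier rank.
        · have hmono := workState_count_mono level S seeds hlt hr (k := k) hcs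
          have hcount : (workState level S seeds (q * 2 ^ a + r)).count (phaseIdx seeds q s) k
              y.low = (workState level S seeds (q * 2 ^ a + r)).count (phaseIdx seeds q r) k
              y.low := by
            simp only [State.count, hi]
          have := MixedItem.rank_lt hy
          rw [h, h', hv] at hadv
          omega
        · exact absurd (hc.symm.trans hc') (by simp)
        · exact absurd (hc.symm.trans hc') (by simp)
        -- Both colors come from B: interval s itself is one more repetition at time r, which shifts
        -- the block by √D, more than the earlier rank. That the drawn indices were recorded at all
        -- uses √D ≤ n.
        · have hrep : (workState level S seeds (q * 2 ^ a + s)).repeats (phaseIdx seeds q s) k + 1 ≤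
              (workState level S seeds (q * 2 ^ a + r)).repeats (phaseIdx seeds q r) k := by
            rw [workState_repeats _ _ _ hr, workState_repeats _ _ _ hs, if_pos hn, if_pos hn, hi]
            have : ∑ t ∈ Finset.range (s + 1),
                (if palIdx (phaseIdx seeds q t) k = palIdx (phaseIdx seeds q r) k then 1 else 0) ≤
                ∑ t ∈ Finset.range r,
                (if palIdx (phaseIdx seeds q t) k = palIdx (phaseIdx seeds q r) k then 1 else 0) :=
              Finset.sum_le_sum_of_subset (Finset.range_mono hlt)
            rw [Finset.sum_range_succ, if_pos hi] at this
            exact this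
          have hb : y.rank < 2 ^ a := (MixedItem.rank_lt hy).trans_le
            ((mixedAt_length_le (hS.sublist (interval_sublist S _)) _).trans
              (deg_le_of_ctr_eq_none level S seeds hcs))
          rw [h, h'] at hadv
          have := Nat.mul_le_mul_left (2 ^ a) hrep
          nlinarith
    -- The common vertex is low for x and high for y: the gap test passed by y separates its window
    -- from the one of the low end of y. The next case is symmetric.
    · rw [hv] at hcol
      exact add_mod_ne_of_gap (hoff _) g3 g4 hax hay hcol
  · obtain hv | hv := hmy.eq_or_eq hvy
    · rw [← hv] at hcol
      exact add_mod_ne_of_gap (hoff _) g1 g2 hay hax hcol.symm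
    -- The common vertex is high for both: within one interval the explicit test excludes equal
    -- colors, and across intervals x would have been blocked.
    · obtain rfl | hlt := hsr.eq_or_lt
      · refine hne (State.mixedPass_proper _ _ _ _
          (mixedItems_nodup (hS.sublist (interval_sublist S _))) hx hy hcx hcy hvy ?_)
        rw [← hv]
        exact hmx.inc_high
      · refine hbx (blocked_of_high level S seeds hlt hr hvx hmx.2.1 hmx.edgeScale_eq.symm ?_ ?_ hi)
        · rw [hv]
          exact hmy.2.1
        · rw [hv, hk, hkdef, hv]

/-- Palettes of different kinds are disjoint, so only edges of the same kind need comparing. The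
order s ≤ r makes r the interval in which blocking acts. -/
theorem interval_proper (hκ : 0 < κ) (hS : S.Nodup) {q r s : ℕ} (hsr : s ≤ r) (hr : r < 2 ^ a)
    {e f : Edge n} {c : Color} (he : (e, c) ∈ (resultAt level S seeds (q * 2 ^ a + r)).colored)
    (hf : (f, c) ∈ (resultAt level S seeds (q * 2 ^ a + s)).colored) (hadj : e.Adj f) : e = f := by
  by_contra hne
  obtain ⟨p, hp, rfl, rfl⟩ | ⟨p, hp, rfl, rfl⟩ | ⟨x, hx, rfl, hpx, hbx, hcx⟩ :=
    colored_cases level S seeds he hr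
  · obtain ⟨p', hp', rfl, h⟩ | ⟨p', hp', rfl, h⟩ | ⟨y, hy, rfl, hpy, hby, hcy⟩ :=
      colored_cases level S seeds hf (by omega)
    · simp only [Color.small.injEq, true_and] at h
      obtain rfl : r = s := by omega
      exact greedy_proper hp hp' hne hadj h.2
    · simp at h
    · obtain ⟨-, -, ⟨-, -, -, h⟩ | ⟨-, -, -, h⟩⟩ := State.propose_eq_some hpy <;> simp at h
  · obtain ⟨p', hp', rfl, h⟩ | ⟨p', hp', rfl, h⟩ | ⟨y, hy, rfl, hpy, hby, hcy⟩ :=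
      colored_cases level S seeds hf (by omega)
    · simp at h
    · simp only [Color.A.injEq, true_and] at h
      obtain ⟨h1, h2, h3⟩ := h
      obtain rfl | hlt := hsr.eq_or_lt
      · exact greedy_proper hp hp' hne hadj h3
      · obtain ⟨v, hv, hv'⟩ := hadj
        have m1 := greedy_fst_mem hp
        have m2 := greedy_fst_mem hp'
        simp only [List.mem_filter, decide_eq_true_eq] at m1 m2
        have d1 := m1.2.1.two_pow_le_deg m1.1 hv
        have d2 := m2.2.1.two_pow_le_deg m2.1 hv'
        refine m1.2.2 (blocked_of_high level S seeds hlt hr hv d1.1 d1.2 d2.1 ?_ ?_)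
        · rw [d1.2, d2.2, h1]
        · rw [d1.2, h2, h1]
    · obtain ⟨-, -, ⟨-, -, -, h⟩ | ⟨-, -, -, h⟩⟩ := State.propose_eq_some hpy <;> simp at h
  · obtain ⟨p', hp', rfl, h⟩ | ⟨p', hp', rfl, h⟩ | ⟨y, hy, rfl, hpy, hby, hcy⟩ :=
      colored_cases level S seeds hf (by omega)
    · obtain ⟨-, -, ⟨-, -, -, h'⟩ | ⟨-, -, -, h'⟩⟩ := State.propose_eq_some hpx <;> simp [h] at h'
    · obtain ⟨-, -, ⟨-, -, -, h'⟩ | ⟨-, -, -, h'⟩⟩ := State.propose_eq_some hpx <;> simp [h] at h'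
    · exact hne (mixed_proper level S seeds hκ hS hsr hr hx hy hpx hpy hbx hcx hcy hadj)

/-- The color reveals level and phase; this reduces properness to pairs of intervals of a single
phase. -/
theorem colored_place {q r : ℕ} {e : Edge n} {c : Color} (hr : r < 2 ^ a)
    (h : (e, c) ∈ (resultAt level S seeds (q * 2 ^ a + r)).colored) :
    c.level = level ∧ c.place a = q := by
  have hq : (q * 2 ^ a + r) / 2 ^ a = q := by
    rw [Nat.mul_comm, Nat.mul_add_div (by positivity), Nat.div_eq_of_lt hr, add_zero]
  obtain ⟨p, hp, rfl, rfl⟩ | ⟨p, hp, rfl, rfl⟩ | ⟨x, hx, rfl, hpx, hbx, hcx⟩ :=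
    colored_cases level S seeds h hr
  · exact ⟨rfl, hq⟩
  · exact ⟨rfl, rfl⟩
  · have hint := workState_interval level S seeds (q * 2 ^ a + r)
    obtain ⟨-, -, ⟨-, -, -, rfl⟩ | ⟨-, -, -, rfl⟩⟩ := State.propose_eq_some hpx <;>
      simp [Color.level, Color.place, hint, hq]

theorem levelColored_level {e : Edge n} {c : Color} (h : (e, c) ∈ levelColored level S seeds) :
    c.level = level := by
  unfold levelColored at h
  split_ifs at h
  · obtain ⟨p, hp, h⟩ := List.mem_map.mp h
    simp only [Prod.mk.injEq] at h
    rw [← h.2]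
    rfl
  · obtain ⟨l, hl, h⟩ := List.mem_flatMap.mp h
    rw [← Nat.div_add_mod' l (2 ^ a)] at h
    exact (colored_place level S seeds (Nat.mod_lt _ (by positivity)) h).1

theorem level_proper (hκ : 0 < κ) (hS : S.Nodup) {e f : Edge n} {c : Color}
    (he : (e, c) ∈ levelColored level S seeds) (hf : (f, c) ∈ levelColored level S seeds)
    (hadj : e.Adj f) : e = f := by
  unfold levelColored at he hf
  split_ifs at he hf
  · obtain ⟨p, hp, he⟩ := List.mem_map.mp he
    obtain ⟨p', hp', hf⟩ := List.mem_map.mp hf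
    simp only [Prod.mk.injEq] at he hf
    obtain ⟨rfl, rfl⟩ := he
    obtain ⟨rfl, h⟩ := hf
    simp only [Color.base.injEq, true_and] at h
    by_contra hne
    exact greedy_proper hp hp' hne hadj h.symm
  · obtain ⟨l, -, he⟩ := List.mem_flatMap.mp he
    obtain ⟨l', -, hf⟩ := List.mem_flatMap.mp hf
    rw [← Nat.div_add_mod' l (2 ^ a)] at he
    rw [← Nat.div_add_mod' l' (2 ^ a)] at hf
    have hr := Nat.mod_lt l (show 0 < 2 ^ a by positivity)
    have hr' := Nat.mod_lt l' (show 0 < 2 ^ a by positivity)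
    have hq : l' / 2 ^ a = l / 2 ^ a := by
      rw [← (colored_place level S seeds hr he).2, (colored_place level S seeds hr' hf).2]
    rw [hq] at hf
    obtain h | h := le_total (l' % 2 ^ a) (l % 2 ^ a)
    · exact interval_proper level S seeds hκ hS h hr he hf hadj
    · exact (interval_proper level S seeds hκ hS h hr' hf he hadj.symm).symm

end Level

end Proper

/-! ### All recursion levels together. -/

section Global

variable {n κ a : ℕ} (E : List (Edge n)) (ω : Outcome n κ a)

/-- The edges that are colored in the first `J` levels. -/
noncomputable def coloredBelow (J : ℕ) : List (Edge n × Color) :=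
  (List.range J).flatMap fun j => levelColored j (virtualStream E ω j) fun l => ω (j, l)

variable {E}

/-- The invariant of the recursion: edges colored so far and the current virtual stream together are
a rearrangement of E. Uniqueness of colors, the degree bound for virtual streams and completeness at
finite depth all follow from it. -/
theorem coloredBelow_perm (hE : E.Nodup) (J : ℕ) :
    E.Perm ((coloredBelow E ω J).map Prod.fst ++ virtualStream E ω J) := by
  induction J with
  | zero => simp [coloredBelow, virtualStream]
  | succ J ih =>
    have hJ : (virtualStream E ω J).Nodup := (List.nodup_append.mp (ih.nodup hE)).2.1
    refine ih.trans ?_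
    have h : coloredBelow E ω (J + 1) = coloredBelow E ω J ++
        levelColored J (virtualStream E ω J) fun l => ω (J, l) := by
      simp [coloredBelow, List.range_succ]
    rw [h, List.map_append, List.append_assoc]
    exact List.Perm.append_left _ (level_perm J (fun l => ω (J, l)) hJ)

theorem virtualStream_subperm (hE : E.Nodup) (j : ℕ) : (virtualStream E ω j).Subperm E :=
  (List.sublist_append_right _ _).subperm.trans (coloredBelow_perm ω hE j).symm.subperm

theorem virtualStream_nodup (hE : E.Nodup) (j : ℕ) : (virtualStream E ω j).Nodup :=
  (List.nodup_append.mp ((coloredBelow_perm ω hE j).nodup hE)).2.1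

theorem mem_coloredBelow {j J : ℕ} (hj : j < J) {p : Edge n × Color}
    (hp : p ∈ levelColored j (virtualStream E ω j) fun l => ω (j, l)) :
    p ∈ coloredBelow E ω J :=
  List.mem_flatMap.mpr ⟨j, List.mem_range.mpr hj, hp⟩

theorem isPartialColoring_output (hκ : 0 < κ) (hE : E.Nodup) :
    IsPartialColoring E (output E ω) := by
  refine ⟨?_, ?_, ?_⟩
  · rintro e c ⟨j, hj⟩
    rw [(coloredBelow_perm ω hE (j + 1)).mem_iff]
    exact List.mem_append_left _
      (List.mem_map_of_mem (f := Prod.fst) (mem_coloredBelow ω j.lt_succ_self hj))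
  · rintro e c c' ⟨j, hj⟩ ⟨j', hj'⟩
    have hnd := (List.nodup_append.mp
      ((coloredBelow_perm ω hE (max j j' + 1)).nodup hE)).1
    have := List.inj_on_of_nodup_map hnd
      (mem_coloredBelow ω (Nat.lt_succ_of_le (le_max_left j j')) hj)
      (mem_coloredBelow ω (Nat.lt_succ_of_le (le_max_right j j')) hj') rfl
    exact (Prod.mk.inj this).2
  · rintro e f c c' ⟨j, hj⟩ ⟨j', hj'⟩ hne hadj rfl
    have h1 := levelColored_level _ _ _ hj
    have h2 := levelColored_level _ _ _ hj'
    obtain rfl : j = j' := h1.symm.trans h2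
    exact hne (level_proper _ _ _ hκ (virtualStream_nodup ω hE j) hj hj' hadj)

theorem virtualStream_eq_nil_of_le {i j : ℕ} (hij : i ≤ j) (h : virtualStream E ω i = []) :
    virtualStream E ω j = [] := by
  induction j, hij using Nat.le_induction with
  | base => exact h
  | succ j _ ih =>
    rw [virtualStream, ih]
    simp [levelLeftover]

theorem exists_virtualStream_eq_nil (h : depth E ω ≠ ⊤) : ∃ j, virtualStream E ω j = [] := by
  by_contra hc
  push Not at hc
  apply h
  have : {j | virtualStream E ω j ≠ []} = Set.univ := Set.eq_univ_of_forall hc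
  rw [depth, this, Set.encard_univ]
  simp

theorem isColoring_output (hκ : 0 < κ) (hE : E.Nodup) (h : depth E ω ≠ ⊤) :
    IsColoring E (output E ω) := by
  refine ⟨isPartialColoring_output ω hκ hE, fun e he => ?_⟩
  obtain ⟨J, hJ⟩ := exists_virtualStream_eq_nil ω h
  rw [(coloredBelow_perm ω hE J).mem_iff, hJ, List.append_nil, List.mem_map] at he
  obtain ⟨⟨e, c⟩, hp, rfl⟩ := he
  obtain ⟨j, -, hj⟩ := List.mem_flatMap.mp hp
  exact ⟨c, j, hj⟩

end Global

/-! ### Degree sums and ranges of the parameters. -/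

section Degrees

variable {n : ℕ}

theorem deg_cons (e : Edge n) (L : List (Edge n)) (v : Fin n) [Decidable (e.Inc v)] :
    deg (e :: L) v = deg L v + if e.Inc v then 1 else 0 := by
  simp [deg, List.countP_cons]

/-- Charging each edge to its source alone avoids any assumption on loops, which `deg` counts once.
-/
theorem length_le_sum_deg (L : List (Edge n)) : L.length ≤ ∑ v, deg L v := by
  classical
  induction L with
  | nil => simp
  | cons e L ih =>
    simp only [deg_cons, Finset.sum_add_distrib, List.length_cons]
    have : 1 ≤ ∑ v, if e.Inc v then 1 else 0 := by
      refine le_trans ?_ (Finset.single_le_sum (fun _ _ => Nat.zero_le _)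
        (Finset.mem_univ e.src))
      rw [if_pos (show e.Inc e.src from Or.inl rfl)]
    omega

theorem sum_deg_le (L : List (Edge n)) : ∑ v, deg L v ≤ 2 * L.length := by
  classical
  induction L with
  | nil => simp [deg]
  | cons e L ih =>
    simp only [deg_cons, Finset.sum_add_distrib, List.length_cons]
    have : (∑ v, if e.Inc v then 1 else 0) ≤ 2 := by
      rw [← Finset.card_filter]
      refine le_trans (Finset.card_le_card (t := {e.src, e.tgt}) ?_) Finset.card_le_two
      intro v hv
      simp only [Finset.mem_filter, Finset.mem_univ, true_and] at hv
      simp only [Finset.mem_insert, Finset.mem_singleton]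
      exact hv.imp Eq.symm Eq.symm
    omega

theorem length_le_of_deg_le {L : List (Edge n)} {D : ℕ} (h : ∀ v, deg L v ≤ D) :
    L.length ≤ n * D := by
  refine (length_le_sum_deg L).trans ((Finset.sum_le_sum fun v _ => h v).trans ?_)
  simp

/-- There are at most nD edges, cut into pieces of n. For D = 4^a this leaves at most √D phases. -/
theorem numIntervals_le {L : List (Edge n)} {D : ℕ} (h : ∀ v, deg L v ≤ D) :
    numIntervals L ≤ D := by
  rcases Nat.eq_zero_or_pos n with rfl | hn
  · simp [numIntervals, eq_nil_of_vertices L]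
  · have h1 := length_le_of_deg_le h
    rw [numIntervals, ← Nat.lt_succ_iff, Nat.div_lt_iff_lt_mul hn]
    have : (D + 1) * n = n * D + n := by ring
    simp only [Nat.succ_eq_add_one]
    omega

theorem deg_interval_le (S : List (Edge n)) (l : ℕ) (v : Fin n) : deg (interval S l) v ≤ deg S v :=
  deg_le_of_subperm (interval_sublist S l).subperm v

theorem scale_le {a : ℕ} {I : List (Edge n)} {v : Fin n} (h : deg I v ≤ 4 ^ a) :
    scale I v ≤ 2 * a := by
  have : (4 : ℕ) ^ a = 2 ^ (2 * a) := by rw [pow_mul]; norm_num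
  rw [this] at h
  refine (Nat.log_mono_right h).trans ?_
  rw [Nat.log_pow (by norm_num)]

theorem numPal_eq {κ a k : ℕ} (hk : k ≤ 2 * a) : numPal κ a k = κ * 2 ^ (2 * a - k) := by
  have h : (4 : ℕ) ^ a = 2 ^ (2 * a - k) * 2 ^ k := by
    rw [← pow_add, Nat.sub_add_cancel hk, pow_mul]
    norm_num
  rw [numPal, h, ← mul_assoc, Nat.mul_div_cancel _ (by positivity)]

theorem numPal_mul {κ a k : ℕ} (hk : k ≤ 2 * a) : numPal κ a k * 2 ^ k = κ * 4 ^ a := by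
  rw [numPal_eq hk, mul_assoc, ← pow_add, Nat.sub_add_cancel hk, pow_mul]
  norm_num

/-- By the degree sum, an interval of n edges has at most 2n/√D vertices of degree at least √D. This
is what keeps the recorded data of a phase linear in n. -/
theorem card_high_mul_le (a : ℕ) (I : List (Edge n)) :
    (Finset.univ.filter fun v => 2 ^ a ≤ deg I v).card * 2 ^ a ≤ 2 * I.length := by
  refine le_trans ?_ (sum_deg_le I)
  rw [← smul_eq_mul]
  refine (Finset.card_nsmul_le_sum _ (deg I) _ fun v hv => ?_).trans
    (Finset.sum_le_sum_of_subset (Finset.filter_subset _ _))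
  exact (Finset.mem_filter.mp hv).2

end Degrees

/-! ### Number of colors of a level. -/

section Palette

variable {n κ a : ℕ}

/-- Phase, threshold, palette index and position of the colors `A`, `B`, `C` of a level. -/
def levelKeys (κ a : ℕ) : Finset (ℕ × Σ _ : ℕ, ℕ × ℕ) :=
  Finset.range (2 ^ a) ×ˢ (Finset.range (a + 1)).sigma fun m =>
    Finset.range (κ * 2 ^ (a - m)) ×ˢ Finset.range (4 * κ * 2 ^ (a + m))

/-- Palette number and palette size vary inversely, so each of the a + 1 thresholds contributes the
same 4κ²D positions in each of the √D phases. -/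
theorem card_levelKeys : (levelKeys κ a).card = 2 ^ a * ((a + 1) * (4 * κ ^ 2 * 4 ^ a)) := by
  rw [levelKeys, Finset.card_product, Finset.card_sigma, Finset.card_range]
  congr 1
  have : ∀ m ∈ Finset.range (a + 1), (Finset.range (κ * 2 ^ (a - m)) ×ˢ
      Finset.range (4 * κ * 2 ^ (a + m))).card = 4 * κ ^ 2 * 4 ^ a := by
    intro m hm
    have hm : m ≤ a := Nat.lt_succ_iff.mp (Finset.mem_range.mp hm)
    rw [Finset.card_product, Finset.card_range, Finset.card_range]
    have h : (4 : ℕ) ^ a = 2 ^ (a - m) * 2 ^ (a + m) := by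
      rw [← pow_add, show a - m + (a + m) = 2 * a by omega, pow_mul]
      norm_num
    rw [h]
    ring
  rw [Finset.sum_congr rfl this]
  simp

open scoped Classical in
/-- The colors that a level may use. -/
noncomputable def levelPalette (κ a level : ℕ) : Finset Color :=
  (Finset.range (2 * 4 ^ a + 1)).image (Color.base level) ∪
  (Finset.range (4 ^ a) ×ˢ Finset.range (2 * 2 ^ a + 1)).image (fun x => Color.small level x.1 x.2) ∪
  (levelKeys κ a).image (fun x => Color.A level x.1 (a + x.2.1) x.2.2.1 x.2.2.2) ∪
  (levelKeys κ a).image (fun x => Color.B level x.1 (a + x.2.1) x.2.2.1 x.2.2.2) ∪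
  (levelKeys κ a).image (fun x => Color.C level x.1 (a + x.2.1) x.2.2.1 x.2.2.2)

/-- 18 = 3 · 4 + 6: the three families A, B, C have 4κ²(a+1)8^a colors each, and the base and small
palettes together have at most 6 · 8^a. -/
theorem card_levelPalette_le (hκ : 0 < κ) (level : ℕ) :
    (levelPalette κ a level).card ≤ 18 * κ ^ 2 * (a + 1) * 8 ^ a := by
  classical
  have h : (levelPalette κ a level).card ≤ (2 * 4 ^ a + 1) + 4 ^ a * (2 * 2 ^ a + 1) +
      (levelKeys κ a).card + (levelKeys κ a).card + (levelKeys κ a).card := by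
    unfold levelPalette
    refine (Finset.card_union_le _ _).trans (add_le_add ?_ Finset.card_image_le)
    refine (Finset.card_union_le _ _).trans (add_le_add ?_ Finset.card_image_le)
    refine (Finset.card_union_le _ _).trans (add_le_add ?_ Finset.card_image_le)
    refine (Finset.card_union_le _ _).trans (add_le_add ?_ ?_)
    · exact Finset.card_image_le.trans (by simp)
    · exact Finset.card_image_le.trans (by simp)
  refine h.trans ?_
  rw [card_levelKeys, show (8 : ℕ) ^ a = 2 ^ a * 4 ^ a by rw [← mul_pow]; norm_num]
  have h2 : 1 ≤ 2 ^ a := Nat.one_le_two_pow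
  have h4 : 1 ≤ 4 ^ a := Nat.one_le_pow _ _ (by norm_num)
  generalize (2 : ℕ) ^ a = x at *
  generalize (4 : ℕ) ^ a = y at *
  have hxy : y ≤ x * y := Nat.le_mul_of_pos_left y h2
  have h1 : 2 * y + 1 + y * (2 * x + 1) ≤ 6 * (x * y) := by nlinarith
  have h5 : 1 * (x * y) ≤ (κ ^ 2 * (a + 1)) * (x * y) :=
    Nat.mul_le_mul_right _ (Nat.mul_pos (by positivity) (by omega))
  nlinarith

theorem palIdx_lt (hκ : 0 < κ) (σ : Fin (κ * 2 ^ a)) {k : ℕ} (hk : k ≤ 2 * a) :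
    palIdx σ k < numPal κ a k :=
  Nat.mod_lt _ (by rw [numPal_eq hk]; positivity)

theorem mem_levelKeys {q k i x : ℕ} (hq : q < 2 ^ a) (hk : a ≤ k) (hk' : k ≤ 2 * a)
    (hi : i < numPal κ a k) (hx : x < 4 * κ * 2 ^ k) :
    ∃ y ∈ levelKeys κ a, y = ⟨q, k - a, i, x⟩ ∧ a + y.2.1 = k := by
  refine ⟨_, ?_, rfl, by simp only; omega⟩
  rw [numPal_eq hk'] at hi
  simp only [levelKeys, Finset.mem_product, Finset.mem_range, Finset.mem_sigma]
  refine ⟨hq, by omega, ?_, ?_⟩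
  · rwa [show a - (k - a) = 2 * a - k by omega]
  · rwa [show a + (k - a) = k by omega]

variable (level : ℕ) (S : List (Edge n)) (seeds : ℕ → Seed n κ a)

variable {S} in
-- The degree bound D limits intervals to D, phases to √D, and thresholds to the exponents from a to
-- 2a.
theorem mem_levelPalette (hκ : 0 < κ) (hdeg : ∀ v, deg S v ≤ 4 ^ a) {p : Edge n × Color}
    (h0 : p ∈ levelColored level S seeds) : p.2 ∈ levelPalette κ a level := by
  classical
  obtain ⟨e, c⟩ := p
  have hsub : ∀ (I : List (Edge n)) (P : Edge n → Bool) (v : Fin n),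
      deg (I.filter P) v ≤ deg I v := fun I P v =>
    deg_le_of_subperm List.filter_sublist.subperm v
  unfold levelColored at h0
  split_ifs at h0
  · obtain ⟨p, hp, h⟩ := List.mem_map.mp h0
    simp only [Prod.mk.injEq] at h
    obtain ⟨rfl, rfl⟩ := h
    have : p.2 ≤ 2 * 4 ^ a := by
      have := greedy_le hp
      have := hdeg p.1.src
      have := hdeg p.1.tgt
      omega
    simp only [levelPalette, Finset.mem_union, Finset.mem_image, Finset.mem_range]
    exact Or.inl (Or.inl (Or.inl (Or.inl ⟨_, by omega, rfl⟩)))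
  · obtain ⟨l, hl, h⟩ := List.mem_flatMap.mp h0
    have hl : l < 4 ^ a := (List.mem_range.mp hl).trans_le (numIntervals_le hdeg)
    rw [← Nat.div_add_mod' l (2 ^ a)] at h
    have hr : l % 2 ^ a < 2 ^ a := Nat.mod_lt _ (by positivity)
    have hq : l / 2 ^ a < 2 ^ a := by
      rw [Nat.div_lt_iff_lt_mul (by positivity), ← mul_pow]
      exact hl
    have hsc : ∀ v, scale (phaseInterval S a (l / 2 ^ a) (l % 2 ^ a)) v ≤ 2 * a := fun v =>
      scale_le ((deg_interval_le S _ v).trans (hdeg v))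
    have hidx : ∀ k, 0 < palSize κ k ∧ palSize κ k ≤ 4 * κ * 2 ^ k := by
      intro k
      rw [palSize]
      refine ⟨by positivity, Nat.mul_le_mul_right _ (by omega)⟩
    obtain ⟨p, hp, rfl, rfl⟩ | ⟨p, hp, rfl, rfl⟩ | ⟨x, hx, rfl, hpx, hbx, hcx⟩ :=
      colored_cases level S seeds h hr
    · have : p.2 ≤ 2 * 2 ^ a := by
        have he := greedy_fst_mem hp
        simp only [List.mem_filter, decide_eq_true_eq] at he
        have h1 := greedy_le hp
        have h2 := hsub (phaseInterval S a (l / 2 ^ a) (l % 2 ^ a)) (fun e => decide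
          (IsSmall a (phaseInterval S a (l / 2 ^ a) (l % 2 ^ a)) e)) p.1.src
        have h3 := hsub (phaseInterval S a (l / 2 ^ a) (l % 2 ^ a)) (fun e => decide
          (IsSmall a (phaseInterval S a (l / 2 ^ a) (l % 2 ^ a)) e)) p.1.tgt
        have h4 := he.2.1
        have h5 := he.2.2
        have h6 := h1.trans (Nat.add_le_add (h2.trans h4.le) (h3.trans h5.le))
        omega
      simp only [levelPalette, Finset.mem_union, Finset.mem_image, Finset.mem_product,
        Finset.mem_range]
      refine Or.inl (Or.inl (Or.inl (Or.inr ⟨(_, p.2), ⟨?_, Nat.lt_succ_of_le this⟩, rfl⟩)))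
      rwa [Nat.div_add_mod']
    · set I := phaseInterval S a (l / 2 ^ a) (l % 2 ^ a) with hI
      have hp1 := greedy_fst_mem hp
      simp only [List.mem_filter, decide_eq_true_eq] at hp1
      have hd := hp1.2.1.two_pow_le_deg hp1.1 (v := p.1.src) (Or.inl rfl)
      have hd' := hp1.2.1.two_pow_le_deg hp1.1 (v := p.1.tgt) (Or.inr rfl)
      set k := edgeScale I p.1 with hk
      have hk' : k ≤ 2 * a := hd.2 ▸ hsc _
      have hka : a ≤ k := hd.2 ▸ le_scale hd.1
      -- First-fit numbers are at most a sum of two degrees, each less than 2 · 2^k. As only κ > 0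
      -- is assumed here, `palSize` might be too small, hence the range 4κ · 2^k in `levelKeys`.
      have hb : p.2 < 4 * κ * 2 ^ k := by
        have h1 := (greedy_le hp).trans (Nat.add_le_add (hsub I _ _) (hsub I _ _))
        have h2 := deg_lt_two_pow_scale (I := I) p.1.src
        have h3 := deg_lt_two_pow_scale (I := I) p.1.tgt
        rw [hd.2, pow_succ] at h2
        rw [hd'.2, pow_succ] at h3
        have h4 : 4 * 1 * 2 ^ k ≤ 4 * κ * 2 ^ k :=
          Nat.mul_le_mul_right _ (Nat.mul_le_mul_left _ hκ)
        omega
      obtain ⟨y, hy, hy1, hy2⟩ := mem_levelKeys hq hka hk' (palIdx_lt hκ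
        (phaseIdx seeds (l / 2 ^ a) (l % 2 ^ a)) hk') hb
      simp only [levelPalette, Finset.mem_union, Finset.mem_image]
      refine Or.inl (Or.inl (Or.inr ⟨y, hy, ?_⟩))
      rw [hy2, hy1]
    · have hm := MixedItem.isMixed hx
      have hint := workState_interval level S seeds (l / 2 ^ a * 2 ^ a + l % 2 ^ a)
      rw [Nat.div_add_mod'] at hint
      have key := fun z (hz : z < palSize κ _) => mem_levelKeys hq (le_scale hm.2.1) (hsc x.high) (palIdx_lt hκ
        (phaseIdx seeds (l / 2 ^ a) (l % 2 ^ a)) (hsc x.high)) (x := z)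
          (hz.trans_le (hidx (scale (phaseInterval S a (l / 2 ^ a) (l % 2 ^ a)) x.high)).2)
      simp only [levelPalette, Finset.mem_union, Finset.mem_image]
      obtain ⟨-, -, ⟨-, -, -, rfl⟩ | ⟨-, -, -, rfl⟩⟩ := State.propose_eq_some hpx
      · obtain ⟨y, hy, hy1, hy2⟩ := key _ (Nat.mod_lt _ (hidx _).1)
        refine Or.inr ⟨y, hy, ?_⟩
        rw [hy2, hy1]
        simp only [Nat.div_add_mod', hint]
        rfl
      · obtain ⟨y, hy, hy1, hy2⟩ := key _ (Nat.mod_lt _ (hidx _).1)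
        refine Or.inl (Or.inr ⟨y, hy, ?_⟩)
        rw [hy2, hy1]
        simp only [Nat.div_add_mod', hint]
        rfl

end Palette

/-! ### Memory of a level. -/

section Memory

variable {n κ a : ℕ} (level : ℕ) (S : List (Edge n)) (seeds : ℕ → Seed n κ a)

open scoped Classical in
/-- Number of memory words for the entries of a state whose number varies. -/
noncomputable def State.entries (st : State n κ a) : ℕ :=
  (Finset.univ.filter (fun j => st.hits j ≠ 0)).card + st.used.card +
    (Finset.univ.filter (fun x : Fin n × Fin (κ * 2 ^ a) => st.ctr x.1 x.2 ≠ none)).card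

/-- An interval adds at most one recorded index, and at most 2n/√D triples and 2n/√D counters, one
per vertex of degree at least √D. Multiplied by √D this is n + 2n + 2n; for the recorded index it
uses that nothing is recorded when n < √D. -/
theorem entries_next_le (l : ℕ) :
    2 ^ a * (resultAt level S seeds l).next.entries ≤
      2 ^ a * (phaseState level S seeds l).entries + 5 * n := by
  classical
  set I := interval S l with hI
  set H := Finset.univ.filter fun v => 2 ^ a ≤ deg I v with hH
  have hcard : H.card * 2 ^ a ≤ 2 * n := (card_high_mul_le a I).trans
    (Nat.mul_le_mul_left _ (interval_length_le S l))
  have h1 : (Finset.univ.filter (fun j => (resultAt level S seeds l).next.hits j ≠ 0)).card ≤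
      (Finset.univ.filter (fun j => (phaseState level S seeds l).hits j ≠ 0)).card +
        if 2 ^ a ≤ n then 1 else 0 := by
    have hh : ∀ j, (resultAt level S seeds l).next.hits j =
        if j = (seeds l).1 ∧ 2 ^ a ≤ n then (phaseState level S seeds l).hits j + 1
        else (phaseState level S seeds l).hits j := fun j => rfl
    simp only [hh]
    split_ifs with hn
    · refine le_trans (Finset.card_le_card ?_) (Finset.card_insert_le (seeds l).1 _)
      intro j hj
      simp only [Finset.mem_filter, Finset.mem_univ, true_and, Finset.mem_insert] at hj ⊢
      by_cases hjs : j = (seeds l).1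
      · exact Or.inl hjs
      · right
        rwa [if_neg (fun h => hjs h.1)] at hj
    · simp [hn]
  have h2 : (resultAt level S seeds l).next.used.card ≤
      (phaseState level S seeds l).used.card + H.card := by
    have : (resultAt level S seeds l).next.used.card ≤ (phaseState level S seeds l).used.card +
        (H.image fun v => (scale I v, v, palIdx (seeds l).1 (scale I v))).card := by
      refine le_trans (Finset.card_le_card fun x hx => ?_) (Finset.card_union_le _ _)
      simp only [resultAt, processInterval, Finset.mem_union, Finset.mem_image, Finset.mem_filter,
        Finset.mem_univ, true_and, hH] at hx ⊢
      exact hx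
    exact this.trans (Nat.add_le_add_left Finset.card_image_le _)
  have h3 : (Finset.univ.filter (fun x : Fin n × Fin (κ * 2 ^ a) =>
        (resultAt level S seeds l).next.ctr x.1 x.2 ≠ none)).card ≤
      (Finset.univ.filter (fun x : Fin n × Fin (κ * 2 ^ a) =>
        (phaseState level S seeds l).ctr x.1 x.2 ≠ none)).card + H.card := by
    refine le_trans (Finset.card_le_card (t := _ ∪ H.image fun v => (v, (seeds l).1)) ?_)
      ((Finset.card_union_le _ _).trans (Nat.add_le_add_left Finset.card_image_le _))
    rintro ⟨u, j⟩ hj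
    simp only [Finset.mem_filter, Finset.mem_univ, true_and, Finset.mem_union, Finset.mem_image,
      Prod.mk.injEq] at hj ⊢
    by_cases hc : (phaseState level S seeds l).ctr u j = none
    · right
      have hw : (workState level S seeds l).ctr u j ≠ none := by
        intro hw
        rw [resultAt_next_ctr, hw] at hj
        simp at hj
      rw [workState_ctr] at hw
      split_ifs at hw with h
      · exact ⟨u, Finset.mem_filter.mpr ⟨Finset.mem_univ _, h.2.1.le⟩, rfl, h.1.symm⟩
      · exact absurd hc hw
    · exact Or.inl hc
  have h4 : 2 ^ a * (if 2 ^ a ≤ n then 1 else 0) ≤ n := by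
    split_ifs with h
    · simpa using h
    · simp
  unfold State.entries
  generalize hx : (if 2 ^ a ≤ n then 1 else 0) = x at *
  have h5 := Nat.mul_le_mul_left (2 ^ a) (Nat.add_le_add (Nat.add_le_add h1 h2) h3)
  nlinarith

theorem entries_phaseState_le {q r : ℕ} (hr : r < 2 ^ a) :
    2 ^ a * (phaseState level S seeds (q * 2 ^ a + r)).entries ≤ 5 * n * r := by
  induction r with
  | zero => simp [phaseState_zero, State.init, State.entries]
  | succ r ih =>
    rw [phaseState_succ _ _ _ hr]
    refine (entries_next_le level S seeds _).trans ?_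
    have := ih (by omega)
    linarith

/-- A phase has √D intervals, each adding at most 5n/√D entries. -/
theorem entries_next_le' (l : ℕ) : (resultAt level S seeds l).next.entries ≤ 5 * n := by
  have hr : l % 2 ^ a < 2 ^ a := Nat.mod_lt _ (by positivity)
  have h1 := entries_next_le level S seeds l
  have h2 := entries_phaseState_le level S seeds (q := l / 2 ^ a) hr
  rw [Nat.div_add_mod'] at h2
  have h3 : 2 ^ a * (resultAt level S seeds l).next.entries ≤ 2 ^ a * (5 * n) := by
    calc _ ≤ 5 * n * (l % 2 ^ a) + 5 * n := h1.trans (Nat.add_le_add_right h2 _)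
      _ = 5 * n * (l % 2 ^ a + 1) := by ring
      _ ≤ 5 * n * 2 ^ a := Nat.mul_le_mul_left _ hr
      _ = _ := by ring
  exact Nat.le_of_mul_le_mul_left h3 (by positivity)

/-- 2n for the interval and its colors, n for degrees, n + 1 for offsets and the interval number, 5n
for the entries: 9n + 1 ≤ 10n. The value 0 on empty input ties total memory to depth. -/
theorem levelMemory_le : levelMemory level S seeds ≤ if S = [] then 0 else 10 * n := by
  split_ifs with hS
  · simp [levelMemory, hS]
  · have hn : 0 < n := by
      rcases Nat.eq_zero_or_pos n with rfl | hn
      · exact absurd (eq_nil_of_vertices S) hS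
      · exact hn
    unfold levelMemory
    split_ifs with h
    · omega
    · refine Finset.sup_le fun l _ => ?_
      have h1 := entries_next_le' level S seeds l
      have h2 := interval_length_le S l
      have h3 : (resultAt level S seeds l).next.words =
          1 + n + (resultAt level S seeds l).next.entries := by
        simp only [State.words, State.entries]
        ring
      omega

end Memory

/-! ### Indicators with natural number values, for counting outcomes. -/

section Indicator

open scoped Classical in
/-- Numerical indicator of a proposition. -/
noncomputable def ind (P : Prop) : ℕ := if P then 1 else 0

theorem ind_pos {P : Prop} (h : P) : ind P = 1 := if_pos h

theorem ind_neg {P : Prop} (h : ¬ P) : ind P = 0 := if_neg h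

theorem ind_eq_ite (P : Prop) [Decidable P] : ind P = if P then 1 else 0 := by
  split_ifs with h
  exacts [ind_pos h, ind_neg h]

theorem ind_mono {P Q : Prop} (h : P → Q) : ind P ≤ ind Q := by
  by_cases hp : P
  · rw [ind_pos hp, ind_pos (h hp)]
  · rw [ind_neg hp]
    exact Nat.zero_le _

theorem ind_or_le (P Q : Prop) : ind (P ∨ Q) ≤ ind P + ind Q := by
  by_cases hp : P <;> by_cases hq : Q <;> simp [ind, hp, hq]

theorem ind_exists_mem_le {α : Type*} (L : List α) (P : α → Prop) :
    ind (∃ y ∈ L, P y) ≤ (L.map fun y => ind (P y)).sum := by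
  induction L with
  | nil => simp [ind]
  | cons y L ih =>
    simp only [List.mem_cons, exists_eq_or_imp, List.map_cons, List.sum_cons]
    exact (ind_or_le _ _).trans (Nat.add_le_add_left ih _)

/-- Markov's inequality for a single outcome. -/
theorem mul_ind_le {P : Prop} {m b : ℕ} (h : P → m ≤ b) : m * ind P ≤ b := by
  by_cases hp : P
  · rw [ind_pos hp, mul_one]
    exact h hp
  · rw [ind_neg hp]
    exact Nat.zero_le _

theorem countP_eq_sum_ind {α : Type*} (L : List α) (p : α → Prop) [DecidablePred p] :
    L.countP (fun x => p x) = (L.map fun x => ind (p x)).sum := by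
  induction L with
  | nil => simp
  | cons x L ih =>
    rw [List.countP_cons, List.map_cons, List.sum_cons, ih, add_comm]
    congr 1
    by_cases h : p x <;> simp [h, ind]

end Indicator

/-! ### Sums over rotated residues. -/

section Rotation

/-- K consecutive shifts are pairwise distinct modulo K, so no residue is visited twice. -/
theorem sum_rotate_le (f : ℕ → ℕ) (c K : ℕ) :
    ∑ t ∈ Finset.range K, f ((c + t) % K) ≤ ∑ z ∈ Finset.range K, f z := by
  have hinj : Set.InjOn (fun t => (c + t) % K) (Finset.range K) := by
    intro s hs t ht h
    exact add_mod_inj (Finset.mem_range.mp hs) (Finset.mem_range.mp ht) h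
  rw [← Finset.sum_image (f := f) hinj]
  refine Finset.sum_le_sum_of_subset fun z hz => ?_
  obtain ⟨t, ht, rfl⟩ := Finset.mem_image.mp hz
  have := Finset.mem_range.mp ht
  exact Finset.mem_range.mpr (Nat.mod_lt _ (by omega))

theorem sum_ind_eq_le_one (K y : ℕ) : ∑ z ∈ Finset.range K, ind (z = y) ≤ 1 := by
  simp only [ind_eq_ite, Finset.sum_ite_eq']
  split_ifs <;> simp

theorem sum_ind_gap_le (K d : ℕ) :
    ∑ z ∈ Finset.range K, ind (z < 2 * d ∨ K - 2 * d < z) ≤ 4 * d := by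
  simp only [ind_eq_ite, ← Finset.card_filter]
  have : (Finset.range K).filter (fun z => z < 2 * d ∨ K - 2 * d < z) ⊆
      Finset.range (2 * d) ∪ Finset.Ico (K - 2 * d) K := by
    intro z hz
    simp only [Finset.mem_filter, Finset.mem_range, Finset.mem_union, Finset.mem_Ico] at hz ⊢
    omega
  refine (Finset.card_le_card this).trans ((Finset.card_union_le _ _).trans ?_)
  rw [Finset.card_range, Nat.card_Ico]
  omega

end Rotation

/-! ### Averages over seeds, bounded by cyclic shifts of one seed. -/

section Average

variable {n κ a : ℕ} [NeZero κ] {N : ℕ}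

/-- Extension of finitely many seeds by zero. -/
def extendSeeds (x : Fin N → Seed n κ a) (l : ℕ) : Seed n κ a := if h : l < N then x ⟨l, h⟩ else 0

/-- Sum of a quantity over all choices of the first `N` seeds. -/
noncomputable def total (N : ℕ) (F : (ℕ → Seed n κ a) → ℕ) : ℕ :=
  ∑ x : Fin N → Seed n κ a, F (extendSeeds x)

/-- Number of choices of the first `N` seeds. -/
def numSeeds (n κ a N : ℕ) : ℕ := Fintype.card (Fin N → Seed n κ a)

variable (F G : (ℕ → Seed n κ a) → ℕ)

theorem total_add : total N (fun s => F s + G s) = total N F + total N G :=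
  Finset.sum_add_distrib

theorem total_mul_left (c : ℕ) : total N (fun s => c * F s) = c * total N F :=
  (Finset.mul_sum _ _ _).symm

variable {F G} in
theorem total_mono (h : ∀ s, F s ≤ G s) : total N F ≤ total N G :=
  Finset.sum_le_sum fun _ _ => h _

theorem total_finset_sum {α : Type*} (A : Finset α) (F : α → (ℕ → Seed n κ a) → ℕ) :
    total N (fun s => ∑ x ∈ A, F x s) = ∑ x ∈ A, total N (F x) :=
  Finset.sum_comm

theorem total_list_sum {α : Type*} (L : List α) (F : α → (ℕ → Seed n κ a) → ℕ) :
    total N (fun s => (L.map fun x => F x s).sum) = (L.map fun x => total N (F x)).sum := by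
  induction L with
  | nil => simp [total]
  | cons x L ih => simp only [List.map_cons, List.sum_cons, total_add, ih]

/-- Addition of `g` to the seed with number `l`. -/
def addAt (s : ℕ → Seed n κ a) (l : ℕ) (g : Seed n κ a) : ℕ → Seed n κ a :=
  fun m => if m = l then s m + g else s m

theorem extendSeeds_add_single (x : Fin N → Seed n κ a) {l : ℕ} (hl : l < N) (g : Seed n κ a) :
    extendSeeds (x + Pi.single ⟨l, hl⟩ g) = addAt (extendSeeds x) l g := by
  funext m
  by_cases hm : m < N
  · by_cases h : m = l
    · subst h
      simp [extendSeeds, addAt, hm]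
    · have : (⟨m, hm⟩ : Fin N) ≠ ⟨l, hl⟩ := by simpa using h
      simp [extendSeeds, addAt, hm, h, this]
  · have h : m ≠ l := by omega
    simp [extendSeeds, addAt, hm, h]

variable {F} in
/-- If a quantity sums up to at most `B` over `m` shifts of one seed, its average is at most
`B / m`. -/
theorem mul_total_le {l : ℕ} (hl : l < N) {m B : ℕ} (g : ℕ → Seed n κ a)
    (h : ∀ s, ∑ t ∈ Finset.range m, F (addAt s l (g t)) ≤ B) :
    m * total N F ≤ B * numSeeds n κ a N := by
  -- Shifting one seed is a translation of the finite group of seed vectors, hence permutes the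
  -- summands.
  have h1 : ∀ t, total N F = ∑ x : Fin N → Seed n κ a, F (addAt (extendSeeds x) l (g t)) := by
    intro t
    rw [total, ← Equiv.sum_comp (Equiv.addRight (Pi.single ⟨l, hl⟩ (g t)))]
    refine Finset.sum_congr rfl fun x _ => ?_
    rw [Equiv.coe_addRight, extendSeeds_add_single]
  calc m * total N F
      = ∑ t ∈ Finset.range m, total N F := by simp
    _ = ∑ t ∈ Finset.range m, ∑ x : Fin N → Seed n κ a,
          F (addAt (extendSeeds x) l (g t)) := Finset.sum_congr rfl fun t _ => h1 t
    _ = ∑ x : Fin N → Seed n κ a, ∑ t ∈ Finset.range m,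
          F (addAt (extendSeeds x) l (g t)) := Finset.sum_comm
    _ ≤ ∑ x : Fin N → Seed n κ a, B := Finset.sum_le_sum fun x _ => h _
    _ = B * numSeeds n κ a N := by simp [numSeeds, mul_comm]

/-- Shift of the index of one interval. -/
def idxShift (n κ a : ℕ) [NeZero κ] (t : ℕ) : Seed n κ a := (Fin.ofNat _ t, 0)

/-- Shift of the offset of one vertex. -/
def offShift (κ a : ℕ) [NeZero κ] (v : Fin n) (t : ℕ) : Seed n κ a :=
  (0, Pi.single v (Fin.ofNat _ t))

/-- For a ≤ k ≤ 2a the number of palettes divides the range of σ, so addition with wrap-around in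
that range becomes a rotation of the palette index. -/
theorem palIdx_add_shift {k : ℕ} (hk : a ≤ k) (hk' : k ≤ 2 * a) (s : ℕ → Seed n κ a) (l t : ℕ) :
    palIdx ((addAt s l (idxShift n κ a t)) l).1 k = ((s l).1 + t) % numPal κ a k := by
  have hdvd : numPal κ a k ∣ κ * 2 ^ a := by
    rw [numPal_eq hk']
    exact Nat.mul_dvd_mul_left _ (pow_dvd_pow _ (by omega))
  simp only [palIdx, addAt, if_true, idxShift, Prod.fst_add, Fin.val_add,
    Fin.ofNat_eq_cast, Fin.val_natCast, Nat.add_mod_mod, Nat.mod_mod_of_dvd _ hdvd]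

/-- Rotating the index of interval l through all palettes, with interval l' fixed, produces at most
one coincidence. -/
theorem palIdx_collision {k : ℕ} (hk : a ≤ k) (hk' : k ≤ 2 * a) {l l' : ℕ} (hl : l < N)
    (hne : l' ≠ l) :
    numPal κ a k * total N (fun s : ℕ → Seed n κ a => ind (palIdx (s l').1 k = palIdx (s l).1 k)) ≤
      numSeeds n κ a N := by
  rw [← one_mul (numSeeds n κ a N)]
  refine mul_total_le hl (idxShift n κ a) fun s => ?_
  refine le_trans (Finset.sum_le_sum fun t _ => ?_) ((sum_rotate_le
    (fun z => ind (z = palIdx (s l').1 k)) (s l).1 _).trans (sum_ind_eq_le_one _ _))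
  refine ind_mono fun h => ?_
  rw [palIdx_add_shift hk hk'] at h
  rw [← h]
  simp [addAt, hne]

/-- Union bound. -/
theorem mul_total_or_le {c A B : ℕ} {P Q R : (ℕ → Seed n κ a) → Prop}
    (h : ∀ s, P s → Q s ∨ R s) (hQ : c * total N (fun s => ind (Q s)) ≤ A)
    (hR : c * total N (fun s => ind (R s)) ≤ B) : c * total N (fun s => ind (P s)) ≤ A + B := by
  refine (Nat.mul_le_mul_left c (total_mono fun s =>
    (ind_mono (h s)).trans (ind_or_le _ _))).trans ?_
  rw [total_add, mul_add]
  exact Nat.add_le_add hQ hR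

variable {F} in
/-- A quantity that is bounded by the weight of the earlier intervals of the phase with the same
palette index is small on average. -/
theorem mul_total_le_of_weight {k : ℕ} (hk : a ≤ k) (hk' : k ≤ 2 * a) {q r : ℕ}
    (hl : q * 2 ^ a + r < N) (w : ℕ → ℕ) (hw : ∑ s ∈ Finset.range r, w s ≤ 4 ^ a)
    (hF : ∀ seeds : ℕ → Seed n κ a, 2 ^ k * F seeds ≤
      ∑ s ∈ Finset.range r, w s *
        ind (palIdx (phaseIdx seeds q s) k = palIdx (phaseIdx seeds q r) k)) :
    κ * total N F ≤ numSeeds n κ a N := by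
  -- The identity κD = N · 2^k splits the extra factor D between the collision probability 1/N and
  -- the Markov threshold 2^k; the total weight at most D then cancels it.
  refine Nat.le_of_mul_le_mul_left (c := 4 ^ a) ?_ (by positivity)
  calc 4 ^ a * (κ * total N F) = numPal κ a k * 2 ^ k * total N F := by
        rw [numPal_mul hk']
        ring
    _ = numPal κ a k * total N (fun s => 2 ^ k * F s) := by rw [total_mul_left]; ring
    _ ≤ numPal κ a k * total N (fun seeds => ∑ s ∈ Finset.range r, w s *
          ind (palIdx (phaseIdx seeds q s) k = palIdx (phaseIdx seeds q r) k)) :=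
        Nat.mul_le_mul_left _ (total_mono hF)
    _ = ∑ s ∈ Finset.range r, w s * (numPal κ a k * total N (fun seeds : ℕ → Seed n κ a =>
          ind (palIdx (phaseIdx seeds q s) k = palIdx (phaseIdx seeds q r) k))) := by
        rw [total_finset_sum, Finset.mul_sum]
        refine Finset.sum_congr rfl fun s _ => ?_
        rw [total_mul_left]
        ring
    _ ≤ ∑ s ∈ Finset.range r, w s * numSeeds n κ a N := by
        refine Finset.sum_le_sum fun s hs => Nat.mul_le_mul_left _ ?_
        have := Finset.mem_range.mp hs
        exact palIdx_collision hk hk' hl (by omega)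
    _ ≤ 4 ^ a * numSeeds n κ a N := by
        rw [← Finset.sum_mul]
        exact Nat.mul_le_mul_right _ hw

theorem off_add_shift {k : ℕ} (hk' : k ≤ 2 * a) (s : ℕ → Seed n κ a) (l t : ℕ) (v : Fin n) :
    ((((addAt s l (offShift κ a v t)) l).2 v : ℕ)) % palSize κ k =
      ((s l).2 v + t) % palSize κ k := by
  have hdvd : palSize κ k ∣ 2 * κ * 4 ^ a := by
    rw [palSize]
    refine Nat.mul_dvd_mul_left _ ?_
    rw [show (4 : ℕ) = 2 ^ 2 by norm_num, ← pow_mul]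
    exact pow_dvd_pow _ hk'
  simp only [addAt, if_true, offShift, Prod.snd_add, Pi.add_apply, Pi.single_eq_same, Fin.val_add,
    Fin.ofNat_eq_cast, Fin.val_natCast, Nat.add_mod_mod, Nat.mod_mod_of_dvd _ hdvd]

theorem off_add_shift_of_ne (s : ℕ → Seed n κ a) (l t : ℕ) {u v : Fin n} (h : u ≠ v) :
    ((addAt s l (offShift κ a v t)) l).2 u = (s l).2 u := by
  simp [addAt, offShift, h]

theorem fst_add_offShift (s : ℕ → Seed n κ a) (l t m : ℕ) (v : Fin n) :
    ((addAt s l (offShift κ a v t)) m).1 = (s m).1 := by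
  by_cases h : m = l
  · subst h
    simp [addAt, offShift]
  · simp [addAt, h]

/-- Rotating the offset of v alone lets the gap run through all K = 2κd residues, of which at most
4d are bad. -/
theorem gap_total_le {k : ℕ} (hk' : k ≤ 2 * a) {l : ℕ} (hl : l < N) {u v : Fin n} (huv : u ≠ v) :
    κ * total N (fun s : ℕ → Seed n κ a =>
      ind (((s l).2 v % palSize κ k + palSize κ k - (s l).2 u % palSize κ k) % palSize κ k <
          2 * 2 ^ k ∨
        palSize κ k - 2 * 2 ^ k <
          ((s l).2 v % palSize κ k + palSize κ k - (s l).2 u % palSize κ k) % palSize κ k)) ≤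
      2 * numSeeds n κ a N := by
  have hK : 0 < palSize κ k := by
    rw [palSize]
    have := NeZero.pos κ
    positivity
  have h := mul_total_le (F := fun s : ℕ → Seed n κ a =>
      ind (((s l).2 v % palSize κ k + palSize κ k - (s l).2 u % palSize κ k) % palSize κ k <
          2 * 2 ^ k ∨
        palSize κ k - 2 * 2 ^ k <
          ((s l).2 v % palSize κ k + palSize κ k - (s l).2 u % palSize κ k) % palSize κ k))
    hl (m := palSize κ k) (B := 4 * 2 ^ k) (offShift κ a v) fun s => by
      refine le_trans (Finset.sum_le_sum fun t _ => ?_) ((sum_rotate_le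
        (fun z => ind (z < 2 * 2 ^ k ∨ palSize κ k - 2 * 2 ^ k < z))
        ((s l).2 v + (palSize κ k - (s l).2 u % palSize κ k)) _).trans (sum_ind_gap_le _ _))
      simp only [off_add_shift hk', off_add_shift_of_ne _ _ _ huv]
      refine ind_mono fun h => ?_
      have hu : ((s l).2 u : ℕ) % palSize κ k < palSize κ k := Nat.mod_lt _ hK
      have e : (((s l).2 v + t) % palSize κ k + palSize κ k - (s l).2 u % palSize κ k) %
          palSize κ k = (((s l).2 v : ℕ) + (palSize κ k - (s l).2 u % palSize κ k) + t) %
            palSize κ k := by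
        rw [Nat.add_sub_assoc hu.le, Nat.mod_add_mod]
        congr 1
        ring
      rwa [e] at h
  refine Nat.le_of_mul_le_mul_left (c := 2 * 2 ^ k) ?_ (by positivity)
  rw [palSize] at h ⊢
  calc _ = _ := ?_
    _ ≤ _ := h
    _ = _ := by ring
  ring

/-- A and B are assumed to depend on the indices only, so rotating the offset of u moves the left
side through all residues while the right side stands still. -/
theorem color_total_le {k : ℕ} (hk' : k ≤ 2 * a) {l : ℕ} (hl : l < N) {u v : Fin n} (huv : u ≠ v)
    (A B : (ℕ → Seed n κ a) → ℕ)
    (hA : ∀ s s' : ℕ → Seed n κ a, (∀ m, (s m).1 = (s' m).1) → A s = A s')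
    (hB : ∀ s s' : ℕ → Seed n κ a, (∀ m, (s m).1 = (s' m).1) → B s = B s') :
    palSize κ k * total N (fun s : ℕ → Seed n κ a =>
      ind (((s l).2 u % palSize κ k + A s) % palSize κ k =
        ((s l).2 v % palSize κ k + B s) % palSize κ k)) ≤ numSeeds n κ a N := by
  rw [← one_mul (numSeeds n κ a N)]
  refine mul_total_le hl (offShift κ a u) fun s => ?_
  refine le_trans (Finset.sum_le_sum fun t _ => ?_) ((sum_rotate_le
    (fun z => ind (z = ((s l).2 v % palSize κ k + B s) % palSize κ k))
    ((s l).2 u + A s) _).trans (sum_ind_eq_le_one _ _))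
  simp only [off_add_shift hk', off_add_shift_of_ne _ _ _ huv.symm,
    hA _ s (fun m => fst_add_offShift s l t m u), hB _ s (fun m => fst_add_offShift s l t m u)]
  refine ind_mono fun h => ?_
  rw [← h, Nat.mod_add_mod]
  congr 1
  ring

end Average

/-! ### Probability that an edge is left over. -/

section Leftover

variable {n κ a : ℕ} (level : ℕ) (S : List (Edge n))

/-- Repetitions and counters are functions of the drawn indices, not of the offsets. This is what
allows offsets to be rotated with `advance` fixed. -/
theorem stateAt_congr_fst {s s' : ℕ → Seed n κ a} (h : ∀ m, (s m).1 = (s' m).1) (l : ℕ) :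
    (stateAt level S s l).hits = (stateAt level S s' l).hits ∧
      (stateAt level S s l).ctr = (stateAt level S s' l).ctr := by
  induction l with
  | zero => exact ⟨rfl, rfl⟩
  | succ l ih =>
    have hP : (phaseState level S s l).hits = (phaseState level S s' l).hits ∧
        (phaseState level S s l).ctr = (phaseState level S s' l).ctr := by
      simp only [phaseState, State.openPhase, stateAt_interval]
      split_ifs
      exacts [⟨rfl, rfl⟩, ih]
    constructor
    · funext j
      change (if j = (s l).1 ∧ 2 ^ a ≤ n then (phaseState level S s l).hits j + 1
          else (phaseState level S s l).hits j) =
        (if j = (s' l).1 ∧ 2 ^ a ≤ n then (phaseState level S s' l).hits j + 1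
          else (phaseState level S s' l).hits j)
      rw [hP.1, h l]
    · funext u j
      change (resultAt level S s l).next.ctr u j = (resultAt level S s' l).next.ctr u j
      simp only [resultAt_next_ctr, workState_ctr, hP.2, h l]

theorem workState_congr_fst {s s' : ℕ → Seed n κ a} (h : ∀ m, (s m).1 = (s' m).1) (l : ℕ) :
    (workState level S s l).hits = (workState level S s' l).hits ∧
      (workState level S s l).ctr = (workState level S s' l).ctr := by
  have hP : (phaseState level S s l).hits = (phaseState level S s' l).hits ∧
      (phaseState level S s l).ctr = (phaseState level S s' l).ctr := by
    simp only [phaseState, State.openPhase, stateAt_interval]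
    split_ifs
    exacts [⟨rfl, rfl⟩, stateAt_congr_fst level S h l]
  refine ⟨hP.1, ?_⟩
  funext u j
  simp only [workState_ctr, hP.2, h l]

theorem advance_congr_fst {s s' : ℕ → Seed n κ a} (h : ∀ m, (s m).1 = (s' m).1) (q r k : ℕ)
    (x : MixedItem n) :
    (workState level S s (q * 2 ^ a + r)).advance (phaseIdx s q r) k x =
      (workState level S s' (q * 2 ^ a + r)).advance (phaseIdx s' q r) k x := by
  have hw := workState_congr_fst level S h (q * 2 ^ a + r)
  have hi : phaseIdx s q r = phaseIdx s' q r := h _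
  simp only [State.advance, State.count, State.repeats, hw.1, hw.2, hi]

variable {S} (hS : S.Nodup) (hdeg : ∀ v, deg S v ≤ 4 ^ a)

include hS in
/-- Two colliding mixed edges have different low-degree end points. -/
theorem collide_spec (hκ : 0 < κ) {seeds : ℕ → Seed n κ a} {q r : ℕ} (hr : r < 2 ^ a)
    {x y : MixedItem n}
    (hx : x ∈ mixedItems a (phaseInterval S a q r)) (hy : y ∈ mixedItems a (phaseInterval S a q r))
    (h : (workState level S seeds (q * 2 ^ a + r)).Collide level (phaseInterval S a q r)
      (phaseIdx seeds q r) x y) :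
    y.high = x.high ∧ x.low ≠ y.low ∧
      ((seeds (q * 2 ^ a)).2 x.low % palSize κ (scale (phaseInterval S a q r) x.high) +
        (workState level S seeds (q * 2 ^ a + r)).advance (phaseIdx seeds q r)
          (scale (phaseInterval S a q r) x.high) x) %
          palSize κ (scale (phaseInterval S a q r) x.high) =
      ((seeds (q * 2 ^ a)).2 y.low % palSize κ (scale (phaseInterval S a q r) x.high) +
        (workState level S seeds (q * 2 ^ a + r)).advance (phaseIdx seeds q r)
          (scale (phaseInterval S a q r) x.high) y) %
          palSize κ (scale (phaseInterval S a q r) x.high) := by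
  obtain ⟨hne, hinc, c, hpx, hpy⟩ := h
  have hmx := MixedItem.isMixed hx
  have hmy := MixedItem.isMixed hy
  have hax := advance_lt level S seeds hS hx hpx
  have hay := advance_lt level S seeds hS hy hpy
  obtain ⟨-, -, hX⟩ := State.propose_eq_some hpx
  obtain ⟨-, -, hY⟩ := State.propose_eq_some hpy
  have hk : scale (phaseInterval S a q r) y.high = scale (phaseInterval S a q r) x.high := by
    obtain ⟨-, -, -, h⟩ | ⟨-, -, -, h⟩ := hX <;> obtain ⟨-, -, -, h'⟩ | ⟨-, -, -, h'⟩ := hY <;>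
      simp_all
  rw [hk] at hay hY
  -- The low end of y has scale below k, whereas x.high has scale k.
  have hhigh : y.high = x.high := by
    obtain h | h := hmy.eq_or_eq hinc
    · have := hmy.2.2
      rw [hk, h] at this
      exact absurd this (lt_irrefl _)
    · exact h.symm
  set k := scale (phaseInterval S a q r) x.high with hkdef
  have hcol : ((workState level S seeds (q * 2 ^ a + r)).off k x.low +
          (workState level S seeds (q * 2 ^ a + r)).advance (phaseIdx seeds q r) k x) %
            palSize κ k =
      ((workState level S seeds (q * 2 ^ a + r)).off k y.low +
          (workState level S seeds (q * 2 ^ a + r)).advance (phaseIdx seeds q r) k y) %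
            palSize κ k := by
    obtain ⟨-, -, -, h⟩ | ⟨-, -, -, h⟩ := hX <;> obtain ⟨-, -, -, h'⟩ | ⟨-, -, -, h'⟩ := hY <;>
      rw [h] at h' <;> simp only [Color.C.injEq, Color.B.injEq, reduceCtorEq] at h' <;>
      exact h'.2.2.2.2
  rw [workState_off _ _ _ hr, workState_off _ _ _ hr] at hcol
  refine ⟨hhigh, fun hlow => hne ?_, hcol⟩
  rw [hlow] at hcol
  have hKle := two_mul_pow_le_palSize hκ k
  have hadv := add_mod_inj (hax.trans_le hKle) (hay.trans_le hKle) hcol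
  refine (congrArg _ (MixedItem.eq_of_rank hx hy hlow ?_)).symm
  obtain ⟨-, -, h, hc⟩ | ⟨-, -, h, hc⟩ := hX <;>
    obtain ⟨-, -, h', hc'⟩ | ⟨-, -, h', hc'⟩ := hY
  · rw [h, h', hlow] at hadv
    omega
  · exact absurd (hc.symm.trans hc') (by simp)
  · exact absurd (hc.symm.trans hc') (by simp)
  · rw [h, h'] at hadv
    omega

/-- The possible reasons for a mixed edge to propose no color. -/
theorem State.propose_eq_none {st : State n κ a} {level : ℕ} {I : List (Edge n)}
    {σ : Fin (κ * 2 ^ a)} {x : MixedItem n} (h : st.propose level I σ x = none) :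
    (st.gap (scale I x.high) x < 2 * 2 ^ scale I x.high ∨
      palSize κ (scale I x.high) - 2 * 2 ^ scale I x.high < st.gap (scale I x.high) x) ∨
    2 * 2 ^ scale I x.high ≤ st.count σ (scale I x.high) x.low + x.rank ∨
    2 * 2 ^ scale I x.high ≤ st.repeats σ (scale I x.high) * 2 ^ a := by
  by_contra hcon
  push Not at hcon
  obtain ⟨h1, h2, h3⟩ := hcon
  unfold State.propose at h
  simp only at h
  have h1' : ¬ (st.gap (scale I x.high) x < 2 * 2 ^ scale I x.high ∨
      palSize κ (scale I x.high) - 2 * 2 ^ scale I x.high < st.gap (scale I x.high) x) := by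
    push Not
    exact h1
  unfold State.gap at h1'
  rw [if_neg h1'] at h
  cases hc : st.ctr x.low σ with
  | some m => simp [hc, not_le.mpr h2] at h
  | none => simp [hc, not_le.mpr h3] at h

variable (S) in
theorem sum_deg_interval (N : ℕ) (v : Fin n) :
    ∑ l ∈ Finset.range N, deg (interval S l) v = deg (S.take (N * n)) v := by
  induction N with
  | zero => simp [deg]
  | succ N ih =>
    rw [Finset.sum_range_succ, ih, Nat.succ_mul, List.take_add, deg_append]
    rfl

include hdeg in
-- The intervals are disjoint pieces of one stream, so the degrees of a vertex in them add up to at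
-- most D: the weight budget of a phase.
theorem sum_deg_phase_le (q r : ℕ) (v : Fin n) :
    ∑ s ∈ Finset.range r, deg (phaseInterval S a q s) v ≤ 4 ^ a := by
  have h := sum_deg_interval S (q * 2 ^ a + r) v
  rw [Finset.sum_range_add] at h
  have h2 := deg_le_of_subperm (List.take_sublist ((q * 2 ^ a + r) * n) S).subperm v
  have h3 := hdeg v
  simp only [phaseInterval]
  omega

variable [NeZero κ] {N : ℕ}

include hdeg in
-- Give each earlier interval in which v was high for 2^k the weight 2^k. Each weight is at most the
-- degree of v there, so together they are at most D.
theorem used_total_le {q r : ℕ} (hr : r < 2 ^ a) (hl : q * 2 ^ a + r < N) (v : Fin n) :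
    κ * total N (fun seeds : ℕ → Seed n κ a => ind (2 ^ a ≤ deg (phaseInterval S a q r) v ∧
      (scale (phaseInterval S a q r) v, v,
        palIdx (phaseIdx seeds q r) (scale (phaseInterval S a q r) v)) ∈
        (workState level S seeds (q * 2 ^ a + r)).used)) ≤ numSeeds n κ a N := by
  by_cases hv : 2 ^ a ≤ deg (phaseInterval S a q r) v
  swap
  · simp [hv, ind, total]
  set k := scale (phaseInterval S a q r) v with hk
  have hk' : k ≤ 2 * a := scale_le ((deg_interval_le S _ v).trans (hdeg v))
  refine mul_total_le_of_weight (le_scale hv) hk' hl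
    (fun s => 2 ^ k * ind (2 ^ a ≤ deg (phaseInterval S a q s) v ∧
      scale (phaseInterval S a q s) v = k)) ?_ ?_
  · refine le_trans (Finset.sum_le_sum fun s _ => ?_) (sum_deg_phase_le hdeg q r v)
    refine mul_ind_le fun h => ?_
    rw [← h.2]
    exact two_pow_scale_le h.1
  · intro seeds
    refine mul_ind_le ?_
    rintro ⟨-, h⟩
    obtain ⟨s, hs, h1, h2, h3⟩ := (mem_workState_used level S seeds hr _ _ _).mp h
    refine le_trans ?_ (Finset.single_le_sum (fun _ _ => Nat.zero_le _)
      (Finset.mem_range.mpr hs))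
    rw [ind_pos ⟨h1, h2⟩, ind_pos h3, hk]
    simp

include hdeg in
theorem blocked_total_le {q r : ℕ} (hr : r < 2 ^ a) (hl : q * 2 ^ a + r < N) (e : Edge n) :
    κ * total N (fun seeds : ℕ → Seed n κ a =>
      ind ((workState level S seeds (q * 2 ^ a + r)).Blocked (phaseInterval S a q r)
        (phaseIdx seeds q r) e)) ≤ 2 * numSeeds n κ a N := by
  refine (mul_total_or_le ?_ (used_total_le level hdeg hr hl e.src)
    (used_total_le level hdeg hr hl e.tgt)).trans_eq (two_mul _).symm
  rintro seeds ⟨v, rfl | rfl, h1, -, h2⟩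
  exacts [Or.inl ⟨h1, h2⟩, Or.inr ⟨h1, h2⟩]

section Mixed

variable {q r : ℕ} (hr : r < 2 ^ a) (hl : q * 2 ^ a + r < N) {x : MixedItem n}
  (hx : x ∈ mixedItems a (phaseInterval S a q r))

include hS hdeg hr hl hx

/-- The rank is below deg u < 2^k, so a full counter means that at least 2^k mixed edges at u came
from earlier intervals with the same palette index. The weight of an interval is the number of mixed
edges at u. -/
theorem count_total_le :
    κ * total N (fun seeds : ℕ → Seed n κ a => ind (2 * 2 ^ scale (phaseInterval S a q r) x.high ≤
      (workState level S seeds (q * 2 ^ a + r)).count (phaseIdx seeds q r)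
        (scale (phaseInterval S a q r) x.high) x.low + x.rank)) ≤ numSeeds n κ a N := by
  have hm := MixedItem.isMixed hx
  refine mul_total_le_of_weight (le_scale hm.2.1)
    (scale_le ((deg_interval_le S _ x.high).trans (hdeg x.high))) hl
    (fun s => (mixedAt a (phaseInterval S a q s) x.low).length) ?_ ?_
  · exact le_trans (Finset.sum_le_sum fun s _ =>
      mixedAt_length_le (hS.sublist (interval_sublist S _)) _) (sum_deg_phase_le hdeg q r x.low)
  · intro seeds
    refine mul_ind_le fun h => ?_
    have h1 := workState_count_le level S seeds (q := q) hr (phaseIdx seeds q r)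
      (scale (phaseInterval S a q r) x.high) x.low
    have h2 : x.rank < 2 ^ scale (phaseInterval S a q r) x.high :=
      (MixedItem.rank_lt hx).trans_le ((mixedAt_length_le (hS.sublist (interval_sublist S _))
        _).trans hm.adj_low_lt.le)
    simp only [ind_eq_ite, mul_ite, mul_one, mul_zero]
    omega

omit hS in
-- Each earlier interval has weight √D; there are fewer than √D of them in the phase.
theorem repeats_total_le :
    κ * total N (fun seeds : ℕ → Seed n κ a => ind (2 * 2 ^ scale (phaseInterval S a q r) x.high ≤
      (workState level S seeds (q * 2 ^ a + r)).repeats (phaseIdx seeds q r)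
        (scale (phaseInterval S a q r) x.high) * 2 ^ a)) ≤ numSeeds n κ a N := by
  have hm := MixedItem.isMixed hx
  refine mul_total_le_of_weight (le_scale hm.2.1)
    (scale_le ((deg_interval_le S _ x.high).trans (hdeg x.high))) hl (fun _ => 2 ^ a) ?_ ?_
  · rw [Finset.sum_const, Finset.card_range, smul_eq_mul, show (4 : ℕ) = 2 * 2 by norm_num,
      mul_pow]
    exact Nat.mul_le_mul_right _ hr.le
  · intro seeds
    refine mul_ind_le fun h => ?_
    have h1 := workState_repeats level S seeds (q := q) hr (phaseIdx seeds q r)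
      (scale (phaseInterval S a q r) x.high)
    rw [if_pos (pow_le_vertices (interval_length_le S _) hx)] at h1
    rw [h1, mul_comm _ (2 ^ a), Finset.mul_sum] at h
    simp only [ind_eq_ite]
    omega

/-- Fewer than 2d edges compete at the high end point, and each proposes the same color with
probability at most 1/K = 1/(2κd). The offset is rotated in the first seed of the phase, where all
offsets are drawn. -/
theorem collide_total_le :
    κ * total N (fun seeds : ℕ → Seed n κ a =>
      ind (∃ y ∈ mixedItems a (phaseInterval S a q r),
        (workState level S seeds (q * 2 ^ a + r)).Collide level (phaseInterval S a q r)
          (phaseIdx seeds q r) x y)) ≤ numSeeds n κ a N := by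
  have hκ := NeZero.pos κ
  have hm := MixedItem.isMixed hx
  set k := scale (phaseInterval S a q r) x.high with hk
  have hk' : k ≤ 2 * a := scale_le ((deg_interval_le S _ x.high).trans (hdeg x.high))
  have hone : ∀ y ∈ mixedItems a (phaseInterval S a q r),
      palSize κ k * total N (fun seeds : ℕ → Seed n κ a =>
        ind ((workState level S seeds (q * 2 ^ a + r)).Collide level (phaseInterval S a q r)
          (phaseIdx seeds q r) x y)) ≤ ind (y.high = x.high) * numSeeds n κ a N := by
    intro y hy
    by_cases hyx : y.high = x.high ∧ x.low ≠ y.low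
    · rw [ind_pos hyx.1, one_mul]
      refine (Nat.mul_le_mul_left _ (total_mono fun seeds => ind_mono fun h =>
        (collide_spec level hS hκ hr hx hy h).2.2)).trans ?_
      exact color_total_le hk' (by omega : q * 2 ^ a < N) hyx.2
        (fun seeds => (workState level S seeds (q * 2 ^ a + r)).advance (phaseIdx seeds q r) k x)
        (fun seeds => (workState level S seeds (q * 2 ^ a + r)).advance (phaseIdx seeds q r) k y)
        (fun s s' h => advance_congr_fst level S h q r k x)
        (fun s s' h => advance_congr_fst level S h q r k y)
    · have : total N (fun seeds : ℕ → Seed n κ a =>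
          ind ((workState level S seeds (q * 2 ^ a + r)).Collide level (phaseInterval S a q r)
          (phaseIdx seeds q r) x y)) = 0 := by
        refine Finset.sum_eq_zero fun s _ => ind_neg fun h => hyx ?_
        have := collide_spec level hS hκ hr hx hy h
        exact ⟨this.1, this.2.1⟩
      rw [this, mul_zero]
      exact Nat.zero_le _
  have hcount : ((mixedItems a (phaseInterval S a q r)).map fun y => ind (y.high = x.high)).sum ≤
      2 * 2 ^ k := by
    rw [← countP_eq_sum_ind]
    refine (countP_high_le (hS.sublist (interval_sublist S _)) x.high).trans ?_
    have := deg_lt_two_pow_scale (I := phaseInterval S a q r) x.high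
    rw [pow_succ] at this
    exact le_trans this.le (by rw [hk, mul_comm])
  refine Nat.le_of_mul_le_mul_left (c := 2 * 2 ^ k) ?_ (by positivity)
  calc 2 * 2 ^ k * (κ * total N (fun seeds : ℕ → Seed n κ a =>
      ind (∃ y ∈ mixedItems a (phaseInterval S a q r),
        (workState level S seeds (q * 2 ^ a + r)).Collide level (phaseInterval S a q r)
          (phaseIdx seeds q r) x y)))
      ≤ 2 * 2 ^ k * (κ * total N (fun seeds : ℕ → Seed n κ a =>
      ((mixedItems a (phaseInterval S a q r)).map fun y => ind (
        (workState level S seeds (q * 2 ^ a + r)).Collide level (phaseInterval S a q r)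
          (phaseIdx seeds q r) x y)).sum)) := by
        gcongr
        exact total_mono fun seeds => ind_exists_mem_le _ _
    _ = ((mixedItems a (phaseInterval S a q r)).map fun y => palSize κ k *
          total N (fun seeds : ℕ → Seed n κ a => ind (
        (workState level S seeds (q * 2 ^ a + r)).Collide level (phaseInterval S a q r)
          (phaseIdx seeds q r) x y))).sum := by
        rw [total_list_sum, List.sum_map_mul_left, palSize]
        ring
    _ ≤ ((mixedItems a (phaseInterval S a q r)).map fun y =>
          ind (y.high = x.high) * numSeeds n κ a N).sum := List.sum_le_sum hone
    _ ≤ _ := by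
        rw [List.sum_map_mul_right]
        exact Nat.mul_le_mul_right _ hcount

/-- 5 = 2 + 1 + 1 + 1: gap, full counter, repetitions, collision. -/
theorem mixed_total_le :
    κ * total N (fun seeds : ℕ → Seed n κ a =>
      ind ((workState level S seeds (q * 2 ^ a + r)).propose level (phaseInterval S a q r)
          (phaseIdx seeds q r) x = none ∨
        ∃ y ∈ mixedItems a (phaseInterval S a q r),
        (workState level S seeds (q * 2 ^ a + r)).Collide level (phaseInterval S a q r)
          (phaseIdx seeds q r) x y)) ≤ 5 * numSeeds n κ a N := by
  have h1 := gap_total_le (κ := κ) (k := scale (phaseInterval S a q r) x.high)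
    (scale_le ((deg_interval_le S _ x.high).trans (hdeg x.high)))
    (by omega : q * 2 ^ a < N) (MixedItem.isMixed hx).ne
  have h2 := count_total_le (κ := κ) level hS hdeg hr hl hx
  have h3 := repeats_total_le (κ := κ) level hdeg hr hl hx
  have h4 := collide_total_le (κ := κ) level hS hdeg hr hl hx
  have h5 := mul_total_or_le (P := fun seeds : ℕ → Seed n κ a =>
    (workState level S seeds (q * 2 ^ a + r)).propose level (phaseInterval S a q r)
      (phaseIdx seeds q r) x = none) (fun seeds h => by
        have h' := State.propose_eq_none h
        unfold State.gap at h'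
        rw [workState_off _ _ _ hr, workState_off _ _ _ hr] at h'
        exact h') h1 (mul_total_or_le (fun _ h => h) h2 h3)
  exact (mul_total_or_le (fun _ h => h) h5 h4).trans (by linarith)

end Mixed

include hS hdeg in
-- 7 = 2 + 5: every edge may be blocked at either end, and there are no more mixed items than edges.
theorem interval_total_le {q r : ℕ} (hr : r < 2 ^ a) (hl : q * 2 ^ a + r < N) :
    κ * total N (fun seeds : ℕ → Seed n κ a =>
      (resultAt level S seeds (q * 2 ^ a + r)).leftover.length) ≤
      7 * (interval S (q * 2 ^ a + r)).length * numSeeds n κ a N := by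
  classical
  have hnd := hS.sublist (interval_sublist S (q * 2 ^ a + r))
  have h0 : ∀ seeds : ℕ → Seed n κ a,
      (resultAt level S seeds (q * 2 ^ a + r)).leftover.length ≤
      ((phaseInterval S a q r).map fun e => ind
        ((workState level S seeds (q * 2 ^ a + r)).Blocked (phaseInterval S a q r)
          (phaseIdx seeds q r) e)).sum +
      ((mixedItems a (phaseInterval S a q r)).map fun x => ind
        ((workState level S seeds (q * 2 ^ a + r)).propose level (phaseInterval S a q r)
          (phaseIdx seeds q r) x = none ∨
        ∃ y ∈ mixedItems a (phaseInterval S a q r),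
        (workState level S seeds (q * 2 ^ a + r)).Collide level (phaseInterval S a q r)
          (phaseIdx seeds q r) x y)).sum := by
    intro seeds
    have h1 : (resultAt level S seeds (q * 2 ^ a + r)).leftover =
      (phaseInterval S a q r).filter (fun e => (workState level S seeds (q * 2 ^ a + r)).Blocked
        (phaseInterval S a q r) (phaseIdx seeds q r) e) ++
      ((workState level S seeds (q * 2 ^ a + r)).mixedPass level (phaseInterval S a q r)
        (phaseIdx seeds q r) (mixedItems a (phaseInterval S a q r))).2 := by
      rfl
    rw [h1, List.length_append, ← List.countP_eq_length_filter, countP_eq_sum_ind]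
    refine Nat.add_le_add_left (le_trans (State.mixedPass_leftover_le _ _ _ _
      (mixedItems_nodup hnd)) (le_of_eq ?_)) _
    exact countP_eq_sum_ind _ _
  refine (Nat.mul_le_mul_left κ (total_mono h0)).trans ?_
  rw [total_add, total_list_sum, total_list_sum, mul_add, ← List.sum_map_mul_left,
    ← List.sum_map_mul_left]
  have hlen : (mixedItems a (phaseInterval S a q r)).length ≤ (phaseInterval S a q r).length := by
    rw [← List.length_map (f := MixedItem.edge)]
    refine (List.subperm_of_subset (mixedItems_nodup hnd) fun e he => ?_).length_le
    obtain ⟨x, hx, rfl⟩ := List.mem_map.mp he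
    exact MixedItem.edge_mem hx
  have e1 := List.sum_le_card_nsmul ((phaseInterval S a q r).map fun e =>
    κ * total N (fun seeds : ℕ → Seed n κ a => ind
        ((workState level S seeds (q * 2 ^ a + r)).Blocked (phaseInterval S a q r)
          (phaseIdx seeds q r) e))) (2 * numSeeds n κ a N) (by
      intro z hz
      obtain ⟨e, he, rfl⟩ := List.mem_map.mp hz
      exact blocked_total_le level hdeg hr hl e)
  have e2 := List.sum_le_card_nsmul ((mixedItems a (phaseInterval S a q r)).map fun x =>
    κ * total N (fun seeds : ℕ → Seed n κ a => ind
        ((workState level S seeds (q * 2 ^ a + r)).propose level (phaseInterval S a q r)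
          (phaseIdx seeds q r) x = none ∨
        ∃ y ∈ mixedItems a (phaseInterval S a q r),
        (workState level S seeds (q * 2 ^ a + r)).Collide level (phaseInterval S a q r)
          (phaseIdx seeds q r) x y))) (5 * numSeeds n κ a N) (by
      intro z hz
      obtain ⟨x, hx, rfl⟩ := List.mem_map.mp hz
      exact mixed_total_le level hS hdeg hr hl hx)
  rw [List.length_map, smul_eq_mul] at e1 e2
  have e3 := Nat.mul_le_mul_right (5 * numSeeds n κ a N) hlen
  refine (Nat.add_le_add e1 (e2.trans e3)).trans (le_of_eq ?_)
  simp only [phaseInterval]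
  ring

include hS hdeg in
/-- On average, a level leaves over at most a fraction of `7 / κ` of its input. -/
theorem level_total_le :
    κ * total (numIntervals S) (fun seeds : ℕ → Seed n κ a =>
      (levelLeftover level S seeds).length) ≤
      7 * S.length * numSeeds n κ a (numIntervals S) := by
  unfold levelLeftover
  split_ifs with h
  · simp [total]
  · simp only [List.length_flatMap]
    rw [total_list_sum, ← List.sum_map_mul_left]
    have hsum : ((List.range (numIntervals S)).map fun l => (interval S l).length).sum =
        S.length := by
      rw [← List.length_flatMap, flatMap_interval_eq]
    conv_rhs => rw [← hsum, ← List.sum_map_mul_left, ← List.sum_map_mul_right]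
    refine List.sum_le_sum fun l hl => ?_
    have hl := List.mem_range.mp hl
    rw [← Nat.div_add_mod' l (2 ^ a)] at hl
    have := interval_total_le (κ := κ) level hS hdeg (Nat.mod_lt l (by positivity)) hl
    rwa [Nat.div_add_mod'] at this

end Leftover

/-! ### Each virtual stream depends on finitely many seeds. -/

section Locality

variable {n κ a : ℕ} (level : ℕ) (S : List (Edge n))

theorem stateAt_congr {s s' : ℕ → Seed n κ a} {l : ℕ} (h : ∀ m < l, s m = s' m) :
    stateAt level S s l = stateAt level S s' l := by
  induction l with
  | zero => rfl
  | succ l ih =>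
    simp only [stateAt]
    rw [ih fun m hm => h m (by omega), h l l.lt_succ_self]

theorem levelLeftover_congr {s s' : ℕ → Seed n κ a} (h : ∀ m < numIntervals S, s m = s' m) :
    levelLeftover level S s = levelLeftover level S s' := by
  unfold levelLeftover
  split_ifs
  · rfl
  · refine List.flatMap_congr fun l hl => ?_
    have hl := List.mem_range.mp hl
    simp only [resultAt]
    rw [stateAt_congr level S fun m hm => h m (hm.trans hl), h l hl]

variable {S} in
theorem numIntervals_mono {T : List (Edge n)} (h : T.length ≤ S.length) :
    numIntervals T ≤ numIntervals S :=
  Nat.div_le_div_right (by omega)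

variable {E : List (Edge n)} (hE : E.Nodup)

include hE in
-- No virtual stream is longer than E, so the number of intervals of E bounds the seeds needed at
-- every level.
theorem virtualStream_congr {ω ω' : Outcome n κ a} {j : ℕ}
    (h : ∀ i < j, ∀ l < numIntervals E, ω (i, l) = ω' (i, l)) :
    virtualStream E ω j = virtualStream E ω' j := by
  induction j with
  | zero => rfl
  | succ j ih =>
    simp only [virtualStream]
    rw [ih fun i hi => h i (by omega)]
    refine levelLeftover_congr j _ fun l hl => h j j.lt_succ_self l (hl.trans_le ?_)
    exact numIntervals_mono (virtualStream_subperm ω' hE j).length_le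

end Locality

/-! ### From counting seeds to conditional expectations. -/

section Measure

variable {n κ a : ℕ} [NeZero κ]

open ProbabilityTheory

instance : IsProbabilityMeasure (law n κ a) := by
  unfold law
  infer_instance

theorem card_seed_pos : 0 < Fintype.card (Seed n κ a) := Fintype.card_pos

omit [NeZero κ] in
theorem numSeeds_eq (N : ℕ) : numSeeds n κ a N = Fintype.card (Seed n κ a) ^ N := by
  simp [numSeeds]

/-- The first `N` seeds of a level are uniformly distributed. -/
theorem lintegral_level (j N : ℕ) (F : (ℕ → Seed n κ a) → ℕ)
    (hF : ∀ s s' : ℕ → Seed n κ a, (∀ l < N, s l = s' l) → F s = F s') :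
    ∫⁻ ω, (F fun l => ω (j, l) : ℝ≥0∞) ∂law n κ a = total N F / numSeeds n κ a N := by
  have hinj : Function.Injective fun l : Fin N => (j, (l : ℕ)) := by
    intro l l' h
    simpa [Fin.ext_iff] using h
  have hmap : (law n κ a).map (fun ω (l : Fin N) => ω (j, (l : ℕ))) =
      Measure.pi fun _ : Fin N => (PMF.uniformOfFintype (Seed n κ a)).toMeasure := by
    rw [law, Measure.map_infinitePi_infinitePi_of_inj hinj, Measure.infinitePi_eq_pi]
  have hres : ∀ ω : Outcome n κ a, F (fun l => ω (j, l)) =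
      F (extendSeeds fun l : Fin N => ω (j, (l : ℕ))) := by
    intro ω
    refine hF _ _ fun l hl => ?_
    simp [extendSeeds, hl]
  simp only [hres]
  rw [← lintegral_map (f := fun x : Fin N → Seed n κ a => (F (extendSeeds x) : ℝ≥0∞))
    (μ := law n κ a) (g := fun ω (l : Fin N) => ω (j, (l : ℕ))) .of_discrete (by fun_prop), hmap,
    lintegral_fintype]
  have hpt : ∀ x : Fin N → Seed n κ a,
      (Measure.pi fun _ : Fin N => (PMF.uniformOfFintype (Seed n κ a)).toMeasure) {x} =
        (numSeeds n κ a N : ℝ≥0∞)⁻¹ := by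
    intro x
    rw [Measure.pi_singleton, numSeeds_eq]
    simp only [PMF.toMeasure_apply_singleton _ _ (measurableSet_singleton _),
      PMF.uniformOfFintype_apply, Finset.prod_const, Finset.card_univ, Fintype.card_fin]
    rw [Nat.cast_pow, ENNReal.inv_pow]
  simp only [hpt]
  rw [← Finset.sum_mul, total, Nat.cast_sum, div_eq_mul_inv]

variable {E : List (Edge n)} (hE : E.Nodup)

/-- The coordinates that determine the input of level `j`. -/
def coordsBelow (E : List (Edge n)) (j : ℕ) : Finset (ℕ × ℕ) :=
  Finset.range j ×ˢ Finset.range (numIntervals E)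

/-- Extension of finitely many coordinates to an outcome. -/
def extendOutcome (U : Finset (ℕ × ℕ)) (x : U → Seed n κ a) : Outcome n κ a :=
  fun p => if h : p ∈ U then x ⟨p, h⟩ else 0

include hE in
theorem virtualStream_eq_restrict (ω : Outcome n κ a) (j : ℕ) :
    virtualStream E ω j =
      virtualStream E (extendOutcome (coordsBelow E j) fun p => ω p) j := by
  refine virtualStream_congr hE fun i hi l hl => ?_
  have : (i, l) ∈ coordsBelow E j := by simp [coordsBelow, hi, hl]
  simp [extendOutcome, this]

include hE in
-- The event is the preimage of a subset of a finite discrete space under a coordinate projection.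
theorem measurableSet_virtualStream (j : ℕ) (P : List (Edge n) → Prop) :
    MeasurableSet {ω : Outcome n κ a | P (virtualStream E ω j)} := by
  have : {ω : Outcome n κ a | P (virtualStream E ω j)} =
      (fun ω (p : coordsBelow E j) => ω p) ⁻¹'
        {x | P (virtualStream E (extendOutcome (coordsBelow E j) x) j)} := by
    ext ω
    simp only [Set.mem_ofPred_eq, Set.mem_preimage]
    rw [virtualStream_eq_restrict hE]
  rw [this]
  exact (by fun_prop : Measurable fun (ω : Outcome n κ a) (p : coordsBelow E j) => ω p)
    .of_discrete

include hE in
-- The input of level j is determined by coordinates of the levels below j and F by coordinates of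
-- level j; disjoint sets of coordinates are independent.
theorem lintegral_restrict_level (j N : ℕ) (S : List (Edge n)) (F : (ℕ → Seed n κ a) → ℕ)
    (hF : ∀ s s' : ℕ → Seed n κ a, (∀ l < N, s l = s' l) → F s = F s') :
    ∫⁻ ω in {ω | virtualStream E ω j = S}, (F fun l => ω (j, l) : ℝ≥0∞) ∂law n κ a =
      law n κ a {ω | virtualStream E ω j = S} *
        ∫⁻ ω, (F fun l => ω (j, l) : ℝ≥0∞) ∂law n κ a := by
  have hA : MeasurableSet {ω : Outcome n κ a | virtualStream E ω j = S} :=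
    measurableSet_virtualStream hE j (· = S)
  set V : Finset (ℕ × ℕ) := {j} ×ˢ Finset.range N with hV
  have hdisj : Disjoint (coordsBelow E j) V := by
    rw [Finset.disjoint_left]
    rintro ⟨i, l⟩ h1 h2
    simp only [coordsBelow, hV, Finset.mem_product, Finset.mem_range, Finset.mem_singleton] at h1 h2
    omega
  have hind : iIndepFun (fun (p : ℕ × ℕ) (ω : Outcome n κ a) => ω p) (law n κ a) :=
    iIndepFun_infinitePi (X := fun _ x => x) fun _ => measurable_id
  have h2 := hind.indepFun_finset _ V hdisj fun p => measurable_pi_apply p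
  classical
  have h3 := h2.comp (φ := fun x => if virtualStream E (extendOutcome (coordsBelow E j) x) j = S
      then (1 : ℝ≥0∞) else 0)
    (ψ := fun x => (F fun l => extendOutcome V x (j, l) : ℝ≥0∞)) .of_discrete .of_discrete
  have e1 : (fun x => if virtualStream E (extendOutcome (coordsBelow E j) x) j = S
      then (1 : ℝ≥0∞) else 0) ∘ (fun (ω : Outcome n κ a) (p : coordsBelow E j) => ω p) =
      {ω | virtualStream E ω j = S}.indicator 1 := by
    funext ω
    simp only [Function.comp, ← virtualStream_eq_restrict hE, Set.indicator_apply, Set.mem_ofPred_eq,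
      Pi.one_apply]
  have e2 : (fun x => (F fun l => extendOutcome V x (j, l) : ℝ≥0∞)) ∘
      (fun (ω : Outcome n κ a) (p : V) => ω p) = fun ω => (F fun l => ω (j, l) : ℝ≥0∞) := by
    funext ω
    simp only [Function.comp]
    congr 1
    refine hF _ _ fun l hl => ?_
    have : (j, l) ∈ V := by simp [hV, hl]
    simp [extendOutcome, this]
  have m1 : Measurable ((fun x => if virtualStream E (extendOutcome (coordsBelow E j) x) j = S
      then (1 : ℝ≥0∞) else 0) ∘ (fun (ω : Outcome n κ a) (p : coordsBelow E j) => ω p)) :=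
    Measurable.comp .of_discrete (by fun_prop)
  have m2 : Measurable ((fun x => (F fun l => extendOutcome V x (j, l) : ℝ≥0∞)) ∘
      (fun (ω : Outcome n κ a) (p : V) => ω p)) :=
    Measurable.comp .of_discrete (by fun_prop)
  rw [e1] at h3 m1
  rw [e2] at h3 m2
  have h4 := lintegral_mul_eq_lintegral_mul_lintegral_of_indepFun m1 m2 h3
  rw [lintegral_indicator_one hA] at h4
  rw [← h4, ← lintegral_indicator hA]
  refine lintegral_congr fun ω => ?_
  simp only [Set.indicator_apply, Pi.mul_apply, Pi.one_apply]
  split_ifs <;> simp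

/-- Conditional on its input, a level leaves over at most a fraction of `7 / κ` on average. -/
theorem lintegral_leftover_le {Δ : ℕ} (hE : IsStream E Δ) (hΔ : Δ ≤ 4 ^ a) (j : ℕ)
    (S : List (Edge n)) :
    ∫⁻ ω in {ω | virtualStream E ω j = S}, (virtualStream E ω (j + 1)).length ∂law n κ a ≤
      7 * (S.length : ℝ≥0∞) / κ * law n κ a {ω | virtualStream E ω j = S} := by
  have hA : MeasurableSet {ω : Outcome n κ a | virtualStream E ω j = S} :=
    measurableSet_virtualStream hE.nodup j (· = S)
  -- If S never occurs, both sides vanish. Otherwise S inherits distinct edges and the degree bound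
  -- from E through an outcome that produces it.
  by_cases hne : ∃ ω : Outcome n κ a, virtualStream E ω j = S
  swap
  · have : {ω : Outcome n κ a | virtualStream E ω j = S} = ∅ := by
      ext ω
      simpa using fun h => hne ⟨ω, h⟩
    rw [this]
    simp
  obtain ⟨ω₀, rfl⟩ := hne
  set S := virtualStream E ω₀ j with hS
  have hnd : S.Nodup := virtualStream_nodup ω₀ hE.nodup j
  have hdeg : ∀ v, deg S v ≤ 4 ^ a := fun v =>
    ((deg_le_of_subperm (virtualStream_subperm ω₀ hE.nodup j) v).trans (hE.deg_le v)).trans hΔ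
  have h1 : ∫⁻ ω in {ω | virtualStream E ω j = S}, (virtualStream E ω (j + 1)).length ∂law n κ a =
      ∫⁻ ω in {ω | virtualStream E ω j = S},
        ((levelLeftover j S fun l => ω (j, l)).length : ℝ≥0∞) ∂law n κ a := by
    refine setLIntegral_congr_fun hA fun ω hω => ?_
    simp only [virtualStream]
    rw [hω]
  have hF : ∀ s s' : ℕ → Seed n κ a, (∀ l < numIntervals S, s l = s' l) →
      (levelLeftover j S s).length = (levelLeftover j S s').length := fun s s' h => by
    rw [levelLeftover_congr j S h]
  rw [h1, lintegral_restrict_level hE.nodup j (numIntervals S) S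
    (fun s => (levelLeftover j S s).length) hF,
    lintegral_level j (numIntervals S) (fun s => (levelLeftover j S s).length) hF, mul_comm]
  refine mul_le_mul' ?_ le_rfl
  have h2 := level_total_le (κ := κ) j hnd hdeg
  have hκ : (κ : ℝ≥0∞) ≠ 0 := by exact_mod_cast NeZero.ne κ
  have hcard : (numSeeds n κ a (numIntervals S) : ℝ≥0∞) ≠ 0 := by
    rw [numSeeds_eq]
    exact_mod_cast (pow_pos card_seed_pos _).ne'
  rw [ENNReal.div_le_iff hcard (ENNReal.natCast_ne_top _), ← ENNReal.mul_div_right_comm,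
    ENNReal.le_div_iff_mul_le (Or.inl hκ) (Or.inl (ENNReal.natCast_ne_top _)), mul_comm]
  exact_mod_cast h2

end Measure

/-- Makes the set of possible streams countable, so that expectations can be split according to the
input of a level. -/
instance {n : ℕ} : Countable (Edge n) := by
  refine Function.Injective.countable (f := fun e : Edge n => (e.src, e.tgt, e.copy)) ?_
  rintro ⟨_, _, _⟩ ⟨_, _, _⟩ h
  simp only [Prod.mk.injEq] at h
  simp [h]

/-! ### Geometric decay of the stream lengths and expected depth. -/

section Depth

variable {n κ a : ℕ} [NeZero κ] {E : List (Edge n)} {Δ : ℕ}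

/-- Expected length of the input of a level. -/
noncomputable def meanLength (κ a : ℕ) [NeZero κ] (E : List (Edge n)) (j : ℕ) : ℝ≥0∞ :=
  ∫⁻ ω, ((virtualStream E ω j).length : ℝ≥0∞) ∂law n κ a

theorem measurable_length_virtualStream (hE : E.Nodup) (j : ℕ) :
    Measurable fun ω : Outcome n κ a => ((virtualStream E ω j).length : ℝ≥0∞) := by
  refine (measurable_of_countable (fun m : ℕ => (m : ℝ≥0∞))).comp
    (measurable_to_countable' fun m => ?_)
  exact measurableSet_virtualStream hE j (·.length = m)

/-- Law of total expectation over the countably many possible inputs of level j. -/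
theorem meanLength_succ_le (hE : IsStream E Δ) (hΔ : Δ ≤ 4 ^ a) (j : ℕ) :
    meanLength κ a E (j + 1) ≤ 7 / κ * meanLength κ a E j := by
  have hmeas (S : List (Edge n)) : MeasurableSet {ω : Outcome n κ a | virtualStream E ω j = S} :=
    measurableSet_virtualStream hE.nodup j (· = S)
  have hdisj : Pairwise (Function.onFun Disjoint
      fun S : List (Edge n) => {ω : Outcome n κ a | virtualStream E ω j = S}) := by
    intro S S' h
    refine Set.disjoint_left.mpr fun ω h1 h2 => h ?_
    exact h1.symm.trans h2
  have hunion : ⋃ S : List (Edge n), {ω : Outcome n κ a | virtualStream E ω j = S} = Set.univ := by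
    ext ω
    simp
  have split (f : Outcome n κ a → ℝ≥0∞) : ∫⁻ ω, f ω ∂law n κ a =
      ∑' S : List (Edge n), ∫⁻ ω in {ω | virtualStream E ω j = S}, f ω ∂law n κ a := by
    rw [← lintegral_iUnion hmeas hdisj, hunion, Measure.restrict_univ]
  rw [meanLength, meanLength, split, split (fun ω => ((virtualStream E ω j).length : ℝ≥0∞)),
    ← ENNReal.tsum_mul_left]
  refine ENNReal.tsum_le_tsum fun S => (lintegral_leftover_le hE hΔ j S).trans_eq ?_
  have : ∫⁻ ω in {ω | virtualStream E ω j = S}, ((virtualStream E ω j).length : ℝ≥0∞) ∂law n κ a =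
      ∫⁻ ω in {ω | virtualStream E ω j = S}, (S.length : ℝ≥0∞) ∂law n κ a :=
    setLIntegral_congr_fun (hmeas S) fun ω hω => by
      have hω : virtualStream E ω j = S := hω
      simp only [hω]
  rw [this, setLIntegral_const, ENNReal.mul_div_right_comm, mul_assoc]

theorem meanLength_le (hκ : 32 ≤ κ) (hE : IsStream E Δ) (hΔ : Δ ≤ 4 ^ a) (j : ℕ) :
    meanLength κ a E j ≤ n * 4 ^ a * (1 / 4) ^ j := by
  induction j with
  | zero =>
    have h : E.length ≤ n * 4 ^ a := length_le_of_deg_le fun v => (hE.deg_le v).trans hΔ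
    simp only [meanLength, virtualStream, lintegral_const, measure_univ, mul_one, pow_zero]
    exact_mod_cast h
  | succ j ih =>
    -- Here κ has to be at least 28.
    have h : (7 : ℝ≥0∞) / κ ≤ 1 / 4 := by
      have h0 : (κ : ℝ≥0∞) ≠ 0 := by exact_mod_cast NeZero.ne κ
      rw [ENNReal.div_le_iff h0 (ENNReal.natCast_ne_top _), ← ENNReal.mul_div_right_comm,
        ENNReal.le_div_iff_mul_le (by simp) (by simp)]
      norm_cast
      omega
    calc meanLength κ a E (j + 1) ≤ 7 / κ * meanLength κ a E j := meanLength_succ_le hE hΔ j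
      _ ≤ 1 / 4 * (n * 4 ^ a * (1 / 4) ^ j) := mul_le_mul' h ih
      _ = n * 4 ^ a * (1 / 4) ^ (j + 1) := by ring

omit [NeZero κ] in
/-- Beyond the top level, the input of a level is empty unless the level above got more than `n`
edges. -/
theorem length_virtualStream_of_succ_ne_nil {ω : Outcome n κ a} {j : ℕ}
    (h : virtualStream E ω (j + 1) ≠ []) : n ≤ (virtualStream E ω j).length := by
  by_contra hlt
  exact h (by rw [virtualStream, levelLeftover, if_pos (by omega)])

/-- Markov's inequality at n. Because short inputs are stored outright, the threshold is n and not
1, and the factor n in the initial length cancels. -/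
theorem law_virtualStream_ne_nil_le (hn : 0 < n) (hκ : 32 ≤ κ) (hE : IsStream E Δ)
    (hΔ : Δ ≤ 4 ^ a) (j : ℕ) :
    law n κ a {ω | virtualStream E ω (j + 1) ≠ []} ≤ 4 ^ a * (1 / 4) ^ j := by
  have h0 : (n : ℝ≥0∞) ≠ 0 := by exact_mod_cast hn.ne'
  have h1 := mul_meas_ge_le_lintegral (μ := law n κ a)
    (measurable_length_virtualStream hE.nodup j) (n : ℝ≥0∞)
  have h2 : (n : ℝ≥0∞) * law n κ a {ω | virtualStream E ω (j + 1) ≠ []} ≤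
      n * (4 ^ a * (1 / 4) ^ j) := by
    calc _ ≤ n * law n κ a {ω | (n : ℝ≥0∞) ≤ (virtualStream E ω j).length} := by
          gcongr
          exact fun h => by exact_mod_cast length_virtualStream_of_succ_ne_nil h
      _ ≤ meanLength κ a E j := h1
      _ ≤ n * 4 ^ a * (1 / 4) ^ j := meanLength_le hκ hE hΔ j
      _ = _ := mul_assoc _ _ _
  exact (ENNReal.mul_le_mul_iff_right h0 (ENNReal.natCast_ne_top _)).mp h2

omit [NeZero κ] in
theorem depth_eq_tsum (ω : Outcome n κ a) :
    (depth E ω : ℝ≥0∞) =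
      ∑' j, {ω : Outcome n κ a | virtualStream E ω j ≠ []}.indicator (fun _ => 1) ω := by
  rw [depth, ← ENNReal.tsum_set_one]
  exact tsum_subtype {j | virtualStream E ω j ≠ []} fun _ => (1 : ℝ≥0∞)

theorem lintegral_depth_eq (hE : E.Nodup) :
    ∫⁻ ω, (depth E ω : ℝ≥0∞) ∂law n κ a =
      ∑' j, law n κ a {ω | virtualStream E ω j ≠ []} := by
  simp only [depth_eq_tsum]
  have hm (j : ℕ) : MeasurableSet {ω : Outcome n κ a | virtualStream E ω j ≠ []} :=
    measurableSet_virtualStream hE j (· ≠ [])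
  rw [lintegral_tsum fun j => (measurable_const.indicator (hm j)).aemeasurable]
  exact tsum_congr fun j => lintegral_indicator_one (hm j)

theorem measurable_depth (hE : E.Nodup) :
    Measurable fun ω : Outcome n κ a => (depth E ω : ℝ≥0∞) := by
  simp only [depth_eq_tsum]
  exact Measurable.tsum fun j =>
    measurable_const.indicator (measurableSet_virtualStream hE j (· ≠ []))

omit [NeZero κ] in
theorem virtualStream_nil (ω : Outcome n κ a) (j : ℕ) : virtualStream [] ω j = [] :=
  virtualStream_eq_nil_of_le ω j.zero_le rfl

/-- After a further levels the factor 4^a is used up, and a geometric series remains. Its ratio 1/4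
is relaxed to 1/2, whose sum is 2. -/
theorem tsum_law_virtualStream_ne_nil_le (hn : 0 < n) (hκ : 32 ≤ κ) (hE : IsStream E Δ)
    (hΔ : Δ ≤ 4 ^ a) :
    ∑' j, law n κ a {ω | virtualStream E ω (j + (a + 1)) ≠ []} ≤ 2 := by
  have h (j : ℕ) : law n κ a {ω | virtualStream E ω (j + (a + 1)) ≠ []} ≤ (2⁻¹ : ℝ≥0∞) ^ j := by
    have h4 : (4 : ℝ≥0∞) ^ a * (1 / 4) ^ a = 1 := by
      rw [← mul_pow, one_div, ENNReal.mul_inv_cancel (by simp) (by simp), one_pow]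
    calc _ ≤ (4 : ℝ≥0∞) ^ a * (1 / 4) ^ (j + a) :=
          law_virtualStream_ne_nil_le hn hκ hE hΔ (j + a)
      _ = (4 ^ a * (1 / 4) ^ a) * (1 / 4) ^ j := by ring
      _ = (4⁻¹ : ℝ≥0∞) ^ j := by rw [h4, one_mul, one_div]
      _ ≤ (2⁻¹ : ℝ≥0∞) ^ j := pow_le_pow_left' (ENNReal.inv_le_inv.mpr (by norm_num)) j
  refine (ENNReal.tsum_le_tsum h).trans_eq ?_
  rw [ENNReal.tsum_geometric, ENNReal.one_sub_inv_two, inv_inv]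

/-- The first a + 1 levels are charged probability 1 each, and all later ones together 2. -/
theorem lintegral_depth_le (hκ : 32 ≤ κ) (hE : IsStream E Δ) (hΔ : Δ ≤ 4 ^ a) :
    ∫⁻ ω, (depth E ω : ℝ≥0∞) ∂law n κ a ≤ a + 3 := by
  rcases Nat.eq_zero_or_pos n with hn | hn
  · have : E = [] := by
      subst hn
      exact eq_nil_of_vertices E
    simp [depth, this, virtualStream_nil]
  have h1 : ∑ j ∈ Finset.range (a + 1), law n κ a {ω | virtualStream E ω j ≠ []} ≤ a + 1 := by
    refine (Finset.sum_le_card_nsmul _ _ 1 fun j _ => prob_le_one).trans_eq ?_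
    simp
  calc ∫⁻ ω, (depth E ω : ℝ≥0∞) ∂law n κ a
      = ∑ j ∈ Finset.range (a + 1), law n κ a {ω | virtualStream E ω j ≠ []} +
          ∑' j, law n κ a {ω | virtualStream E ω (j + (a + 1)) ≠ []} := by
        rw [lintegral_depth_eq hE.nodup]
        exact (ENNReal.summable.sum_add_tsum_nat_add' (f := fun j =>
          law n κ a {ω | virtualStream E ω j ≠ []})).symm
    _ ≤ ((a : ℝ≥0∞) + 1) + 2 := add_le_add h1 (tsum_law_virtualStream_ne_nil_le hn hκ hE hΔ)
    _ = a + 3 := by rw [add_assoc]; norm_num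

theorem ae_depth_ne_top (hκ : 32 ≤ κ) (hE : IsStream E Δ) (hΔ : Δ ≤ 4 ^ a) :
    ∀ᵐ ω ∂law n κ a, depth E ω ≠ ⊤ := by
  have h : ∫⁻ ω, (depth E ω : ℝ≥0∞) ∂law n κ a ≠ ⊤ :=
    ((lintegral_depth_le hκ hE hΔ).trans_lt (by finiteness)).ne
  filter_upwards [ae_lt_top (measurable_depth hE.nodup) h] with ω hω h
  simp [h] at hω

end Depth

/-! ### Colors and memory in terms of the depth. -/

section Expectations

variable {n κ a : ℕ} {E : List (Edge n)} {Δ : ℕ}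

/-- For infinite J the right side is infinite unless M = 0, and then every P j is empty. -/
theorem encard_biUnion_le_mul {α : Type*} (J : Set ℕ) (P : ℕ → Finset α) (M : ℕ)
    (hP : ∀ j, (P j).card ≤ M) : (⋃ j ∈ J, (P j : Set α)).encard ≤ J.encard * M := by
  by_cases hJ : J.Finite
  · lift J to Finset ℕ using hJ
    classical
    have : (⋃ j ∈ (J : Set ℕ), (P j : Set α)) = (J.biUnion P : Finset α) := by simp
    rw [this, Set.encard_coe_eq_coe_finsetCard, Set.encard_coe_eq_coe_finsetCard]
    exact_mod_cast Finset.card_biUnion_le_card_mul _ _ _ fun j _ => hP j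
  · rw [Set.Infinite.encard_eq hJ]
    rcases Nat.eq_zero_or_pos M with rfl | hM
    · have : (⋃ j ∈ J, (P j : Set α)) = ∅ := by
        simp only [Set.iUnion_eq_empty]
        intro j _
        simpa using hP j
      simp [this]
    · rw [ENat.top_mul (by exact_mod_cast hM.ne')]
      exact le_top

/-- Levels with empty input color nothing, and every other level stays within its palette. The bound
holds for every outcome, also at infinite depth. -/
theorem numColors_le (hκ : 0 < κ) (hE : IsStream E Δ) (hΔ : Δ ≤ 4 ^ a) (ω : Outcome n κ a) :
    numColors E ω ≤ depth E ω * (18 * κ ^ 2 * (a + 1) * 8 ^ a : ℕ) := by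
  refine le_trans (Set.encard_le_encard ?_) (encard_biUnion_le_mul _
    (fun j => levelPalette κ a j) _ fun j => card_levelPalette_le hκ j)
  rintro _ ⟨p, ⟨j, hp⟩, rfl⟩
  have hdeg : ∀ v, deg (virtualStream E ω j) v ≤ 4 ^ a := fun v =>
    ((deg_le_of_subperm (virtualStream_subperm ω hE.nodup j) v).trans (hE.deg_le v)).trans hΔ
  simp only [Set.mem_iUnion]
  refine ⟨j, fun h => ?_, mem_levelPalette j _ hκ hdeg hp⟩
  rw [h] at hp
  simp [levelColored, greedy] at hp

theorem totalMemory_le (ω : Outcome n κ a) :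
    totalMemory E ω ≤ 10 * n * (depth E ω : ℝ≥0∞) := by
  rw [depth_eq_tsum, ← ENNReal.tsum_mul_left, totalMemory]
  refine ENNReal.tsum_le_tsum fun j => ?_
  have h := levelMemory_le j (virtualStream E ω j) fun l => ω (j, l)
  by_cases h0 : virtualStream E ω j = []
  · rw [if_pos h0] at h
    simp [Nat.le_zero.mp h]
  · rw [if_neg h0] at h
    rw [Set.indicator_of_mem (by exact h0), mul_one]
    exact_mod_cast h

end Expectations

/-! ### Powers of 4 and 8 in terms of Δ. -/

section Numeric

variable {Δ : ℕ}

theorem log_succ_lower_bound (hΔ : 0 < Δ) : 0.69 ≤ Real.log (Δ + 1) := by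
  have h1 : (1 : ℝ) ≤ Δ := by exact_mod_cast hΔ
  have h2 : Real.log 2 ≤ Real.log (Δ + 1) := Real.log_le_log (by norm_num) (by linarith)
  linarith [Real.log_two_gt_d9]

theorem four_pow_clog_le (hΔ : 0 < Δ) : 4 ^ Nat.clog 4 Δ ≤ 4 * Δ := by
  rcases Nat.lt_or_ge 1 Δ with h | h
  · obtain ⟨b, hb⟩ : ∃ b, Nat.clog 4 Δ = b + 1 :=
      Nat.exists_eq_succ_of_ne_zero (Nat.clog_pos (by norm_num) h).ne'
    have := Nat.pow_pred_clog_lt_self (b := 4) (by norm_num) h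
    rw [hb, Nat.pred_succ] at this
    rw [hb, pow_succ]
    omega
  · rw [Nat.clog_of_right_le_one h]
    omega

/-- By minimality of D, a ≤ 1 + log₄ Δ; the additive constants are absorbed because log(Δ + 1) ≥ log
2 for Δ ≥ 1. -/
theorem clog_add_three_le (hΔ : 0 < Δ) : (Nat.clog 4 Δ : ℝ) + 3 ≤ 10 * Real.log (Δ + 1) := by
  have h1 : (1 : ℝ) ≤ Δ := by exact_mod_cast hΔ
  have h2 : (4 : ℝ) ^ Nat.clog 4 Δ ≤ 4 * Δ := by exact_mod_cast four_pow_clog_le hΔ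
  have h3 := Real.log_le_log (by positivity) h2
  rw [Real.log_pow, Real.log_mul (by norm_num) (by positivity),
    show (4 : ℝ) = 2 ^ 2 by norm_num, Real.log_pow] at h3
  push_cast at h3
  have h4 : Real.log Δ ≤ Real.log (Δ + 1) := Real.log_le_log (by positivity) (by linarith)
  have h5 := log_succ_lower_bound hΔ
  have h6 := Real.log_two_gt_d9
  have h7 := Real.log_two_lt_d9
  have h8 : (0 : ℝ) ≤ Nat.clog 4 Δ := Nat.cast_nonneg _
  nlinarith

/-- The inequality 4^a ≤ 4Δ raised to the power 3/2. -/
theorem eight_pow_clog_le (hΔ : 0 < Δ) : (8 : ℝ) ^ Nat.clog 4 Δ ≤ 8 * (Δ : ℝ) ^ (3 / 2 : ℝ) := by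
  have h2 : (4 : ℝ) ^ Nat.clog 4 Δ ≤ 4 * Δ := by exact_mod_cast four_pow_clog_le hΔ
  have h3 := Real.rpow_le_rpow (by positivity) h2 (show (0 : ℝ) ≤ 3 / 2 by norm_num)
  have h4 : (4 : ℝ) ^ (3 / 2 : ℝ) = 8 := by
    rw [show (4 : ℝ) = 2 ^ (2 : ℝ) by norm_num, ← Real.rpow_mul (by norm_num)]
    norm_num
  rwa [Real.mul_rpow (by norm_num) (by positivity), h4, ← Real.rpow_natCast, ← Real.rpow_mul
    (by norm_num), mul_comm, Real.rpow_mul (by norm_num), h4, Real.rpow_natCast] at h3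

end Numeric

end StreamColoring

open StreamColoring in
theorem mainTheorem2 (κ : ℕ) [NeZero κ] (hκ : 32 ≤ κ) :
    ∃ (C : ℝ) (q : ℕ), ∀ (n Δ : ℕ) (E : List (Edge n)), IsStream E Δ →
      ∀ a : ℕ, a = Nat.clog 4 Δ →
        -- validity, for every outcome of the random choices
        (∀ ω : Outcome n κ a, IsPartialColoring E (output E ω)) ∧
        (∀ ω : Outcome n κ a, depth E ω ≠ ⊤ → IsColoring E (output E ω)) ∧
        (∀ᵐ ω ∂(law n κ a), depth E ω ≠ ⊤) ∧
        -- leftover edges of each recursion level, given its input stream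
        (∀ (j : ℕ) (S : List (Edge n)),
          ∫⁻ ω in {ω | virtualStream E ω j = S}, (virtualStream E ω (j + 1)).length ∂(law n κ a) ≤
            7 * (S.length : ℝ≥0∞) / κ * law n κ a {ω | virtualStream E ω j = S}) ∧
        -- expected recursion depth
        ∫⁻ ω, (depth E ω : ℝ≥0∞) ∂(law n κ a) ≤ ENNReal.ofReal (C * Real.log (Δ + 1)) ∧
        -- expected number of colors
        ∫⁻ ω, (numColors E ω : ℝ≥0∞) ∂(law n κ a) ≤
          ENNReal.ofReal (C * (Δ : ℝ) ^ (3 / 2 : ℝ) * Real.log (Δ + 1) ^ q) ∧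
        -- expected total memory
        ∫⁻ ω, totalMemory E ω ∂(law n κ a) ≤ ENNReal.ofReal (C * n * Real.log (Δ + 1)) := by
  -- 14400 = 10 · 18 · 10 · 8: expected depth, palette bound, a + 1, and 8^a. The two logarithms
  -- come from the depth and from the number a + 1 of thresholds. Depth and memory need only the
  -- constants 10 and 100.
  refine ⟨14400 * κ ^ 2, 2, fun n Δ E hE a ha => ?_⟩
  have hκ0 : 0 < κ := by omega
  have hΔ : Δ ≤ 4 ^ a := ha ▸ Nat.le_pow_clog (by norm_num) Δ
  have hκ1 : (1 : ℝ) ≤ (κ : ℝ) ^ 2 := by exact_mod_cast Nat.one_le_pow _ _ hκ0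
  have hL0 : 0 ≤ Real.log (Δ + 1) := Real.log_nonneg (by simp)
  have hdepth : ∫⁻ ω, (depth E ω : ℝ≥0∞) ∂(law n κ a) ≤
      ENNReal.ofReal (10 * Real.log (Δ + 1)) := by
    -- For Δ = 0 the right side is 0, but then there are no edges and the depth is 0.
    rcases Nat.eq_zero_or_pos Δ with rfl | hpos
    · have : E = [] := List.length_eq_zero_iff.mp
        (Nat.le_zero.mp (length_le_of_deg_le (D := 0) hE.deg_le))
      subst this
      simp [depth, virtualStream_nil]
    · refine (lintegral_depth_le hκ hE hΔ).trans ?_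
      have h := ENNReal.ofReal_le_ofReal (clog_add_three_le hpos)
      rwa [← ha, ENNReal.ofReal_add (by positivity) (by norm_num), ENNReal.ofReal_natCast,
        ENNReal.ofReal_ofNat] at h
  refine ⟨fun ω => isPartialColoring_output ω hκ0 hE.nodup,
    fun ω h => isColoring_output ω hκ0 hE.nodup h, ae_depth_ne_top hκ hE hΔ,
    lintegral_leftover_le hE hΔ, hdepth.trans (ENNReal.ofReal_le_ofReal ?_), ?_, ?_⟩
  · gcongr
    linarith
  · have h1 : ∫⁻ ω, (numColors E ω : ℝ≥0∞) ∂(law n κ a) ≤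
        ENNReal.ofReal (10 * Real.log (Δ + 1)) * (18 * κ ^ 2 * (a + 1) * 8 ^ a : ℕ) := by
      refine le_trans ?_ (mul_le_mul' hdepth le_rfl)
      rw [← lintegral_mul_const _ (measurable_depth hE.nodup)]
      refine lintegral_mono fun ω => ?_
      have := ENat.toENNReal_mono (numColors_le hκ0 hE hΔ ω)
      rwa [ENat.toENNReal_mul, ENat.toENNReal_coe] at this
    refine h1.trans ?_
    rw [← ENNReal.ofReal_natCast, ← ENNReal.ofReal_mul (by positivity)]
    refine ENNReal.ofReal_le_ofReal ?_
    rcases Nat.eq_zero_or_pos Δ with rfl | hpos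
    · simp
    have h2 : (a : ℝ) + 1 ≤ 10 * Real.log (Δ + 1) := by
      linarith [ha ▸ clog_add_three_le hpos]
    have h3 : (8 : ℝ) ^ a ≤ 8 * (Δ : ℝ) ^ (3 / 2 : ℝ) := ha ▸ eight_pow_clog_le hpos
    push_cast
    calc _ ≤ 10 * Real.log (Δ + 1) * (18 * κ ^ 2 * (10 * Real.log (Δ + 1)) *
          (8 * (Δ : ℝ) ^ (3 / 2 : ℝ))) := by gcongr
      _ = _ := by ring
  · calc ∫⁻ ω, totalMemory E ω ∂(law n κ a) ≤ ∫⁻ ω, 10 * n * (depth E ω : ℝ≥0∞) ∂(law n κ a) :=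
          lintegral_mono fun ω => totalMemory_le ω
      _ = 10 * n * ∫⁻ ω, (depth E ω : ℝ≥0∞) ∂(law n κ a) :=
          lintegral_const_mul _ (measurable_depth hE.nodup)
      _ ≤ ENNReal.ofReal (10 * n) * ENNReal.ofReal (10 * Real.log (Δ + 1)) := by
          rw [ENNReal.ofReal_mul (by norm_num), ENNReal.ofReal_natCast, ENNReal.ofReal_ofNat]
          gcongr
      _ = ENNReal.ofReal (100 * n * Real.log (Δ + 1)) := by
          rw [← ENNReal.ofReal_mul (by positivity)]
          congr 1
          ring
      _ ≤ _ := by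
          refine ENNReal.ofReal_le_ofReal ?_
          gcongr
          linarith
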